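/- **Setting.** Let $T>0$ and let $\eta$ be space-time white noise on $[0,T]\times\mathbb R$, i.e. a centered Gaussian process indexed by the Borel sets of finite Lebesgue measure in $[0,T]\times\mathbb R$ with $\mathrm E[\eta(A)\eta(B)]=|A\cap B|$, and let $(\mathcal F_t)$ be the filtration it generates (augmented by the null events). Let $\boldsymbol p_t(x)=(2\pi t)^{-1/2}e^{-x^2/(2t)}$. For $L\ge 1$, $t>0$ and $x,y\in[0,L]$ let $G_t(x,y)$ be the heat kernel on $[0,L]$: $$G_t(x,y)=\sum_{n\in\mathbb Z}\big(\boldsymbol p_t(x-y+2nL)+\boldsymbol p_t(x+y+2nL)\big)\quad\text{(Neumann)},$$ $$G_t(x,y)=\sum_{n\in\mathbb Z}\big(\boldsymbol p_t(x-y+2nL)-\boldsymbol p_t(x+y+2nL)\big)\quad\text{(Dirichlet)},$$ $$G_t(x,y)=\sum_{n\in\mathbb Z}\boldsymbol p_t(x-y+nL)\quad\text{(periodic)}.$$ Let $u=u_L$ be the mild solution on $[0,T]\times[0,L]$ of the parabolic Anderson model $\partial_tu=\tfrac12\partial_x^2u+u\,\eta$, $u(0)\equiv1$, with one of these three boundary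 conditions. That is, $u$ is a jointly measurable, $(\mathcal F_t)$-adapted random field with $\sup_{(t,x)\in[0,T]\times[0,L]}\mathrm E[u(t,x)^2]<\infty$ such that, for every $x\in[0,L]$, $u(0,x)=1$ a.s. and, for every $t\in(0,T]$, almost surely $$u(t,x)=\int_0^LG_t(x,y)\,dy+\int_0^t\int_0^LG_{t-s}(x,y)\,u(s,y)\,\eta(ds\,dy),$$ where the last integral is the Itô–Walsh stochastic integral. Define $$\mathcal S_{L,t}=\frac1L\int_0^L\{u(t,x)-\mathrm E[u(t,x)]\}\,dx,\qquad t\in[0,T],$$ and write $\|Z\|_k=(\mathrm E|Z|^k)^{1/k}$. **Proposition.** For every $T>0$ and every real $k\ge2$ there exists $\alpha_{T,k}>0$, depending only on $T$ and $k$, such that for each of the three boundary conditions, all $L\ge1$ and all $t_1,t_2\in[0,T]$, one has $\mathcal S_{L,t_2}-\mathcal S_{L,t_1}\in L^k(\Omega)$ and $$\|\mathcal S_{L,t_2}-\mathcal S_{L,t_1}\|_k\le\alpha_{T,k}\,|t_2-t_1|^{1/2}\,L^{-1/2}.$$ -/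

import Mathlib

open MeasureTheory ProbabilityTheory Set Filter Topology
open scoped ENNReal NNReal

noncomputable section

namespace PAM

/-- The heat kernel `p_t(x) = (2πt)^{-1/2} exp(-x²/(2t))` on the real line (used for `t > 0`). -/
def gaussKernel (t x : ℝ) : ℝ :=
  Real.exp (-x ^ 2 / (2 * t)) / Real.sqrt (2 * Real.pi * t)

/-- The three types of boundary conditions on the interval `[0, L]`. -/
inductive BoundaryCondition
  | neumann
  | dirichlet
  | periodic

/-- The heat kernel `G_t(x, y)` of `∂_t - ½ ∂_x²` on `[0, L]` with the given boundary conditions,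
for `t > 0` and `x, y ∈ [0, L]`. All series converge absolutely. -/
def heatKernel (bc : BoundaryCondition) (L t x y : ℝ) : ℝ :=
  match bc with
  | .neumann =>
      ∑' n : ℤ, (gaussKernel t (x - y + 2 * n * L) + gaussKernel t (x + y + 2 * n * L))
  | .dirichlet =>
      ∑' n : ℤ, (gaussKernel t (x - y + 2 * n * L) - gaussKernel t (x + y + 2 * n * L))
  | .periodic => ∑' n : ℤ, gaussKernel t (x - y + n * L)

/-- The space-time region `[0, t] × ℝ`; the first coordinate is time, the second is space. -/
def strip (t : ℝ) : Set (ℝ × ℝ) := Icc 0 t ×ˢ univ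

/-- The sets on which the noise is evaluated: Borel subsets of `[0, T] × ℝ` of finite Lebesgue
measure. -/
def NoiseSet (T : ℝ) : Type :=
  {A : Set (ℝ × ℝ) // MeasurableSet A ∧ A ⊆ strip T ∧ volume A < ∞}

variable {Ω : Type*} [mΩ : MeasurableSpace Ω]

/-- Space-time white noise on `[0, T] × ℝ`: a centred Gaussian process indexed by the Borel sets of
finite Lebesgue measure in `[0, T] × ℝ`, with covariance `E[η(A) η(B)] = |A ∩ B|`.
The values of `eval` at other sets play no role. -/
structure WhiteNoise (T : ℝ) (P : Measure Ω) where
  eval : Set (ℝ × ℝ) → Ω → ℝ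
  measurable_eval : ∀ A : NoiseSet T, Measurable (eval A.1)
  isGaussianProcess : IsGaussianProcess (fun A : NoiseSet T => eval A.1) P
  mean_eq_zero : ∀ A : NoiseSet T, ∫ ω, eval A.1 ω ∂P = 0
  covariance_eq : ∀ A B : NoiseSet T,
    ∫ ω, eval A.1 ω * eval B.1 ω ∂P = volume.real (A.1 ∩ B.1)

namespace WhiteNoise

variable {T : ℝ} {P : Measure Ω}

/-- The filtration generated by the noise, augmented by the null sets: `ℱ_t` is generated by the
variables `η(A)` with `A ⊆ [0, t] × ℝ` and by the events of probability zero. -/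
def filtration (η : WhiteNoise T P) : Filtration ℝ mΩ where
  seq t := (⨆ A : {A : NoiseSet T // A.1 ⊆ strip t},
      MeasurableSpace.comap (η.eval A.1.1) inferInstance) ⊔
    MeasurableSpace.generateFrom {N | MeasurableSet N ∧ P N = 0}
  mono' := by
    intro s t hst
    refine sup_le_sup_right (iSup_le fun A => ?_) _
    have hA : A.1.1 ⊆ strip t :=
      A.2.trans (Set.prod_mono (Icc_subset_Icc_right hst) subset_rfl)
    exact le_iSup (fun A : {A : NoiseSet T // A.1 ⊆ strip t} =>
      MeasurableSpace.comap (η.eval A.1.1) inferInstance) ⟨A.1, hA⟩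
  le' := by
    intro t
    refine sup_le (iSup_le fun A => (η.measurable_eval A.1).comap_le) ?_
    exact MeasurableSpace.generateFrom_le fun N hN => hN.1

/-- A simple predictable random field
`Φ(s, y) = ∑ i, X_i 1_{(a_i, b_i]}(s) 1_{A_i}(y)`, where `0 ≤ a_i ≤ b_i ≤ T`, the set `A_i` is Borel
with finite Lebesgue measure, and `X_i` is bounded and `ℱ_{a_i}`-measurable. -/
structure SimpleField (η : WhiteNoise T P) where
  card : ℕ
  left : Fin card → ℝ
  right : Fin card → ℝ
  region : Fin card → Set ℝ
  coeff : Fin card → Ω → ℝ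
  left_nonneg : ∀ i, 0 ≤ left i
  left_le_right : ∀ i, left i ≤ right i
  right_le : ∀ i, right i ≤ T
  measurableSet_region : ∀ i, MeasurableSet (region i)
  volume_region_lt_top : ∀ i, volume (region i) < ∞
  measurable_coeff : ∀ i, Measurable[η.filtration (left i)] (coeff i)
  bounded_coeff : ∀ i, ∃ C : ℝ, ∀ ω, |coeff i ω| ≤ C

namespace SimpleField

variable {η : WhiteNoise T P}

/-- The space-time rectangle `(a_i, b_i] × A_i` of the `i`-th summand. -/
def box (Φ : SimpleField η) (i : Fin Φ.card) : Set (ℝ × ℝ) :=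
  Ioc (Φ.left i) (Φ.right i) ×ˢ Φ.region i

/-- The value of a simple field at a space-time point. -/
def val (Φ : SimpleField η) (q : ℝ × ℝ) (ω : Ω) : ℝ :=
  ∑ i, (Φ.box i).indicator (fun _ => Φ.coeff i ω) q

/-- The stochastic integral `∑ i, X_i η((a_i, b_i] × A_i)` of a simple field. -/
def integral (Φ : SimpleField η) (ω : Ω) : ℝ :=
  ∑ i, Φ.coeff i ω * η.eval (Φ.box i) ω

end SimpleField

/-- `η.IsWalshIntegral Φ Y` means that the random field `Φ` is Walsh integrable and that `Y` is (a
version of) its Itô-Walsh integral `∫_{[0,T]×ℝ} Φ(s, y) η(ds dy)`: simple predictable fields converge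
to `Φ` in `L²([0, T] × ℝ × Ω)` while their stochastic integrals converge to `Y` in `L²(Ω)`. -/
def IsWalshIntegral (η : WhiteNoise T P) (Φ : ℝ × ℝ → Ω → ℝ) (Y : Ω → ℝ) : Prop :=
  ∃ Ψ : ℕ → SimpleField η,
    Tendsto (fun n => eLpNorm (fun z : (ℝ × ℝ) × Ω => (Ψ n).val z.1 z.2 - Φ z.1 z.2) 2
      ((volume.restrict (strip T)).prod P)) atTop (𝓝 0) ∧
    Tendsto (fun n => eLpNorm (fun ω => (Ψ n).integral ω - Y ω) 2 P) atTop (𝓝 0)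

end WhiteNoise

/-- `u` is a mild solution on `[0, T] × [0, L]` of `∂_t u = ½ ∂_x² u + u η`, `u(0) ≡ 1`, with the
given boundary conditions: a jointly measurable, adapted random field with
`sup_{t,x} E[u(t,x)²] < ∞` such that, for all `t ∈ (0, T]` and `x ∈ [0, L]`, almost surely
`u(t,x) = ∫_0^L G_t(x,y) dy + ∫_0^t ∫_0^L G_{t-s}(x,y) u(s,y) η(ds dy)`. -/
structure IsMildSolution {T : ℝ} {P : Measure Ω} (bc : BoundaryCondition) (η : WhiteNoise T P)
    (L : ℝ) (u : ℝ → ℝ → Ω → ℝ) : Prop where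
  measurable : Measurable (((Icc 0 T ×ˢ Icc 0 L) ×ˢ univ).indicator
    fun z : (ℝ × ℝ) × Ω => u z.1.1 z.1.2 z.2)
  adapted : ∀ t ∈ Icc 0 T, ∀ x ∈ Icc 0 L, Measurable[η.filtration t] (u t x)
  bounded : ∃ C : ℝ≥0, ∀ t ∈ Icc 0 T, ∀ x ∈ Icc 0 L, eLpNorm (u t x) 2 P ≤ C
  initial : ∀ x ∈ Icc 0 L, u 0 x =ᵐ[P] fun _ => 1
  mild : ∀ t ∈ Ioc 0 T, ∀ x ∈ Icc 0 L,
    η.IsWalshIntegral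
      (fun q ω => (Ioo 0 t ×ˢ Icc 0 L).indicator
        (fun q : ℝ × ℝ => heatKernel bc L (t - q.1) x q.2 * u q.1 q.2 ω) q)
      (fun ω => u t x ω - ∫ y in (0 : ℝ)..L, heatKernel bc L t x y)

/-- The spatial average `S_{L,t} = L⁻¹ ∫_0^L (u(t,x) - E[u(t,x)]) dx`. -/
def spatialAverage (P : Measure Ω) (L : ℝ) (u : ℝ → ℝ → Ω → ℝ) (t : ℝ) (ω : Ω) : ℝ :=
  L⁻¹ * ∫ x in (0 : ℝ)..L, (u t x ω - ∫ ω', u t x ω' ∂P)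

end PAM

end

/-!
Averaging the mild formulation over `x` and exchanging the two integrals (stochastic Fubini) gives
`L (𝒮_{t₂} - 𝒮_{t₁}) = ∫ (k_{t₂} - k_{t₁})(s, y) u(s, y) η(ds dy)` with the deterministic kernel
`k_t(s, y) = ∫_0^L G_{t-s}(x, y) dx` for `0 < s < t` (`massKernel`). For each of the boundary
conditions `G` is bounded by a sum of Gaussian densities over image charges; summing over the images
turns integrals over `[0, L]` into integrals over the line. Hence `|k_t| ≤ 2` and
`|k_{t₂} - k_{t₁}|(s, ·) ≤ 2 (t₂ - t₁) / (t₁ - s)`, and together these give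
`∬ (k_{t₂} - k_{t₁})² ≤ 24 (t₂ - t₁) L` (`lintegral_massKernel_sub_sq_le`). The exponents
`|t₂ - t₁|^{1/2} L^{-1/2}` are read off from this `L²` norm, once moments of stochastic integrals are
controlled by `L²` norms of their kernels and the moments of `u` are bounded.

*Moments of stochastic integrals.* Let `m ≥ 1` be an integer and `w` a weight on space-time with
`∫ w ≤ 1`. Then `E (∫ Φ dη)^{2m} ≤ C_m E ∫ w^{1-m} Φ^{2m}`
(`WhiteNoise.IsWalshIntegral.lintegral_pow_le`). For simple fields this is proved along the time
intervals between consecutive endpoints of the boxes. On such an interval the increment of the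
integral is, conditionally on the past, a centred Gaussian variable; expanding the `2m`-th power and
using Young's inequality gives a recursion of Grönwall type, whose growth factors multiply to at most
`exp(c ∫ w)`. This replaces the Burkholder inequality and needs no martingale theory. Simple fields
are dense among predictable fields in the weighted `L^{2m}` space (`exists_simpleField_approx`), so
the estimate extends by Fatou's lemma. For `Φ = g u` with `g` deterministic, the choice of `w` as half
the normalized density of `g²` plus half the uniform one gives
`E (∫ g u dη)^{2m} ≤ C_m (2 ‖g‖₂²)^{m-1} ∫ g² E u^{2m}`.

*Moments of the solution.* The same estimate applied to the mild formulation gives a linear Volterra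
inequality for `sup_x E u(t, x)^{2m}` with the integrable kernel `4 κ / √(t - s)`. Since these moments
are not known to be finite, it is first derived for `E [u² (|u| ∧ N)^{2m-2}]`, by splitting `u` in the
integrand into its truncation at level `N` and the remainder, and using the `2m`-th moment for the one
and the second moment for the other. These quantities are finite, so an exponential weight in time
yields a bound independent of `N`, `L` and the boundary condition
(`IsMildSolution.exists_lintegral_pow_le`).

*Stochastic Fubini.* The relation `Y = ∫ Φ dη` says that `(Φ, Y)` lies in the closure of the graph of
the integral on simple fields, a subspace of a Hilbert space, that is, in its double orthogonal
complement. Orthogonality to a fixed pair is a scalar condition, which can be averaged over a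
parameter by the ordinary Fubini theorem (`WhiteNoise.IsWalshIntegral.integral_param`).
-/

namespace PAM

/-! ### The Gaussian kernel on the line -/

lemma gaussKernel_nonneg (t x : ℝ) : 0 ≤ gaussKernel t x := by
  unfold gaussKernel; positivity

lemma gaussKernel_neg (t x : ℝ) : gaussKernel t (-x) = gaussKernel t x := by
  unfold gaussKernel; simp

lemma measurable_gaussKernel : Measurable fun p : ℝ × ℝ => gaussKernel p.1 p.2 := by
  unfold gaussKernel; fun_prop

lemma gaussKernel_eq_gaussianPDFReal {t : ℝ} (ht : 0 < t) (x : ℝ) :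
    gaussKernel t x = gaussianPDFReal 0 ⟨t, ht.le⟩ x := by
  simp only [gaussKernel, gaussianPDFReal, sub_zero]
  exact div_eq_inv_mul _ _

lemma integrable_gaussKernel {t : ℝ} (ht : 0 < t) : Integrable (gaussKernel t) := by
  have : gaussKernel t = gaussianPDFReal 0 ⟨t, ht.le⟩ :=
    funext fun x => gaussKernel_eq_gaussianPDFReal ht x
  rw [this]
  exact integrable_gaussianPDFReal _ _

lemma integral_gaussKernel {t : ℝ} (ht : 0 < t) : ∫ x, gaussKernel t x = 1 := by
  have : gaussKernel t = gaussianPDFReal 0 ⟨t, ht.le⟩ :=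
    funext fun x => gaussKernel_eq_gaussianPDFReal ht x
  rw [this]
  exact integral_gaussianPDFReal_eq_one _ (fun h => ht.ne' (congrArg NNReal.toReal h))

lemma lintegral_gaussKernel {t : ℝ} (ht : 0 < t) :
    ∫⁻ x, ENNReal.ofReal (gaussKernel t x) = 1 := by
  rw [← ofReal_integral_eq_lintegral_ofReal (integrable_gaussKernel ht)
    (ae_of_all _ fun x => gaussKernel_nonneg t x), integral_gaussKernel ht, ENNReal.ofReal_one]

lemma gaussKernel_le_mul {s t : ℝ} (hs : 0 < s) (hst : s ≤ t) (x : ℝ) :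
    gaussKernel s x ≤ √(t / s) * gaussKernel t x := by
  have ht := hs.trans_le hst
  have h1 : √(t / s) * gaussKernel t x
      = Real.exp (-x ^ 2 / (2 * t)) / √(2 * Real.pi * s) := by
    unfold gaussKernel
    have e : √(2 * Real.pi * t) = √(t / s) * √(2 * Real.pi * s) := by
      rw [← Real.sqrt_mul (by positivity)]; congr 1; field_simp
    have h2 : √(t / s) ≠ 0 := by positivity
    have h3 : √(2 * Real.pi * s) ≠ 0 := by positivity
    rw [e]; field_simp
  rw [h1]
  unfold gaussKernel
  gcongr ?_ / _
  apply Real.exp_le_exp.2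
  rw [neg_div, neg_div, neg_le_neg_iff]
  gcongr

/-- The total variation distance between two centred Gaussian densities is controlled by the
relative difference of the variances: the density with the smaller variance is dominated by a
multiple, close to one, of the other. -/
lemma lintegral_gaussKernel_sub_le {s δ : ℝ} (hs : 0 < s) (hδ : 0 ≤ δ) :
    ∫⁻ x, ENNReal.ofReal |gaussKernel (s + δ) x - gaussKernel s x| ≤ ENNReal.ofReal (δ / s) := by
  have hsd : 0 < s + δ := by positivity
  have hi1 := integrable_gaussKernel hs
  have hi2 := integrable_gaussKernel hsd
  have hroot : √((s + δ) / s) ≤ 1 + δ / s / 2 := by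
    rw [show (s + δ) / s = 1 + δ / s by field_simp]
    have : 0 ≤ δ / s := by positivity
    rw [Real.sqrt_le_left (by positivity)]
    nlinarith
  have hpt : ∀ x, |gaussKernel (s + δ) x - gaussKernel s x|
      ≤ δ / s * gaussKernel (s + δ) x + (gaussKernel (s + δ) x - gaussKernel s x) := by
    intro x
    have h1 := gaussKernel_le_mul hs (le_add_of_nonneg_right hδ : s ≤ s + δ) x
    have h2 := mul_le_mul_of_nonneg_right hroot (gaussKernel_nonneg (s + δ) x)
    have h3 : 0 ≤ δ / s * gaussKernel (s + δ) x :=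
      mul_nonneg (by positivity) (gaussKernel_nonneg _ _)
    rw [abs_le]
    constructor <;> nlinarith
  have hi : Integrable fun x => |gaussKernel (s + δ) x - gaussKernel s x| := (hi2.sub hi1).abs
  rw [← ofReal_integral_eq_lintegral_ofReal hi (ae_of_all _ fun x => abs_nonneg _)]
  apply ENNReal.ofReal_le_ofReal
  calc ∫ x, |gaussKernel (s + δ) x - gaussKernel s x|
      ≤ ∫ x, (δ / s * gaussKernel (s + δ) x + (gaussKernel (s + δ) x - gaussKernel s x)) :=
        integral_mono (hi2.sub hi1).abs ((hi2.const_mul _).add (hi2.sub hi1)) hpt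
    _ = δ / s := by
        have hsub : Integrable fun x => gaussKernel (s + δ) x - gaussKernel s x := hi2.sub hi1
        rw [integral_add (hi2.const_mul _) hsub, integral_const_mul, integral_sub hi2 hi1,
          integral_gaussKernel hs, integral_gaussKernel hsd]
        ring

/-! ### Periodization -/

/-- Summing a function over the translates of a period cell recovers its integral over the line. -/
lemma lintegral_tsum_translate {q : ℝ → ℝ≥0∞} (hq : Measurable q) {a : ℝ} (ha : 0 < a) (c : ℝ) :
    ∫⁻ x in Icc 0 a, ∑' n : ℤ, q (x + c + n * a) = ∫⁻ x, q x := by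
  rw [lintegral_tsum (fun n => by fun_prop)]
  have h1 : ∀ n : ℤ, ∫⁻ x in Icc 0 a, q (x + c + n * a)
      = ∫⁻ x in Ioc (c + n • a) (c + (n + 1) • a), q x := by
    intro n
    rw [setLIntegral_congr Ioc_ae_eq_Icc.symm]
    have hmp := measurePreserving_add_right (volume : Measure ℝ) (c + n * a)
    have := hmp.setLIntegral_comp_preimage
      (measurableSet_Ioc : MeasurableSet (Ioc (c + n • a) (c + (n + 1) • a))) hq
    rw [← this]
    congr 1
    · congr 1
      ext x
      simp only [mem_preimage, mem_Ioc, zsmul_eq_mul, Int.cast_add, Int.cast_one]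
      constructor <;> rintro ⟨h1, h2⟩ <;> constructor <;> linarith
    · ext x; congr 1; ring
  simp_rw [h1]
  rw [← lintegral_iUnion (fun n => measurableSet_Ioc)
    (by simpa using pairwise_disjoint_Ioc_add_zsmul c a), iUnion_Ioc_add_zsmul ha,
    setLIntegral_univ]

/-- The periodization of an even function `q` against both image charges `x - y` and `x + y`,
an upper bound for the heat kernels on the interval when `q` is a Gaussian density. -/
noncomputable def imageSum (q : ℝ → ℝ≥0∞) (a x y : ℝ) : ℝ≥0∞ :=
  (∑' n : ℤ, q (x - y + n * a)) + ∑' n : ℤ, q (x + y + n * a)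

lemma imageSum_comm {q : ℝ → ℝ≥0∞} (hq : ∀ x, q (-x) = q x) (a x y : ℝ) :
    imageSum q a x y = imageSum q a y x := by
  unfold imageSum
  rw [add_comm x y]
  congr 1
  rw [← (Equiv.neg ℤ).tsum_eq]
  refine tsum_congr fun n => ?_
  rw [← hq]
  congr 1
  simp only [Equiv.neg_apply, Int.cast_neg]
  ring

/-- The image charges `x - y + n a` fill the line once as `x` ranges over a period, and so do the
charges `x + y + n a`. -/
lemma lintegral_imageSum_left_le {q : ℝ → ℝ≥0∞} (hq : Measurable q) {L a : ℝ}
    (ha : 0 < a) (hL : L ≤ a) (y : ℝ) :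
    ∫⁻ x in Icc 0 L, imageSum q a x y ≤ 2 * ∫⁻ x, q x := by
  unfold imageSum
  refine (lintegral_mono_set (Icc_subset_Icc_right hL)).trans ?_
  rw [lintegral_add_left (Measurable.tsum fun n => by fun_prop)]
  have h1 := lintegral_tsum_translate hq ha (-y)
  have h2 := lintegral_tsum_translate hq ha y
  simp_rw [← sub_eq_add_neg] at h1
  rw [h1, h2, two_mul]

/-! ### The heat kernels on the interval -/

/-- The spatial period of the heat kernel with the given boundary conditions. -/
def BoundaryCondition.period (bc : BoundaryCondition) (L : ℝ) : ℝ :=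
  match bc with
  | .neumann => 2 * L
  | .dirichlet => 2 * L
  | .periodic => L

/-- The weight of the image charges at `-y + 2nL`. -/
def BoundaryCondition.imageSign (bc : BoundaryCondition) : ℝ :=
  match bc with
  | .neumann => 1
  | .dirichlet => -1
  | .periodic => 0

lemma BoundaryCondition.abs_imageSign_le (bc : BoundaryCondition) : |bc.imageSign| ≤ 1 := by
  cases bc <;> simp [imageSign]

lemma BoundaryCondition.le_period (bc : BoundaryCondition) {L : ℝ} (hL : 0 ≤ L) :
    L ≤ bc.period L := by
  cases bc <;> simp [period] <;> linarith

lemma summable_exp_neg_mul_sq {c : ℝ} (hc : 0 < c) :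
    Summable fun n : ℤ => Real.exp (-c * (n : ℝ) ^ 2) := by
  have key : Summable fun n : ℕ => Real.exp (-c * (n : ℝ) ^ 2) := by
    refine Summable.of_nonneg_of_le (fun n => (Real.exp_pos _).le) (fun n => ?_)
      (Real.summable_exp_nat_mul_iff.2 (neg_lt_zero.2 hc))
    apply Real.exp_le_exp.2
    have : (n : ℝ) ≤ (n : ℝ) ^ 2 := by exact_mod_cast Nat.le_self_pow two_ne_zero n
    nlinarith
  exact Summable.of_nat_of_neg (by simpa using key) (by simpa using key)

lemma gaussKernel_translate_le {t : ℝ} (ht : 0 < t) {a : ℝ} (ha : 1 ≤ a) (z : ℝ) (n : ℤ) :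
    gaussKernel t (z + n * a)
      ≤ Real.exp (z ^ 2 / (2 * t)) / √(2 * Real.pi * t) * Real.exp (-(1 / (4 * t)) * (n : ℝ) ^ 2) := by
  unfold gaussKernel
  rw [div_mul_eq_mul_div, ← Real.exp_add]
  gcongr ?_ / _
  apply Real.exp_le_exp.2
  have h : (n : ℝ) ^ 2 / 2 - z ^ 2 ≤ (z + n * a) ^ 2 := by
    have h1 : (n : ℝ) ^ 2 ≤ (n * a) ^ 2 := by
      rw [mul_pow]; exact le_mul_of_one_le_right (sq_nonneg _) (one_le_pow₀ ha)
    nlinarith [sq_nonneg (n * a + 2 * z)]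
  have e : z ^ 2 / (2 * t) + -(1 / (4 * t)) * (n : ℝ) ^ 2
      = -((n : ℝ) ^ 2 / 2 - z ^ 2) / (2 * t) := by field_simp; ring
  rw [e]
  gcongr

lemma summable_gaussKernel_translate {t : ℝ} (ht : 0 < t) {a : ℝ} (ha : 1 ≤ a) (z : ℝ) :
    Summable fun n : ℤ => gaussKernel t (z + n * a) :=
  Summable.of_nonneg_of_le (fun _ => gaussKernel_nonneg _ _)
    (fun n => gaussKernel_translate_le ht ha z n)
    ((summable_exp_neg_mul_sq (by positivity)).mul_left _)

/-- A constant for the uniform bound on the periodized Gaussian kernel up to time `T`. -/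
noncomputable def kernelConst (T : ℝ) : ℝ :=
  Real.exp (2 / T) * ∑' n : ℤ, Real.exp (-(1 / (4 * T)) * (n : ℝ) ^ 2)

lemma kernelConst_nonneg (T : ℝ) : 0 ≤ kernelConst T :=
  mul_nonneg (Real.exp_pos _).le (tsum_nonneg fun _ => (Real.exp_pos _).le)

/-- The number `2L` in the hypothesis bounds both `|x - y|` and `|x + y|` for `x, y ∈ [0, L]`. The
`n`-th translate is estimated through `(z + n a)² ≥ (n² / 2 - 4) L²`. -/
lemma tsum_gaussKernel_translate_le {T t : ℝ} (ht : 0 < t) (htT : t ≤ T) {L a : ℝ} (hL : 1 ≤ L)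
    (ha : L ≤ a) {z : ℝ} (hz : |z| ≤ 2 * L) :
    ∑' n : ℤ, gaussKernel t (z + n * a) ≤ kernelConst T / √t := by
  have hT := ht.trans_le htT
  have hs := summable_exp_neg_mul_sq (c := 1 / (4 * T)) (by positivity)
  rw [kernelConst, mul_div_right_comm, ← tsum_mul_left]
  refine (summable_gaussKernel_translate ht (hL.trans ha) z).tsum_le_tsum (fun n => ?_)
    (hs.mul_left _)
  unfold gaussKernel
  rw [div_mul_eq_mul_div, ← Real.exp_add]
  have e : 2 / T + -(1 / (4 * T)) * (n : ℝ) ^ 2 = -((n : ℝ) ^ 2 / 2 - 4) / (2 * T) := by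
    field_simp; ring
  rw [e]
  have hden : √t ≤ √(2 * Real.pi * t) := by
    apply Real.sqrt_le_sqrt
    nlinarith [Real.pi_gt_three]
  refine div_le_div₀ (Real.exp_pos _).le ?_ (Real.sqrt_pos.2 ht) hden
  apply Real.exp_le_exp.2
  rcases le_total ((n : ℝ) ^ 2 / 2 - 4) 0 with h | h
  · exact (div_nonpos_of_nonpos_of_nonneg (neg_nonpos.2 (sq_nonneg _)) (by positivity)).trans
      (div_nonneg (neg_nonneg.2 h) (by positivity))
  · have h1 : (n : ℝ) ^ 2 / 2 - 4 ≤ (z + n * a) ^ 2 := by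
      have hz2 : z ^ 2 ≤ 4 * L ^ 2 := by
        have := sq_le_sq' (by linarith [abs_nonneg z]) hz
        rw [sq_abs] at this; nlinarith
      have hna : (n : ℝ) ^ 2 * L ^ 2 ≤ (n * a) ^ 2 := by
        rw [mul_pow]; gcongr
      have hL2 : 1 ≤ L ^ 2 := one_le_pow₀ hL
      nlinarith [sq_nonneg (n * a + 2 * z)]
    rw [neg_div, neg_div, neg_le_neg_iff]
    gcongr

lemma heatKernel_eq (bc : BoundaryCondition) {L t : ℝ} (hL : 1 ≤ L) (ht : 0 < t) (x y : ℝ) :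
    heatKernel bc L t x y = (∑' n : ℤ, gaussKernel t (x - y + n * bc.period L))
      + bc.imageSign * ∑' n : ℤ, gaussKernel t (x + y + n * bc.period L) := by
  have hs := fun z => summable_gaussKernel_translate ht (a := 2 * L) (by linarith) z
  have e : ∀ n : ℤ, 2 * (n : ℝ) * L = n * (2 * L) := fun n => by ring
  cases bc
  · simp only [heatKernel, BoundaryCondition.period, BoundaryCondition.imageSign, one_mul, e]
    exact (hs _).tsum_add (hs _)
  · simp only [heatKernel, BoundaryCondition.period, BoundaryCondition.imageSign, e,
      neg_one_mul, ← sub_eq_add_neg]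
    exact (hs _).tsum_sub (hs _)
  · simp [heatKernel, BoundaryCondition.period, BoundaryCondition.imageSign]

/-- At nonpositive times the kernel takes the value zero, since `gaussKernel` then divides by
`√(2πt) = 0`. -/
lemma heatKernel_of_nonpos (bc : BoundaryCondition) {L t : ℝ} (ht : t ≤ 0) (x y : ℝ) :
    heatKernel bc L t x y = 0 := by
  have h : ∀ z, gaussKernel t z = 0 := fun z => by
    have : √(2 * Real.pi * t) = 0 :=
      Real.sqrt_eq_zero_of_nonpos (mul_nonpos_of_nonneg_of_nonpos (by positivity) ht)
    simp [gaussKernel, this]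
  cases bc <;> simp [heatKernel, h]

lemma measurable_heatKernel (bc : BoundaryCondition) {L : ℝ} (hL : 1 ≤ L) :
    Measurable fun p : ℝ × ℝ × ℝ => heatKernel bc L p.1 p.2.1 p.2.2 := by
  have hL0 := zero_le_one.trans hL
  have hg : ∀ f : ℝ × ℝ × ℝ → ℝ, Measurable f → Measurable fun p : ℝ × ℝ × ℝ =>
      (∑' n : ℤ, ENNReal.ofReal (gaussKernel p.1 (f p + n * bc.period L))).toReal := by
    intro f hf
    refine (Measurable.tsum fun n => ?_).ennreal_toReal
    refine (measurable_gaussKernel.comp (measurable_fst.prodMk ?_)).ennreal_ofReal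
    fun_prop
  have h := ((hg (fun p => p.2.1 - p.2.2) (by fun_prop)).add
    ((hg (fun p => p.2.1 + p.2.2) (by fun_prop)).const_mul bc.imageSign))
  convert! Measurable.indicator h (measurableSet_lt measurable_const measurable_fst) using 1
  ext ⟨t, x, y⟩
  by_cases ht : 0 < t
  · rw [indicator_of_mem (by exact ht)]
    have hts : ∀ z, (∑' n : ℤ, ENNReal.ofReal (gaussKernel t (z + n * bc.period L))).toReal
        = ∑' n : ℤ, gaussKernel t (z + n * bc.period L) := by
      intro z
      rw [ENNReal.tsum_toReal_eq (fun n => ENNReal.ofReal_ne_top)]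
      exact tsum_congr fun n => ENNReal.toReal_ofReal (gaussKernel_nonneg _ _)
    simp only [Pi.add_apply, hts]
    exact heatKernel_eq bc hL ht x y
  · rw [indicator_of_notMem (by exact ht)]
    exact heatKernel_of_nonpos bc (not_lt.1 ht) x y

lemma measurable_heatKernel_comp {α : Type*} [MeasurableSpace α] (bc : BoundaryCondition) {L : ℝ}
    (hL : 1 ≤ L) {f g h : α → ℝ} (hf : Measurable f) (hg : Measurable g) (hh : Measurable h) :
    Measurable fun a => heatKernel bc L (f a) (g a) (h a) :=
  Measurable.comp (g := fun p : ℝ × ℝ × ℝ => heatKernel bc L p.1 p.2.1 p.2.2)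
    (f := fun a => (f a, g a, h a)) (measurable_heatKernel bc hL) (hf.prodMk (hg.prodMk hh))

lemma ofReal_abs_heatKernel_le (bc : BoundaryCondition) {L t : ℝ} (hL : 1 ≤ L) (ht : 0 < t)
    (x y : ℝ) : ENNReal.ofReal |heatKernel bc L t x y|
      ≤ imageSum (fun z => ENNReal.ofReal (gaussKernel t z)) (bc.period L) x y := by
  have ha := hL.trans (bc.le_period (zero_le_one.trans hL))
  have hs := fun z => summable_gaussKernel_translate ht ha z
  have h0 : ∀ z, 0 ≤ ∑' n : ℤ, gaussKernel t (z + n * bc.period L) := fun z =>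
    tsum_nonneg fun n => gaussKernel_nonneg _ _
  rw [imageSum, ← ENNReal.ofReal_tsum_of_nonneg (fun n => gaussKernel_nonneg _ _) (hs _),
    ← ENNReal.ofReal_tsum_of_nonneg (fun n => gaussKernel_nonneg _ _) (hs _),
    ← ENNReal.ofReal_add (h0 _) (h0 _), heatKernel_eq bc hL ht]
  apply ENNReal.ofReal_le_ofReal
  refine (abs_add_le _ _).trans ?_
  rw [abs_mul, abs_of_nonneg (h0 _), abs_of_nonneg (h0 _)]
  gcongr
  exact mul_le_of_le_one_left (h0 _) bc.abs_imageSign_le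

lemma ofReal_abs_heatKernel_sub_le (bc : BoundaryCondition) {L s t : ℝ} (hL : 1 ≤ L) (hs : 0 < s)
    (ht : 0 < t) (x y : ℝ) :
    ENNReal.ofReal |heatKernel bc L t x y - heatKernel bc L s x y|
      ≤ imageSum (fun z => ENNReal.ofReal |gaussKernel t z - gaussKernel s z|)
        (bc.period L) x y := by
  have ha := hL.trans (bc.le_period (zero_le_one.trans hL))
  have hsu := fun z => (summable_gaussKernel_translate ht ha z).sub
    (summable_gaussKernel_translate hs ha z)
  have hsa := fun z => (hsu z).abs
  have h0 : ∀ z, 0 ≤ ∑' n : ℤ,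
      |gaussKernel t (z + n * bc.period L) - gaussKernel s (z + n * bc.period L)| := fun z =>
    tsum_nonneg fun n => abs_nonneg _
  have hle : ∀ z, |(∑' n : ℤ, gaussKernel t (z + n * bc.period L))
      - ∑' n : ℤ, gaussKernel s (z + n * bc.period L)| ≤
      ∑' n : ℤ, |gaussKernel t (z + n * bc.period L) - gaussKernel s (z + n * bc.period L)| := by
    intro z
    rw [← (summable_gaussKernel_translate ht ha z).tsum_sub
      (summable_gaussKernel_translate hs ha z)]
    have := norm_tsum_le_tsum_norm (f := fun n : ℤ => gaussKernel t (z + n * bc.period L)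
      - gaussKernel s (z + n * bc.period L)) (hsa z)
    simpa only [Real.norm_eq_abs] using this
  rw [imageSum, ← ENNReal.ofReal_tsum_of_nonneg (fun n => abs_nonneg _) (hsa _),
    ← ENNReal.ofReal_tsum_of_nonneg (fun n => abs_nonneg _) (hsa _),
    ← ENNReal.ofReal_add (h0 _) (h0 _), heatKernel_eq bc hL ht, heatKernel_eq bc hL hs]
  apply ENNReal.ofReal_le_ofReal
  rw [add_sub_add_comm, ← mul_sub]
  refine (abs_add_le _ _).trans (add_le_add (hle _) ?_)
  rw [abs_mul]
  exact (mul_le_of_le_one_left (abs_nonneg _) bc.abs_imageSign_le).trans (hle _)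

lemma abs_heatKernel_le (bc : BoundaryCondition) {T L t : ℝ} (hL : 1 ≤ L) (ht : 0 < t)
    (htT : t ≤ T) {x y : ℝ} (hx : x ∈ Icc 0 L) (hy : y ∈ Icc 0 L) :
    |heatKernel bc L t x y| ≤ 2 * kernelConst T / √t := by
  have hp := bc.le_period (zero_le_one.trans hL)
  have h0 : ∀ z, 0 ≤ ∑' n : ℤ, gaussKernel t (z + n * bc.period L) := fun z =>
    tsum_nonneg fun n => gaussKernel_nonneg _ _
  have h1 : ∑' n : ℤ, gaussKernel t (x - y + n * bc.period L) ≤ kernelConst T / √t :=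
    tsum_gaussKernel_translate_le ht htT hL hp
      (abs_le.2 ⟨by linarith [hx.1, hy.2], by linarith [hx.2, hy.1]⟩)
  have h2 : ∑' n : ℤ, gaussKernel t (x + y + n * bc.period L) ≤ kernelConst T / √t :=
    tsum_gaussKernel_translate_le ht htT hL hp
      (abs_le.2 ⟨by linarith [hx.1, hy.1], by linarith [hx.2, hy.2]⟩)
  rw [heatKernel_eq bc hL ht]
  refine (abs_add_le _ _).trans ?_
  rw [abs_mul, abs_of_nonneg (h0 _), abs_of_nonneg (h0 _), mul_div_assoc, two_mul]
  exact add_le_add h1 ((mul_le_of_le_one_left (h0 _) bc.abs_imageSign_le).trans h2)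

lemma lintegral_heatKernel_left_le (bc : BoundaryCondition) {L t : ℝ} (hL : 1 ≤ L) (ht : 0 < t)
    (y : ℝ) : ∫⁻ x in Icc 0 L, ENNReal.ofReal |heatKernel bc L t x y| ≤ 2 := by
  have hp := bc.le_period (zero_le_one.trans hL)
  refine (lintegral_mono fun x => ofReal_abs_heatKernel_le bc hL ht x y).trans ?_
  refine (lintegral_imageSum_left_le ?_ (by linarith) hp y).trans ?_
  · exact (measurable_gaussKernel.comp (measurable_const.prodMk measurable_id)).ennreal_ofReal
  · rw [lintegral_gaussKernel ht, mul_one]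

lemma lintegral_heatKernel_right_le (bc : BoundaryCondition) {L t : ℝ} (hL : 1 ≤ L) (ht : 0 < t)
    (x : ℝ) : ∫⁻ y in Icc 0 L, ENNReal.ofReal |heatKernel bc L t x y| ≤ 2 := by
  have hp := bc.le_period (zero_le_one.trans hL)
  refine (lintegral_mono fun y => ofReal_abs_heatKernel_le bc hL ht x y).trans ?_
  simp_rw [imageSum_comm (q := fun z => ENNReal.ofReal (gaussKernel t z))
    (fun z => by rw [gaussKernel_neg]) _ x]
  refine (lintegral_imageSum_left_le ?_ (by linarith) hp x).trans ?_
  · exact (measurable_gaussKernel.comp (measurable_const.prodMk measurable_id)).ennreal_ofReal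
  · rw [lintegral_gaussKernel ht, mul_one]

/-- Uniform bound times `L¹` bound. -/
lemma lintegral_heatKernel_sq_le (bc : BoundaryCondition) {T L t : ℝ} (hL : 1 ≤ L) (ht : 0 < t)
    (htT : t ≤ T) {x : ℝ} (hx : x ∈ Icc 0 L) :
    ∫⁻ y in Icc 0 L, ENNReal.ofReal (heatKernel bc L t x y ^ 2)
      ≤ ENNReal.ofReal (4 * kernelConst T / √t) := by
  have hm : Measurable fun y => heatKernel bc L t x y :=
    measurable_heatKernel_comp bc hL measurable_const measurable_const measurable_id
  calc ∫⁻ y in Icc 0 L, ENNReal.ofReal (heatKernel bc L t x y ^ 2)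
      ≤ ∫⁻ y in Icc 0 L, ENNReal.ofReal (2 * kernelConst T / √t)
          * ENNReal.ofReal |heatKernel bc L t x y| := by
        refine setLIntegral_mono (by fun_prop) fun y hy => ?_
        rw [← ENNReal.ofReal_mul (by have := kernelConst_nonneg T; positivity), ← sq_abs, sq]
        exact ENNReal.ofReal_le_ofReal (mul_le_mul_of_nonneg_right
          (abs_heatKernel_le bc hL ht htT hx hy) (abs_nonneg _))
    _ ≤ ENNReal.ofReal (2 * kernelConst T / √t) * 2 := by
        rw [lintegral_const_mul _ (by fun_prop)]
        gcongr
        exact lintegral_heatKernel_right_le bc hL ht x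
    _ = ENNReal.ofReal (4 * kernelConst T / √t) := by
        rw [show (2 : ℝ≥0∞) = ENNReal.ofReal 2 by simp, ← ENNReal.ofReal_mul' (by norm_num)]
        congr 1; ring

lemma integrableOn_heatKernel_left (bc : BoundaryCondition) {L t : ℝ} (hL : 1 ≤ L) (ht : 0 < t)
    (y : ℝ) : IntegrableOn (fun x => heatKernel bc L t x y) (Icc 0 L) := by
  have hm : Measurable fun x => heatKernel bc L t x y :=
    measurable_heatKernel_comp bc hL measurable_const measurable_id measurable_const
  refine ⟨hm.aestronglyMeasurable, ?_⟩
  rw [hasFiniteIntegral_iff_norm]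
  exact (lintegral_heatKernel_left_le bc hL ht y).trans_lt (by simp)

lemma abs_integral_heatKernel_right_le (bc : BoundaryCondition) {L t : ℝ} (hL : 1 ≤ L)
    (ht : 0 < t) (x : ℝ) : |∫ y in (0 : ℝ)..L, heatKernel bc L t x y| ≤ 2 := by
  rw [intervalIntegral.integral_of_le (by linarith), ← integral_Icc_eq_integral_Ioc,
    ← Real.norm_eq_abs]
  refine (norm_integral_le_lintegral_norm _).trans ?_
  refine ENNReal.toReal_le_of_le_ofReal (by norm_num) ?_
  simpa using lintegral_heatKernel_right_le bc hL ht x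

/-- The mass `∫_0^L G_t(x, y) dx` of the heat kernel with respect to its first variable. -/
noncomputable def heatMass (bc : BoundaryCondition) (L t y : ℝ) : ℝ :=
  ∫ x in (0 : ℝ)..L, heatKernel bc L t x y

lemma heatMass_eq (bc : BoundaryCondition) {L : ℝ} (hL : 1 ≤ L) (t y : ℝ) :
    heatMass bc L t y = ∫ x in Icc 0 L, heatKernel bc L t x y := by
  rw [heatMass, intervalIntegral.integral_of_le (by linarith), integral_Icc_eq_integral_Ioc]

lemma measurable_heatMass (bc : BoundaryCondition) {L : ℝ} (hL : 1 ≤ L) :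
    Measurable fun p : ℝ × ℝ => heatMass bc L p.1 p.2 := by
  simp_rw [heatMass_eq bc hL]
  have : Measurable fun q : (ℝ × ℝ) × ℝ => heatKernel bc L q.1.1 q.2 q.1.2 :=
    measurable_heatKernel_comp bc hL (by fun_prop) (by fun_prop) (by fun_prop)
  exact (this.stronglyMeasurable.integral_prod_right (ν := volume.restrict (Icc 0 L))).measurable

lemma abs_heatMass_le (bc : BoundaryCondition) {L : ℝ} (hL : 1 ≤ L) (t y : ℝ) :
    |heatMass bc L t y| ≤ 2 := by
  rcases le_or_gt t 0 with ht | ht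
  · simp [heatMass, heatKernel_of_nonpos bc ht]
  rw [heatMass_eq bc hL, ← Real.norm_eq_abs]
  refine (norm_integral_le_lintegral_norm _).trans ?_
  refine ENNReal.toReal_le_of_le_ofReal (by norm_num) ?_
  simpa using lintegral_heatKernel_left_le bc hL ht y

/-- The time regularity of the heat mass, inherited from the total variation distance between two
Gaussian densities. -/
lemma abs_heatMass_add_sub_le (bc : BoundaryCondition) {L : ℝ} (hL : 1 ≤ L) {s δ : ℝ} (hs : 0 < s)
    (hδ : 0 ≤ δ) (y : ℝ) :
    |heatMass bc L (s + δ) y - heatMass bc L s y| ≤ 2 * (δ / s) := by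
  have hp := bc.le_period (zero_le_one.trans hL)
  have hsd : 0 < s + δ := by positivity
  rw [heatMass_eq bc hL, heatMass_eq bc hL, ← integral_sub
    (integrableOn_heatKernel_left bc hL hsd y) (integrableOn_heatKernel_left bc hL hs y),
    ← Real.norm_eq_abs]
  refine (norm_integral_le_lintegral_norm _).trans ?_
  refine ENNReal.toReal_le_of_le_ofReal (by positivity) ?_
  simp_rw [Real.norm_eq_abs]
  refine (lintegral_mono fun x => ofReal_abs_heatKernel_sub_le bc hL hs hsd x y).trans ?_
  refine (lintegral_imageSum_left_le ?_ (by linarith) hp y).trans ?_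
  · exact ((measurable_gaussKernel.comp (measurable_const.prodMk measurable_id)).sub
      (measurable_gaussKernel.comp (measurable_const.prodMk measurable_id))).abs.ennreal_ofReal
  · rw [ENNReal.ofReal_mul (by norm_num)]
    simpa using mul_le_mul_right (lintegral_gaussKernel_sub_le hs hδ) 2

/-! ### White noise -/

lemma isNoiseSet_box {T a b : ℝ} {A : Set ℝ} (ha : 0 ≤ a) (hb : b ≤ T) (hA : MeasurableSet A)
    (hA' : volume A < ∞) : MeasurableSet (Ioc a b ×ˢ A) ∧ Ioc a b ×ˢ A ⊆ strip T ∧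
      volume (Ioc a b ×ˢ A) < ∞ := by
  refine ⟨measurableSet_Ioc.prod hA, ?_, ?_⟩
  · rintro ⟨s, y⟩ ⟨h1, -⟩
    exact ⟨⟨ha.trans h1.1.le, h1.2.trans hb⟩, mem_univ _⟩
  · rw [Measure.volume_eq_prod, Measure.prod_prod, Real.volume_Ioc]
    exact ENNReal.mul_lt_top ENNReal.ofReal_lt_top hA'

namespace WhiteNoise

variable {Ω : Type*} [mΩ : MeasurableSpace Ω] {T : ℝ} {P : Measure Ω}

/-- Gaussian variables exist only on probability spaces. -/
lemma isProbabilityMeasure (η : WhiteNoise T P) : IsProbabilityMeasure P :=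
  η.3.isProbabilityMeasure

lemma memLp_eval (η : WhiteNoise T P) (A : NoiseSet T) : MemLp (η.eval A.1) 2 P :=
  (η.3.hasGaussianLaw_eval A).memLp_two

lemma integrable_eval_mul (η : WhiteNoise T P) (A B : NoiseSet T) :
    Integrable (fun ω => η.eval A.1 ω * η.eval B.1 ω) P :=
  (η.memLp_eval A).integrable_mul (η.memLp_eval B)

/-- White noise is finitely additive, up to null sets: the variance of
`η(A ∪ B) - η(A) - η(B)` vanishes. -/
lemma eval_union (η : WhiteNoise T P) {A B : Set (ℝ × ℝ)}
    (hA : MeasurableSet A ∧ A ⊆ strip T ∧ volume A < ∞)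
    (hB : MeasurableSet B ∧ B ⊆ strip T ∧ volume B < ∞) (hd : Disjoint A B) :
    η.eval (A ∪ B) =ᵐ[P] fun ω => η.eval A ω + η.eval B ω := by
  have hAB : MeasurableSet (A ∪ B) ∧ A ∪ B ⊆ strip T ∧ volume (A ∪ B) < ∞ :=
    ⟨hA.1.union hB.1, union_subset hA.2.1 hB.2.1,
      (measure_union_le _ _).trans_lt (ENNReal.add_lt_top.2 ⟨hA.2.2, hB.2.2⟩)⟩
  let C : Fin 3 → NoiseSet T := ![⟨A ∪ B, hAB⟩, ⟨A, hA⟩, ⟨B, hB⟩]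
  have hi := fun i j => η.integrable_eval_mul (C i) (C j)
  have hc := fun i j => η.covariance_eq (C i) (C j)
  have e : ∀ ω, (η.eval (A ∪ B) ω - (η.eval A ω + η.eval B ω)) ^ 2
      = (η.eval (C 0).1 ω * η.eval (C 0).1 ω + η.eval (C 1).1 ω * η.eval (C 1).1 ω
        + η.eval (C 2).1 ω * η.eval (C 2).1 ω + 2 * (η.eval (C 1).1 ω * η.eval (C 2).1 ω))
        - (2 * (η.eval (C 0).1 ω * η.eval (C 1).1 ω)
          + 2 * (η.eval (C 0).1 ω * η.eval (C 2).1 ω)) := by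
    intro ω; simp [C]; ring
  have hint : Integrable (fun ω => (η.eval (A ∪ B) ω - (η.eval A ω + η.eval B ω)) ^ 2) P := by
    simp_rw [e]
    exact ((((hi 0 0).add (hi 1 1)).add (hi 2 2)).add ((hi 1 2).const_mul 2)).sub
      (((hi 0 1).const_mul 2).add ((hi 0 2).const_mul 2))
  have h0 : ∫ ω, (η.eval (A ∪ B) ω - (η.eval A ω + η.eval B ω)) ^ 2 ∂P = 0 := by
    simp_rw [e]
    rw [integral_sub, integral_add, integral_add, integral_add, integral_add, integral_const_mul,
      integral_const_mul, integral_const_mul, hc, hc, hc, hc, hc, hc]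
    · have e1 : (A ∪ B) ∩ A = A := union_inter_cancel_left
      have e2 : (A ∪ B) ∩ B = B := union_inter_cancel_right
      simp only [C, Matrix.cons_val, inter_self, e1, e2,
        hd.inter_eq, measureReal_empty]
      rw [measureReal_union hd hB.1 hA.2.2.ne hB.2.2.ne]
      ring
    · exact (hi 0 1).const_mul 2
    · exact (hi 0 2).const_mul 2
    · exact hi 0 0
    · exact hi 1 1
    · exact (hi 0 0).add (hi 1 1)
    · exact hi 2 2
    · exact ((hi 0 0).add (hi 1 1)).add (hi 2 2)
    · exact (hi 1 2).const_mul 2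
    · exact (((hi 0 0).add (hi 1 1)).add (hi 2 2)).add ((hi 1 2).const_mul 2)
    · exact ((hi 0 1).const_mul 2).add ((hi 0 2).const_mul 2)
  have := (integral_eq_zero_iff_of_nonneg (fun ω => sq_nonneg _) hint).1 h0
  filter_upwards [this] with ω hω
  simpa [sub_eq_zero] using hω

lemma eval_empty (η : WhiteNoise T P) : η.eval ∅ =ᵐ[P] 0 := by
  have h := η.eval_union (A := ∅) (B := ∅) ⟨.empty, by simp, by simp⟩ ⟨.empty, by simp, by simp⟩
    (by simp)
  rw [union_empty] at h
  filter_upwards [h] with ω hω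
  simpa using hω

/-- Linear combinations of the noise are centred Gaussian; their variance is the squared `L²` norm of
the corresponding step function. -/
lemma map_sum_eval (η : WhiteNoise T P) {ι : Type*} [Fintype ι] (B : ι → NoiseSet T) (x : ι → ℝ) :
    P.map (fun ω => ∑ i, x i * η.eval (B i).1 ω) = gaussianReal 0
      (∫ z, (∑ i, (B i).1.indicator (fun _ => x i) z) ^ 2).toNNReal := by
  have hg : HasGaussianLaw (fun ω => ∑ i, x i * η.eval (B i).1 ω) P :=
    ((η.3.comp_right B).smul x).hasGaussianLaw_fun_sum (I := Finset.univ)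
  have hmean : ∫ ω, ∑ i, x i * η.eval (B i).1 ω ∂P = 0 := by
    have := η.isProbabilityMeasure
    rw [integral_finsetSum _ fun i _ =>
      ((η.memLp_eval (B i)).integrable one_le_two).const_mul _]
    simp [integral_const_mul, η.mean_eq_zero]
  rw [hg.map_eq_gaussianReal, hmean, variance_of_integral_eq_zero hg.aemeasurable hmean]
  congr 2
  have e1 : ∀ ω, (∑ i, x i * η.eval (B i).1 ω) ^ 2
      = ∑ i, ∑ j, x i * x j * (η.eval (B i).1 ω * η.eval (B j).1 ω) := by
    intro ω
    rw [sq, Finset.sum_mul_sum]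
    exact Finset.sum_congr rfl fun i _ => Finset.sum_congr rfl fun j _ => by ring
  have e2 : ∀ z, (∑ i, (B i).1.indicator (fun _ => x i) z) ^ 2
      = ∑ i, ∑ j, x i * x j * ((B i).1 ∩ (B j).1).indicator (fun _ => (1 : ℝ)) z := by
    intro z
    rw [sq, Finset.sum_mul_sum]
    refine Finset.sum_congr rfl fun i _ => Finset.sum_congr rfl fun j _ => ?_
    by_cases h1 : z ∈ (B i).1 <;> by_cases h2 : z ∈ (B j).1 <;> simp [h1, h2]
  have hi : ∀ i j, Integrable (((B i).1 ∩ (B j).1).indicator (fun _ => (1 : ℝ))) := fun i j =>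
    (integrable_indicator_iff ((B i).2.1.inter (B j).2.1)).2
      (integrableOn_const ((measure_mono inter_subset_left).trans_lt (B i).2.2.2).ne)
  refine (integral_congr_ae (ae_of_all _ e1)).trans (Eq.trans ?_
    (integral_congr_ae (ae_of_all _ e2)).symm)
  rw [integral_finsetSum _ fun i _ => integrable_finsetSum _ fun j _ =>
      (η.integrable_eval_mul (B i) (B j)).const_mul _,
    integral_finsetSum _ fun i _ => integrable_finsetSum _ fun j _ => (hi i j).const_mul _]
  refine Finset.sum_congr rfl fun i _ => ?_
  rw [integral_finsetSum _ fun j _ => (η.integrable_eval_mul (B i) (B j)).const_mul _,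
    integral_finsetSum _ fun j _ => (hi i j).const_mul _]
  refine Finset.sum_congr rfl fun j _ => ?_
  rw [integral_const_mul, integral_const_mul, η.covariance_eq,
    integral_indicator ((B i).2.1.inter (B j).2.1)]
  simp

/-- Adding null sets to the generators changes events by null sets only. -/
lemma filtration_le_eventuallyMeasurableSpace (η : WhiteNoise T P) (r : ℝ) :
    η.filtration r ≤ eventuallyMeasurableSpace
      (⨆ A : {A : NoiseSet T // A.1 ⊆ strip r},
        MeasurableSpace.comap (η.eval A.1.1) inferInstance) (ae P) := by
  refine sup_le le_eventuallyMeasurableSpace (MeasurableSpace.generateFrom_le ?_)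
  rintro N ⟨-, hN⟩
  exact ⟨∅, @MeasurableSet.empty _ (_), ae_eq_empty.2 hN⟩

/-- The past `ℱ_r` is independent of the noise on sets disjoint from `[0, r] × ℝ`. -/
lemma indep_filtration (η : WhiteNoise T P) {ι : Type*} (B : ι → NoiseSet T) (r : ℝ)
    (hB : ∀ i, Disjoint (B i).1 (strip r)) :
    Indep (η.filtration r) (MeasurableSpace.comap (fun ω i => η.eval (B i).1 ω) inferInstance) P := by
  have := η.isProbabilityMeasure
  let S := {A : NoiseSet T // A.1 ⊆ strip r}
  have h1 : IndepFun (fun ω (s : S) => η.eval s.1.1 ω) (fun ω i => η.eval (B i).1 ω) P := by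
    have hg := η.3.comp_right (Sum.elim (fun s : S => s.1) B)
    have e : (fun A : NoiseSet T => η.eval A.1) ∘ Sum.elim (fun s : S => s.1) B
        = Sum.elim (fun (s : S) ω => η.eval s.1.1 ω) fun i ω => η.eval (B i).1 ω := by
      ext (s | i) <;> rfl
    rw [e] at hg
    refine hg.indepFun_of_covariance_eq_zero
      (fun s => (η.measurable_eval _).aemeasurable) (fun s => (η.measurable_eval _).aemeasurable) ?_
    · intro s i
      rw [covariance_eq_sub (η.memLp_eval _) (η.memLp_eval _), η.mean_eq_zero, zero_mul, sub_zero]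
      have : s.1.1 ∩ (B i).1 = ∅ := ((hB i).symm.mono_left s.2).inter_eq
      simpa [this] using η.covariance_eq s.1 (B i)
  have h2 := (IndepFun_iff_Indep _ _ _).1 h1
  have h3 : MeasurableSpace.comap (fun ω (s : S) => η.eval s.1.1 ω) inferInstance
      = ⨆ A : S, MeasurableSpace.comap (η.eval A.1.1) inferInstance := by
    rw [MeasurableSpace.pi, MeasurableSpace.comap_iSup]
    simp_rw [MeasurableSpace.comap_comp]
    rfl
  rw [h3] at h2
  rw [Indep_iff] at h2 ⊢
  intro s t hs ht
  obtain ⟨s', hs', hss'⟩ := η.filtration_le_eventuallyMeasurableSpace r s hs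
  rw [measure_congr hss', measure_congr (hss'.inter (ae_eq_refl t))]
  exact h2 s' t hs' ht

end WhiteNoise

/-! ### Moments of shifted Gaussian variables -/

lemma enorm_pow_two_mul (x : ℝ) (m : ℕ) : ‖x‖ₑ ^ (2 * m) = ENNReal.ofReal (x ^ (2 * m)) := by
  rw [Real.enorm_eq_ofReal_abs, ← ENNReal.ofReal_pow (abs_nonneg _), (even_two_mul m).pow_abs]

lemma integrable_pow_gaussianReal (i : ℕ) :
    Integrable (fun z : ℝ => z ^ i) (gaussianReal 0 1) := by
  have h : MemLp (fun z : ℝ => z) i (gaussianReal 0 1) :=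
    memLp_id_gaussianReal' (i : ℝ≥0∞) (by simp)
  refine (integrable_norm_iff (by fun_prop)).1 ?_
  simpa using h.integrable_norm_pow'

lemma integral_odd_pow_gaussianReal {i : ℕ} (hi : Odd i) :
    ∫ z : ℝ, z ^ i ∂gaussianReal 0 1 = 0 := by
  have h := gaussianReal_map_neg (μ := 0) (v := 1)
  have h2 : ∫ z : ℝ, z ^ i ∂gaussianReal 0 1 = ∫ z : ℝ, (-z) ^ i ∂gaussianReal 0 1 := by
    conv_lhs => rw [← neg_zero, ← h, integral_map (by fun_prop) (by fun_prop)]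
  simp_rw [hi.neg_pow, integral_neg] at h2
  linarith

/-- A constant bounding the coefficients that appear when a Gaussian variable is added inside a
`2m`-th moment. -/
noncomputable def shiftConst (m : ℕ) : ℝ≥0 :=
  1 + ∑ j ∈ Finset.range (2 * m), (2 * m).choose j * ‖∫ z : ℝ, z ^ (2 * m - j) ∂gaussianReal 0 1‖₊

/-- Weighted Young inequality for the mixed terms of the binomial expansion. -/
lemma pow_mul_pow_sub_le {m l : ℕ} (hl : l < m) {Y v W R : ℝ} (hY : 0 ≤ Y) (hv : 0 ≤ v)
    (hW : 0 ≤ W) (hW1 : W ≤ 1) (hR : 0 ≤ R) (h : v ^ m ≤ W ^ (m - 1) * R) :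
    Y ^ l * v ^ (m - l) ≤ W * Y ^ m + R := by
  -- if `v ≤ W Y` the first term dominates; otherwise `W Y` may be replaced by `v`
  rcases le_or_gt v (W * Y) with hvY | hvY
  · calc Y ^ l * v ^ (m - l) ≤ Y ^ l * (W * Y) ^ (m - l) := by gcongr
      _ = W ^ (m - l) * Y ^ m := by
        rw [mul_pow, mul_left_comm, ← pow_add, Nat.add_sub_cancel' hl.le]
      _ ≤ W * Y ^ m := by
        gcongr
        exact pow_le_of_le_one hW hW1 (by omega)
      _ ≤ _ := le_add_of_nonneg_right hR
  · have hv0 : 0 < v := (mul_nonneg hW hY).trans_lt hvY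
    refine le_trans ?_ (le_add_of_nonneg_left (by positivity))
    rcases Nat.eq_zero_or_pos l with rfl | hl0
    · simpa using h.trans (mul_le_of_le_one_left hR (pow_le_one₀ hW hW1))
    have hW0 : 0 < W := by
      refine hW.lt_of_ne fun h0 => ?_
      rw [← h0, zero_pow (by omega), zero_mul] at h
      exact absurd h (not_le.2 (pow_pos hv0 m))
    have key : W ^ (m - 1) * (Y ^ l * v ^ (m - l)) ≤ W ^ (m - 1) * R := by
      calc W ^ (m - 1) * (Y ^ l * v ^ (m - l))
          = W ^ (m - 1 - l) * ((W * Y) ^ l * v ^ (m - l)) := by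
            rw [mul_pow, ← mul_assoc, ← mul_assoc, ← mul_assoc, ← pow_add,
              Nat.sub_add_cancel (by omega)]
        _ ≤ 1 * (v ^ l * v ^ (m - l)) := by
            gcongr
            exact pow_le_one₀ hW hW1
        _ = v ^ m := by rw [one_mul, ← pow_add, Nat.add_sub_cancel' hl.le]
        _ ≤ _ := h
    exact le_of_mul_le_mul_left key (by positivity)

/-- Adding a centred Gaussian variable of variance `v` increases the `2m`-th power by a factor
`1 + O(W)` and an additive error `O(R)`: odd moments vanish in the binomial expansion, and each even
term `y^{2l} v^{m-l}` with `l < m` is at most `W y^{2m} + R`. -/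
lemma integral_shift_pow_gaussianReal_le (m : ℕ) {y W R : ℝ} {v : ℝ≥0}
    (hW : 0 ≤ W) (hW1 : W ≤ 1) (hR : 0 ≤ R) (h : (v : ℝ) ^ m ≤ W ^ (m - 1) * R) :
    Integrable (fun n => (y + n) ^ (2 * m)) (gaussianReal 0 v) ∧
    ∫ n, (y + n) ^ (2 * m) ∂gaussianReal 0 v
      ≤ (1 + shiftConst m * W) * y ^ (2 * m) + shiftConst m * R := by
  have hmap : gaussianReal 0 v = (gaussianReal 0 1).map (√(v : ℝ) * ·) := by
    rw [gaussianReal_map_const_mul, mul_zero, mul_one]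
    congr 1
    ext
    exact (Real.sq_sqrt v.coe_nonneg).symm
  have hexp : ∀ z : ℝ, (y + √(v : ℝ) * z) ^ (2 * m) = ∑ j ∈ Finset.range (2 * m + 1),
      y ^ j * √(v : ℝ) ^ (2 * m - j) * (2 * m).choose j * z ^ (2 * m - j) := by
    intro z
    rw [add_pow]
    exact Finset.sum_congr rfl fun j _ => by rw [mul_pow]; ring
  have hint : ∀ j ∈ Finset.range (2 * m + 1), Integrable (fun z : ℝ =>
      y ^ j * √(v : ℝ) ^ (2 * m - j) * (2 * m).choose j * z ^ (2 * m - j)) (gaussianReal 0 1) :=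
    fun j _ => (integrable_pow_gaussianReal _).const_mul _
  rw [hmap]
  constructor
  · rw [integrable_map_measure (by fun_prop) (by fun_prop)]
    simp_rw [Function.comp_def, hexp]
    exact integrable_finsetSum _ hint
  rw [integral_map (by fun_prop) (by fun_prop)]
  simp_rw [hexp]
  rw [integral_finsetSum _ hint, Finset.sum_range_succ]
  simp_rw [integral_const_mul]
  have hterm : ∀ j ∈ Finset.range (2 * m), y ^ j * √(v : ℝ) ^ (2 * m - j) * (2 * m).choose j *
      ∫ z : ℝ, z ^ (2 * m - j) ∂gaussianReal 0 1 ≤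
      ((2 * m).choose j * ‖∫ z : ℝ, z ^ (2 * m - j) ∂gaussianReal 0 1‖)
        * (W * y ^ (2 * m) + R) := by
    intro j hj
    have hj' := Finset.mem_range.1 hj
    have hnn : 0 ≤ W * y ^ (2 * m) + R :=
      add_nonneg (mul_nonneg hW (Even.pow_nonneg (even_two_mul m) y)) hR
    rcases Nat.even_or_odd j with ⟨l, hl⟩ | hodd
    · have hl' : l < m := by omega
      have e1 : y ^ j = (y ^ 2) ^ l := by rw [← pow_mul]; congr 1; omega
      have e2 : √(v : ℝ) ^ (2 * m - j) = (v : ℝ) ^ (m - l) := by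
        rw [show 2 * m - j = 2 * (m - l) by omega, pow_mul, Real.sq_sqrt v.coe_nonneg]
      have e3 : y ^ (2 * m) = (y ^ 2) ^ m := pow_mul _ _ _
      have := pow_mul_pow_sub_le hl' (sq_nonneg y) v.coe_nonneg hW hW1 hR h
      rw [e1, e2, e3]
      calc _ ≤ (y ^ 2) ^ l * (v : ℝ) ^ (m - l) * (2 * m).choose j *
            ‖∫ z : ℝ, z ^ (2 * m - j) ∂gaussianReal 0 1‖ := by
            gcongr; exact Real.le_norm_self _
        _ ≤ (W * (y ^ 2) ^ m + R) * (2 * m).choose j *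
            ‖∫ z : ℝ, z ^ (2 * m - j) ∂gaussianReal 0 1‖ := by gcongr
        _ = _ := by ring
    · rw [integral_odd_pow_gaussianReal (by
        obtain ⟨l, hl⟩ := hodd
        exact ⟨m - l - 1, by omega⟩), mul_zero]
      positivity
  have hsum := Finset.sum_le_sum hterm
  rw [← Finset.sum_mul] at hsum
  have hc : (shiftConst m : ℝ) = 1 + ∑ j ∈ Finset.range (2 * m),
      (2 * m).choose j * ‖∫ z : ℝ, z ^ (2 * m - j) ∂gaussianReal 0 1‖ := by
    simp [shiftConst]
  have hnn : 0 ≤ W * y ^ (2 * m) + R :=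
    add_nonneg (mul_nonneg hW (Even.pow_nonneg (even_two_mul m) y)) hR
  have hlast : ∫ z : ℝ, z ^ (2 * m - 2 * m) ∂gaussianReal 0 1 = 1 := by simp
  rw [hlast, Nat.sub_self, Nat.choose_self]
  rw [hc]
  simp only [pow_zero, mul_one, Nat.cast_one]
  linarith

lemma lintegral_shift_pow_gaussianReal_le (m : ℕ) {y q : ℝ} {W R : ℝ≥0∞}
    (hW1 : W ≤ 1) (h : ENNReal.ofReal q ^ m ≤ W ^ (m - 1) * R) :
    ∫⁻ n, ‖y + n‖ₑ ^ (2 * m) ∂gaussianReal 0 q.toNNReal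
      ≤ (1 + shiftConst m * W) * ‖y‖ₑ ^ (2 * m) + shiftConst m * R := by
  have hc : (shiftConst m : ℝ≥0∞) ≠ 0 := by
    simp [shiftConst]
  rcases eq_or_ne R ∞ with rfl | hR
  · rw [ENNReal.mul_top hc, add_top]; exact le_top
  have hWt : W ≠ ∞ := ne_top_of_le_ne_top ENNReal.one_ne_top hW1
  lift W to ℝ≥0 using hWt
  lift R to ℝ≥0 using hR
  have h' : ((q.toNNReal : ℝ≥0) : ℝ) ^ m ≤ (W : ℝ) ^ (m - 1) * R := by
    rw [ENNReal.ofReal] at h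
    exact_mod_cast h
  obtain ⟨h1, h2⟩ := integral_shift_pow_gaussianReal_le m (y := y) W.coe_nonneg
    (by exact_mod_cast hW1) R.coe_nonneg h'
  simp_rw [enorm_pow_two_mul]
  rw [← ofReal_integral_eq_lintegral_ofReal h1
    (ae_of_all _ fun n => Even.pow_nonneg (even_two_mul m) _)]
  refine (ENNReal.ofReal_le_ofReal h2).trans (le_of_eq ?_)
  have hy := Even.pow_nonneg (even_two_mul m) y
  rw [ENNReal.ofReal_add (by positivity) (by positivity), ENNReal.ofReal_mul (by positivity),
    ENNReal.ofReal_add (by positivity) (by positivity), ENNReal.ofReal_mul (by positivity),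
    ENNReal.ofReal_mul (by positivity)]
  simp

/-! ### Moments of noise increments -/

namespace WhiteNoise

variable {Ω : Type*} [mΩ : MeasurableSpace Ω] {T : ℝ} {P : Measure Ω}

/-- Conditionally on the past, an increment `∑ Z_i η(B_i)` is centred Gaussian with variance the
squared `L²` norm of `∑ Z_i 1_{B_i}`. -/
lemma lintegral_add_sum_pow_le (η : WhiteNoise T P) (m : ℕ) {ι : Type*} [Fintype ι]
    (B : ι → NoiseSet T) {r : ℝ} (hB : ∀ i, Disjoint (B i).1 (strip r)) {M : Ω → ℝ}
    (hM : Measurable[η.filtration r] M) {Z : ι → Ω → ℝ}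
    (hZ : ∀ i, Measurable[η.filtration r] (Z i)) {W : ℝ≥0∞} (hW : W ≤ 1) {R : Ω → ℝ≥0∞}
    (hRm : Measurable R)
    (hR : ∀ ω, ENNReal.ofReal (∫ z, (∑ i, (B i).1.indicator (fun _ => Z i ω) z) ^ 2) ^ m
      ≤ W ^ (m - 1) * R ω) :
    ∫⁻ ω, ‖M ω + ∑ i, Z i ω * η.eval (B i).1 ω‖ₑ ^ (2 * m) ∂P
      ≤ (1 + shiftConst m * W) * ∫⁻ ω, ‖M ω‖ₑ ^ (2 * m) ∂P + shiftConst m * ∫⁻ ω, R ω ∂P := by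
  have := η.isProbabilityMeasure
  have hle := η.filtration.le r
  let F : Ω → ℝ × (ι → ℝ) := fun ω => (M ω, fun i => Z i ω)
  let N : Ω → (ι → ℝ) := fun ω i => η.eval (B i).1 ω
  have hF : Measurable[η.filtration r] F := hM.prodMk (@measurable_pi_lambda _ _ _ (η.filtration r) _ _ hZ)
  have hF' : Measurable F := hF.mono hle le_rfl
  have hN : Measurable N := measurable_pi_lambda _ fun i => η.measurable_eval _
  have hind : IndepFun F N P := (IndepFun_iff_Indep _ _ _).2
    (indep_of_indep_of_le_left (η.indep_filtration B r hB)
      (@Measurable.comap_le _ _ (η.filtration r) _ _ hF))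
  have hprod := (indepFun_iff_map_prod_eq_prod_map_map hF'.aemeasurable hN.aemeasurable).1 hind
  let g : (ℝ × (ι → ℝ)) × (ι → ℝ) → ℝ≥0∞ :=
    fun p => ‖p.1.1 + ∑ i, p.1.2 i * p.2 i‖ₑ ^ (2 * m)
  have hg : Measurable g := by fun_prop
  have hM' : Measurable M := hM.mono hle le_rfl
  calc ∫⁻ ω, ‖M ω + ∑ i, Z i ω * η.eval (B i).1 ω‖ₑ ^ (2 * m) ∂P
      = ∫⁻ p, g p ∂(P.map fun ω => (F ω, N ω)) :=
        (lintegral_map hg (hF'.prodMk hN)).symm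
    _ = ∫⁻ ω, ∫⁻ ω', g (F ω, N ω') ∂P ∂P := by
        have := Measure.isProbabilityMeasure_map (μ := P) hN.aemeasurable
        rw [hprod, lintegral_prod _ hg.aemeasurable,
          lintegral_map hg.lintegral_prod_right' hF']
        refine lintegral_congr fun ω => ?_
        exact lintegral_map (f := fun y => g (F ω, y)) (hg.comp measurable_prodMk_left) hN
    _ ≤ ∫⁻ ω, ((1 + shiftConst m * W) * ‖M ω‖ₑ ^ (2 * m) + shiftConst m * R ω) ∂P := by
        refine lintegral_mono fun ω => ?_
        have hS : Measurable fun ω' => ∑ i, Z i ω * η.eval (B i).1 ω' := by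
          refine Finset.measurable_sum _ fun i _ => ?_
          exact (η.measurable_eval (B i)).const_mul _
        have h1 : ∫⁻ ω', g (F ω, N ω') ∂P = ∫⁻ n, ‖M ω + n‖ₑ ^ (2 * m)
            ∂(P.map fun ω' => ∑ i, Z i ω * η.eval (B i).1 ω') := by
          rw [lintegral_map (by fun_prop) hS]
        rw [h1, η.map_sum_eval B (fun i => Z i ω)]
        exact lintegral_shift_pow_gaussianReal_le m hW (hR ω)
    _ = _ := by
        rw [lintegral_add_right _ (hRm.const_mul _), lintegral_const_mul _ (by fun_prop),
          lintegral_const_mul _ hRm]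

end WhiteNoise

/-- Hölder's inequality against a weight `w` that may vanish only where the integrand does. -/
lemma lintegral_pow_le_weight {α : Type*} [MeasurableSpace α] {μ : Measure α} {m : ℕ} (hm : 1 ≤ m)
    {w Q : α → ℝ≥0∞} (hw : Measurable w) (hQ : Measurable Q) (hwt : ∀ z, w z ≠ ∞)
    (hw0 : ∀ z, w z = 0 → Q z = 0) :
    (∫⁻ z, Q z ∂μ) ^ m ≤ (∫⁻ z, w z ∂μ) ^ (m - 1) * ∫⁻ z, (w z)⁻¹ ^ (m - 1) * Q z ^ m ∂μ := by
  have hm0 : (m : ℝ) ≠ 0 := by positivity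
  have hm1 : ((m - 1 : ℕ) : ℝ) = m - 1 := by push_cast [hm]; ring
  have key : ∫⁻ z, Q z ∂μ ≤ (∫⁻ z, w z ∂μ) ^ (((m - 1 : ℕ) : ℝ) / m)
      * (∫⁻ z, (w z)⁻¹ ^ (m - 1) * Q z ^ m ∂μ) ^ (1 / m : ℝ) := by
    refine le_trans (lintegral_mono fun z => ?_) (ENNReal.lintegral_mul_norm_pow_le
      (p := ((m - 1 : ℕ) : ℝ) / m) (q := 1 / m) hw.aemeasurable (by fun_prop) (by positivity)
      (by positivity) (by rw [hm1]; field_simp; ring))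
    rcases eq_or_ne (w z) 0 with h0 | h0
    · simp [hw0 z h0]
    · have e1 : ((w z)⁻¹ ^ (m - 1) * Q z ^ m) ^ (1 / m : ℝ)
          = (w z ^ (((m - 1 : ℕ) : ℝ) / m))⁻¹ * Q z := by
        rw [ENNReal.mul_rpow_of_nonneg _ _ (by positivity), ← ENNReal.rpow_natCast,
          ← ENNReal.rpow_natCast, ← ENNReal.rpow_mul, ← ENNReal.rpow_mul, mul_one_div,
          mul_one_div, div_self hm0, ENNReal.rpow_one, ENNReal.inv_rpow]
      rw [e1, ← mul_assoc, ENNReal.mul_inv_cancel, one_mul]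
      · exact (ENNReal.rpow_pos (pos_iff_ne_zero.2 h0) (hwt z)).ne'
      · exact ENNReal.rpow_ne_top_of_nonneg (by positivity) (hwt z)
  calc (∫⁻ z, Q z ∂μ) ^ m ≤ _ := pow_le_pow_left' key m
    _ = _ := by
      rw [mul_pow, ← ENNReal.rpow_natCast, ← ENNReal.rpow_natCast, ← ENNReal.rpow_mul,
        ← ENNReal.rpow_mul, div_mul_cancel₀ _ hm0, div_mul_cancel₀ _ hm0, ENNReal.rpow_natCast,
        ENNReal.rpow_one]

/-- Multiplicative constant of the moment inequality for stochastic integrals. -/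
noncomputable def momentConst (m : ℕ) : ℝ≥0 :=
  Real.toNNReal (Real.exp (shiftConst m)) * shiftConst m

lemma momentConst_ne_zero (m : ℕ) : momentConst m ≠ 0 := by
  rw [momentConst, shiftConst]
  have : 0 < Real.toNNReal (Real.exp (shiftConst m)) := Real.toNNReal_pos.2 (Real.exp_pos _)
  rw [shiftConst] at this
  exact (mul_pos this (add_pos_of_pos_of_nonneg one_pos zero_le)).ne'

/-! ### Stochastic integrals of simple fields -/

namespace WhiteNoise

variable {Ω : Type*} [mΩ : MeasurableSpace Ω] {T : ℝ} {P : Measure Ω}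

lemma measurable_eval_filtration (η : WhiteNoise T P) (A : NoiseSet T) {r : ℝ}
    (hA : A.1 ⊆ strip r) : Measurable[η.filtration r] (η.eval A.1) := by
  rw [measurable_iff_comap_le]
  exact (le_iSup (fun A : {A : NoiseSet T // A.1 ⊆ strip r} =>
    MeasurableSpace.comap (η.eval A.1.1) inferInstance) ⟨A, hA⟩).trans le_sup_left

namespace SimpleField

variable {η : WhiteNoise T P}

lemma isNoiseSet_Ioc_prod_region (Φ : SimpleField η) (i : Fin Φ.card) {a b : ℝ} (ha : 0 ≤ a)
    (hb : b ≤ T) : MeasurableSet (Ioc a b ×ˢ Φ.region i) ∧ Ioc a b ×ˢ Φ.region i ⊆ strip T ∧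
      volume (Ioc a b ×ˢ Φ.region i) < ∞ :=
  isNoiseSet_box ha hb (Φ.measurableSet_region i) (Φ.volume_region_lt_top i)

lemma isNoiseSet_box' (Φ : SimpleField η) (i : Fin Φ.card) :
    MeasurableSet (Φ.box i) ∧ Φ.box i ⊆ strip T ∧ volume (Φ.box i) < ∞ :=
  Φ.isNoiseSet_Ioc_prod_region i (Φ.left_nonneg i) (Φ.right_le i)

lemma measurable_coeff' (Φ : SimpleField η) (i : Fin Φ.card) : Measurable (Φ.coeff i) :=
  (Φ.measurable_coeff i).mono (η.filtration.le _) le_rfl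

lemma measurable_eval_box (Φ : SimpleField η) (i : Fin Φ.card) :
    Measurable (η.eval (Φ.box i)) :=
  η.measurable_eval ⟨Φ.box i, Φ.isNoiseSet_box' i⟩

lemma measurable_integral (Φ : SimpleField η) : Measurable Φ.integral :=
  Finset.measurable_sum _ fun i _ => (Φ.measurable_coeff' i).mul (Φ.measurable_eval_box i)

lemma measurable_val (Φ : SimpleField η) :
    Measurable fun z : (ℝ × ℝ) × Ω => Φ.val z.1 z.2 := by
  refine Finset.measurable_sum _ fun i _ => ?_
  have : (fun z : (ℝ × ℝ) × Ω => (Φ.box i).indicator (fun _ => Φ.coeff i z.2) z.1)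
      = (Prod.fst ⁻¹' Φ.box i).indicator fun z => Φ.coeff i z.2 := rfl
  rw [this]
  exact ((Φ.measurable_coeff' i).comp measurable_snd).indicator
    (measurable_fst (Φ.isNoiseSet_box' i).1)

/-- The stochastic integral of a simple field over `(0, r] × ℝ`. -/
noncomputable def partialIntegral (Φ : SimpleField η) (r : ℝ) (ω : Ω) : ℝ :=
  ∑ i, if Φ.left i ≤ r then
    Φ.coeff i ω * η.eval (Ioc (Φ.left i) (min (Φ.right i) r) ×ˢ Φ.region i) ω else 0

lemma measurable_partialIntegral (Φ : SimpleField η) (r : ℝ) :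
    Measurable[η.filtration r] (Φ.partialIntegral r) := by
  refine Finset.measurable_sum _ fun i _ => ?_
  split_ifs with h
  · refine Measurable.mul ((Φ.measurable_coeff i).mono (η.filtration.mono h) le_rfl) ?_
    refine η.measurable_eval_filtration ⟨_, Φ.isNoiseSet_Ioc_prod_region i (Φ.left_nonneg i)
      ((min_le_left _ _).trans (Φ.right_le i))⟩ ?_
    rintro ⟨s, y⟩ ⟨h1, -⟩
    exact ⟨⟨(Φ.left_nonneg i).trans h1.1.le, h1.2.trans (min_le_right _ _)⟩, mem_univ _⟩
  · exact measurable_const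

lemma partialIntegral_zero (Φ : SimpleField η) : Φ.partialIntegral 0 =ᵐ[P] 0 := by
  filter_upwards [η.eval_empty] with ω hω
  refine Finset.sum_eq_zero fun i _ => ?_
  split_ifs with h
  · have h0 : min (Φ.right i) 0 ≤ Φ.left i := (min_le_right _ _).trans (Φ.left_nonneg i)
    rw [Ioc_eq_empty (not_lt.2 h0), empty_prod, hω]
    simp
  · rfl

lemma partialIntegral_horizon (Φ : SimpleField η) : Φ.partialIntegral T = Φ.integral := by
  ext ω
  refine Finset.sum_congr rfl fun i _ => ?_
  rw [if_pos ((Φ.left_le_right i).trans (Φ.right_le i)), min_eq_left (Φ.right_le i)]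
  rfl

/-- The coefficient that is active on a time interval `(r, r']` without endpoints of `Φ` inside. -/
noncomputable def activeCoeff (Φ : SimpleField η) (r r' : ℝ) (i : Fin Φ.card) (ω : Ω) : ℝ :=
  if Φ.left i ≤ r ∧ r' ≤ Φ.right i then Φ.coeff i ω else 0

lemma measurable_activeCoeff (Φ : SimpleField η) (r r' : ℝ) (i : Fin Φ.card) :
    Measurable[η.filtration r] (Φ.activeCoeff r r' i) := by
  unfold activeCoeff
  split_ifs with h
  · exact (Φ.measurable_coeff i).mono (η.filtration.mono h.1) le_rfl
  · exact measurable_const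

/-- The increment over a time interval free of endpoints is a sum of noise increments with
coefficients known at its left end. -/
lemma partialIntegral_add (Φ : SimpleField η) {r r' : ℝ} (h0 : 0 ≤ r) (hr : r < r') (hT : r' ≤ T)
    (hl : ∀ i, Φ.left i ∉ Ioo r r') (hri : ∀ i, Φ.right i ∉ Ioo r r') :
    Φ.partialIntegral r' =ᵐ[P] fun ω => Φ.partialIntegral r ω +
      ∑ i, Φ.activeCoeff r r' i ω * η.eval (Ioc r r' ×ˢ Φ.region i) ω := by
  have hadd : ∀ i, ∀ᵐ ω ∂P, Φ.left i ≤ r →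
      η.eval (Ioc (Φ.left i) r' ×ˢ Φ.region i) ω = η.eval (Ioc (Φ.left i) r ×ˢ Φ.region i) ω
        + η.eval (Ioc r r' ×ˢ Φ.region i) ω := by
    intro i
    by_cases hi : Φ.left i ≤ r
    · have hu := η.eval_union
        (Φ.isNoiseSet_Ioc_prod_region i (Φ.left_nonneg i) (hr.le.trans hT))
        (Φ.isNoiseSet_Ioc_prod_region i h0 hT)
        (disjoint_left.2 fun z hz hz' => absurd hz.1.2 (not_le.2 hz'.1.1))
      rw [← union_prod, Ioc_union_Ioc_eq_Ioc hi hr.le] at hu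
      filter_upwards [hu] with ω hω _ using hω
    · exact ae_of_all _ fun ω h => absurd h hi
  filter_upwards [η.eval_empty, ae_all_iff.2 hadd] with ω h_empty hω
  simp only [partialIntegral, activeCoeff]
  rw [← Finset.sum_add_distrib]
  refine Finset.sum_congr rfl fun i _ => ?_
  have hli := hl i
  have hrii := hri i
  have hlr := Φ.left_le_right i
  by_cases h1 : Φ.left i ≤ r
  · rw [if_pos h1, if_pos (h1.trans hr.le)]
    by_cases h2 : r' ≤ Φ.right i
    · rw [if_pos ⟨h1, h2⟩, min_eq_right h2, min_eq_right (hr.le.trans h2), hω i h1, mul_add]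
    · have h3 : Φ.right i ≤ r := by
        by_contra h; exact hrii ⟨not_le.1 h, not_le.1 h2⟩
      rw [if_neg (fun h => h2 h.2), min_eq_left h3, min_eq_left (h3.trans hr.le), zero_mul,
        add_zero]
  · have h2 : r' ≤ Φ.left i := by
      by_contra h; exact hli ⟨not_le.1 h1, not_le.1 h⟩
    rw [if_neg h1, if_neg (fun h : Φ.left i ≤ r ∧ r' ≤ Φ.right i => h1 h.1), zero_mul, add_zero]
    split_ifs with h3
    · rw [le_antisymm h3 h2, min_eq_right (h2.trans hlr), Ioc_self, empty_prod, h_empty]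
      simp
    · rfl

lemma sum_activeCoeff_eq (Φ : SimpleField η) {r r' : ℝ}
    (hl : ∀ i, Φ.left i ∉ Ioo r r') (hri : ∀ i, Φ.right i ∉ Ioo r r') (ω : Ω) (z : ℝ × ℝ) :
    ∑ i, (Ioc r r' ×ˢ Φ.region i).indicator (fun _ => Φ.activeCoeff r r' i ω) z
      = (Ioc r r' ×ˢ univ).indicator (fun z => Φ.val z ω) z := by
  by_cases hz : z ∈ Ioc r r' ×ˢ (univ : Set ℝ)
  · rw [indicator_of_mem hz, val]
    refine Finset.sum_congr rfl fun i _ => ?_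
    have hli := hl i
    have hrii := hri i
    have h1 : Φ.left i < z.1 ↔ Φ.left i ≤ r := by
      refine ⟨fun h => ?_, fun h => h.trans_lt hz.1.1⟩
      by_contra h'
      exact hli ⟨not_le.1 h', h.trans_le hz.1.2⟩
    have h2 : z.1 ≤ Φ.right i ↔ r' ≤ Φ.right i := by
      refine ⟨fun h => ?_, fun h => hz.1.2.trans h⟩
      by_contra h'
      exact hrii ⟨hz.1.1.trans_le h, not_le.1 h'⟩
    have hb : z ∈ Φ.box i ↔ (Φ.left i ≤ r ∧ r' ≤ Φ.right i) ∧ z.2 ∈ Φ.region i := by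
      rw [box, mem_prod, mem_Ioc, h1, h2]
    have hb' : z ∈ Ioc r r' ×ˢ Φ.region i ↔ z.2 ∈ Φ.region i := by
      rw [mem_prod]; exact and_iff_right hz.1
    by_cases h4 : z.2 ∈ Φ.region i
    · rw [indicator_of_mem (hb'.2 h4), activeCoeff]
      split_ifs with h3
      · rw [indicator_of_mem (hb.2 ⟨h3, h4⟩)]
      · rw [indicator_of_notMem fun h => h3 (hb.1 h).1]
    · rw [indicator_of_notMem fun h => h4 (hb'.1 h), indicator_of_notMem fun h => h4 (hb.1 h).2]
  · rw [indicator_of_notMem hz]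
    refine Finset.sum_eq_zero fun i _ => indicator_of_notMem (fun h => hz ⟨h.1, mem_univ _⟩) _

/-- The energy of a simple field over `(r, r'] × ℝ`, weighted so as to control a `2m`-th moment. -/
noncomputable def energy (Φ : SimpleField η) (m : ℕ) (w : ℝ × ℝ → ℝ≥0∞) (r r' : ℝ) (ω : Ω) :
    ℝ≥0∞ :=
  ∫⁻ z in Ioc r r' ×ˢ univ, (w z)⁻¹ ^ (m - 1) * ‖Φ.val z ω‖ₑ ^ (2 * m)

lemma measurable_energy (Φ : SimpleField η) (m : ℕ) {w : ℝ × ℝ → ℝ≥0∞} (hw : Measurable w)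
    (r r' : ℝ) : Measurable (Φ.energy m w r r') := by
  have h : Measurable fun z : (ℝ × ℝ) × Ω => (w z.1)⁻¹ ^ (m - 1) * ‖Φ.val z.1 z.2‖ₑ ^ (2 * m) :=
    ((hw.comp measurable_fst).inv.pow_const _).mul (Φ.measurable_val.enorm.pow_const _)
  exact h.lintegral_prod_left'

lemma lintegral_slab_add {f : ℝ × ℝ → ℝ≥0∞} {r r' r'' : ℝ} (h1 : r ≤ r') (h2 : r' ≤ r'') :
    ∫⁻ z in Ioc r r'' ×ˢ univ, f z
      = (∫⁻ z in Ioc r r' ×ˢ univ, f z) + ∫⁻ z in Ioc r' r'' ×ˢ univ, f z := by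
  rw [← Ioc_union_Ioc_eq_Ioc h1 h2, union_prod, lintegral_union
    (measurableSet_Ioc.prod MeasurableSet.univ)]
  exact disjoint_left.2 fun z hz hz' => absurd hz.1.2 (not_le.2 hz'.1.1)

/-- One step of the moment recursion. Hölder's inequality with the weight `w` bounds the `m`-th power
of the conditional variance by the energy. -/
lemma lintegral_partialIntegral_step (Φ : SimpleField η) {m : ℕ} (hm : 1 ≤ m)
    {w : ℝ × ℝ → ℝ≥0∞} (hw : Measurable w) (hwt : ∀ z, w z ≠ ∞)
    (hw0 : ∀ z ω, w z = 0 → Φ.val z ω = 0) {r r' : ℝ} (h0 : 0 ≤ r) (hr : r < r') (hT : r' ≤ T)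
    (hw1 : ∫⁻ z in Ioc r r' ×ˢ univ, w z ≤ 1)
    (hl : ∀ i, Φ.left i ∉ Ioo r r') (hri : ∀ i, Φ.right i ∉ Ioo r r') :
    ∫⁻ ω, ‖Φ.partialIntegral r' ω‖ₑ ^ (2 * m) ∂P
      ≤ (1 + shiftConst m * ∫⁻ z in Ioc r r' ×ˢ univ, w z)
        * ∫⁻ ω, ‖Φ.partialIntegral r ω‖ₑ ^ (2 * m) ∂P
        + shiftConst m * ∫⁻ ω, Φ.energy m w r r' ω ∂P := by
  have hae := Φ.partialIntegral_add h0 hr hT hl hri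
  rw [lintegral_congr_ae (g := fun ω => ‖Φ.partialIntegral r ω +
      ∑ i, Φ.activeCoeff r r' i ω * η.eval (Ioc r r' ×ˢ Φ.region i) ω‖ₑ ^ (2 * m))
    (hae.mono fun ω hω => by simp only [hω])]
  refine η.lintegral_add_sum_pow_le m
    (fun i => ⟨_, Φ.isNoiseSet_Ioc_prod_region i h0 hT⟩) (fun i => ?_)
    (Φ.measurable_partialIntegral r) (Φ.measurable_activeCoeff r r') hw1
    (Φ.measurable_energy m hw r r') fun ω => ?_
  · exact disjoint_left.2 fun z hz hz' => absurd hz'.1.2 (not_le.2 hz.1.1)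
  · simp only [Φ.sum_activeCoeff_eq hl hri ω]
    have hv : Measurable fun z => Φ.val z ω := Φ.measurable_val.comp measurable_prodMk_right
    have hS : MeasurableSet (Ioc r r' ×ˢ (univ : Set ℝ)) :=
      measurableSet_Ioc.prod MeasurableSet.univ
    have h1 : ENNReal.ofReal
        (∫ z, ((Ioc r r' ×ˢ univ).indicator (fun z => Φ.val z ω) z) ^ 2)
        ≤ ∫⁻ z in Ioc r r' ×ˢ univ, ‖Φ.val z ω‖ₑ ^ 2 := by
      rw [integral_eq_lintegral_of_nonneg_ae (ae_of_all _ fun z => sq_nonneg _)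
        ((hv.indicator hS).pow_const 2).aestronglyMeasurable, ← lintegral_indicator hS]
      refine ENNReal.ofReal_toReal_le.trans (lintegral_mono fun z => ?_)
      by_cases hz : z ∈ Ioc r r' ×ˢ (univ : Set ℝ)
      · rw [indicator_of_mem hz, indicator_of_mem hz]
        exact (enorm_pow_two_mul (Φ.val z ω) 1).ge
      · simp [indicator_of_notMem hz]
    refine (pow_le_pow_left' h1 m).trans ?_
    have h2 := lintegral_pow_le_weight (μ := volume.restrict (Ioc r r' ×ˢ univ)) hm hw
      (hv.enorm.pow_const 2) hwt (fun z hz => by simp [hw0 z ω hz])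
    simpa only [energy, ← pow_mul] using h2

/-- Iteration of the one-step inequality over the time intervals between consecutive endpoints, in
the form of a discrete Grönwall estimate. -/
lemma lintegral_partialIntegral_le (Φ : SimpleField η) {m : ℕ} (hm : 1 ≤ m)
    {w : ℝ × ℝ → ℝ≥0∞} (hw : Measurable w) (hwt : ∀ z, w z ≠ ∞)
    (hw0 : ∀ z ω, w z = 0 → Φ.val z ω = 0) (n : ℕ) : ∀ {r r' : ℝ}, 0 ≤ r → r ≤ r' → r' ≤ T →
    ∫⁻ z in Ioc r r' ×ˢ univ, w z ≤ 1 →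
    ((Finset.univ.image Φ.left ∪ Finset.univ.image Φ.right).filter (· ∈ Ioo r r')).card ≤ n →
    ∫⁻ ω, ‖Φ.partialIntegral r' ω‖ₑ ^ (2 * m) ∂P
      ≤ ENNReal.ofReal (Real.exp (shiftConst m * (∫⁻ z in Ioc r r' ×ˢ univ, w z).toReal))
        * (∫⁻ ω, ‖Φ.partialIntegral r ω‖ₑ ^ (2 * m) ∂P
          + shiftConst m * ∫⁻ ω, Φ.energy m w r r' ω ∂P) := by
  induction n with
  | zero =>
    intro r r' h0 hr hT hw1 hn
    rcases hr.eq_or_lt with rfl | hr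
    · simp
    rw [Nat.le_zero, Finset.card_eq_zero, Finset.filter_eq_empty_iff] at hn
    have hstep := Φ.lintegral_partialIntegral_step hm hw hwt hw0 h0 hr hT hw1
      (fun i => hn (Finset.mem_union_left _ (Finset.mem_image_of_mem _ (Finset.mem_univ i))))
      (fun i => hn (Finset.mem_union_right _ (Finset.mem_image_of_mem _ (Finset.mem_univ i))))
    refine hstep.trans ?_
    have hwf : ∫⁻ z in Ioc r r' ×ˢ univ, w z ≠ ∞ := ne_top_of_le_ne_top ENNReal.one_ne_top hw1
    have hexp : 1 + shiftConst m * ∫⁻ z in Ioc r r' ×ˢ univ, w z ≤ ENNReal.ofReal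
        (Real.exp (shiftConst m * (∫⁻ z in Ioc r r' ×ˢ univ, w z).toReal)) := by
      refine le_trans (le_of_eq ?_) (ENNReal.ofReal_le_ofReal
        (Real.add_one_le_exp _))
      rw [add_comm _ (1 : ℝ), ENNReal.ofReal_add zero_le_one (by positivity),
        ENNReal.ofReal_mul (by positivity), ENNReal.ofReal_toReal hwf]
      simp
    have h1 : (1 : ℝ≥0∞) ≤ ENNReal.ofReal
        (Real.exp (shiftConst m * (∫⁻ z in Ioc r r' ×ˢ univ, w z).toReal)) :=
      le_self_add.trans hexp
    rw [mul_add]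
    refine add_le_add (by gcongr) (le_mul_of_one_le_left zero_le h1)
  | succ n ih =>
    intro r r' h0 hr hT hw1 hn
    by_cases hle : ((Finset.univ.image Φ.left ∪ Finset.univ.image Φ.right).filter
        (· ∈ Ioo r r')).card ≤ n
    · exact ih h0 hr hT hw1 hle
    obtain ⟨e, he⟩ : ((Finset.univ.image Φ.left ∪ Finset.univ.image Φ.right).filter
        (· ∈ Ioo r r')).Nonempty := Finset.card_pos.1 (by omega)
    have he' := (Finset.mem_filter.1 he).2
    have hcard : ∀ a b, r ≤ a → b ≤ r' → e ∉ Ioo a b →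
        ((Finset.univ.image Φ.left ∪ Finset.univ.image Φ.right).filter
          (· ∈ Ioo a b)).card ≤ n := by
      intro a b ha hb hab
      refine Nat.lt_succ_iff.1 (lt_of_lt_of_le (Finset.card_lt_card ?_) hn)
      refine (Finset.ssubset_iff_of_subset fun x hx => ?_).2
        ⟨e, he, fun h => hab (Finset.mem_filter.1 h).2⟩
      rw [Finset.mem_filter] at hx ⊢
      exact ⟨hx.1, ha.trans_lt hx.2.1, hx.2.2.trans_le hb⟩
    have hsplit := fun f : ℝ × ℝ → ℝ≥0∞ => lintegral_slab_add (f := f) he'.1.le he'.2.le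
    have hw1' := hw1
    rw [hsplit] at hw1'
    have hwa : ∫⁻ z in Ioc r e ×ˢ univ, w z ≤ 1 := le_self_add.trans hw1'
    have hwb : ∫⁻ z in Ioc e r' ×ˢ univ, w z ≤ 1 := le_add_self.trans hw1'
    have i1 := ih h0 he'.1.le (he'.2.le.trans hT) hwa
      (hcard r e le_rfl he'.2.le fun h => lt_irrefl _ h.2)
    have i2 := ih (h0.trans he'.1.le) he'.2.le hT hwb
      (hcard e r' he'.1.le le_rfl fun h => lt_irrefl _ h.1)
    have hE : ∫⁻ ω, Φ.energy m w r r' ω ∂P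
        = ∫⁻ ω, Φ.energy m w r e ω ∂P + ∫⁻ ω, Φ.energy m w e r' ω ∂P := by
      rw [← lintegral_add_left (Φ.measurable_energy m hw r e)]
      exact lintegral_congr fun ω => hsplit _
    rw [hsplit, ENNReal.toReal_add (ne_top_of_le_ne_top ENNReal.one_ne_top hwa)
      (ne_top_of_le_ne_top ENNReal.one_ne_top hwb), mul_add (shiftConst m : ℝ), Real.exp_add,
      ENNReal.ofReal_mul (Real.exp_pos _).le, hE]
    set Ea := ENNReal.ofReal (Real.exp (shiftConst m * (∫⁻ z in Ioc r e ×ˢ univ, w z).toReal))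
    set Eb := ENNReal.ofReal (Real.exp (shiftConst m * (∫⁻ z in Ioc e r' ×ˢ univ, w z).toReal))
    have hEa : 1 ≤ Ea := by
      rw [← ENNReal.ofReal_one]
      exact ENNReal.ofReal_le_ofReal (Real.one_le_exp (by positivity))
    calc _ ≤ Eb * (∫⁻ ω, ‖Φ.partialIntegral e ω‖ₑ ^ (2 * m) ∂P
          + shiftConst m * ∫⁻ ω, Φ.energy m w e r' ω ∂P) := i2
      _ ≤ Eb * (Ea * (∫⁻ ω, ‖Φ.partialIntegral r ω‖ₑ ^ (2 * m) ∂P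
          + shiftConst m * ∫⁻ ω, Φ.energy m w r e ω ∂P)
          + Ea * (shiftConst m * ∫⁻ ω, Φ.energy m w e r' ω ∂P)) :=
        mul_le_mul' le_rfl (add_le_add i1 (le_mul_of_one_le_left zero_le hEa))
      _ = _ := by ring

/-- A weighted Burkholder-type inequality for the stochastic integrals of simple fields. -/
theorem lintegral_integral_pow_le (Φ : SimpleField η) (hT : 0 ≤ T) {m : ℕ} (hm : 1 ≤ m)
    {w : ℝ × ℝ → ℝ≥0∞} (hw : Measurable w) (hwt : ∀ z, w z ≠ ∞)
    (hw0 : ∀ z ω, w z = 0 → Φ.val z ω = 0) (hw1 : ∫⁻ z in strip T, w z ≤ 1) :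
    ∫⁻ ω, ‖Φ.integral ω‖ₑ ^ (2 * m) ∂P ≤ momentConst m *
      ∫⁻ z, (w z.1)⁻¹ ^ (m - 1) * ‖Φ.val z.1 z.2‖ₑ ^ (2 * m)
        ∂((volume.restrict (strip T)).prod P) := by
  have := η.isProbabilityMeasure
  have hsub : Ioc 0 T ×ˢ univ ⊆ strip T := prod_mono Ioc_subset_Icc_self subset_rfl
  have hw1' : ∫⁻ z in Ioc 0 T ×ˢ univ, w z ≤ 1 := (lintegral_mono_set hsub).trans hw1
  have h := Φ.lintegral_partialIntegral_le hm hw hwt hw0 _ le_rfl hT le_rfl hw1' le_rfl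
  have hz : ∫⁻ ω, ‖Φ.partialIntegral 0 ω‖ₑ ^ (2 * m) ∂P = 0 := by
    rw [lintegral_congr_ae (g := fun _ => 0) (Φ.partialIntegral_zero.mono fun ω hω => by
      simp [hω, show m ≠ 0 by omega])]
    simp
  rw [hz, zero_add, Φ.partialIntegral_horizon] at h
  refine h.trans ?_
  rw [← mul_assoc]
  have hval : Measurable fun z : (ℝ × ℝ) × Ω =>
      (w z.1)⁻¹ ^ (m - 1) * ‖Φ.val z.1 z.2‖ₑ ^ (2 * m) :=
    ((hw.comp measurable_fst).inv.pow_const _).mul (Φ.measurable_val.enorm.pow_const _)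
  refine mul_le_mul' ?_ ?_
  · rw [momentConst, ENNReal.coe_mul]
    gcongr
    refine ENNReal.ofReal_le_ofReal (Real.exp_le_exp.2 ?_)
    exact mul_le_of_le_one_right (shiftConst m).coe_nonneg
      (ENNReal.toReal_le_of_le_ofReal zero_le_one (by simpa using hw1'))
  · rw [lintegral_prod_symm' _ hval]
    exact lintegral_mono fun ω => lintegral_mono_set hsub

end SimpleField
end WhiteNoise

/-! ### Linear operations on simple fields -/

/-- The part `(0, T] × [0, L]` of space-time on which a solution lives. -/
def cell (T L : ℝ) : Set (ℝ × ℝ) := Ioc 0 T ×ˢ Icc 0 L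

lemma measurableSet_cell (T L : ℝ) : MeasurableSet (cell T L) :=
  measurableSet_Ioc.prod measurableSet_Icc

lemma cell_subset_strip (T L : ℝ) : cell T L ⊆ strip T :=
  prod_mono Ioc_subset_Icc_self (subset_univ _)

lemma volume_cell (T L : ℝ) : volume (cell T L) = ENNReal.ofReal T * ENNReal.ofReal L := by
  rw [cell, Measure.volume_eq_prod, Measure.prod_prod, Real.volume_Ioc, Real.volume_Icc]
  simp

namespace WhiteNoise

variable {Ω : Type*} [mΩ : MeasurableSpace Ω] {T : ℝ} {P : Measure Ω}

namespace SimpleField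

variable {η : WhiteNoise T P}

/-- The simple field with a single summand. -/
def single (a b : ℝ) (A : Set ℝ) (X : Ω → ℝ) (ha : 0 ≤ a) (hab : a ≤ b) (hb : b ≤ T)
    (hA : MeasurableSet A) (hA' : volume A < ∞) (hX : Measurable[η.filtration a] X)
    (hXb : ∃ C : ℝ, ∀ ω, |X ω| ≤ C) : SimpleField η where
  card := 1
  left _ := a
  right _ := b
  region _ := A
  coeff _ := X
  left_nonneg _ := ha
  left_le_right _ := hab
  right_le _ := hb
  measurableSet_region _ := hA
  volume_region_lt_top _ := hA'
  measurable_coeff _ := hX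
  bounded_coeff _ := hXb

/-- The simple field without summands. -/
def zero (η : WhiteNoise T P) : SimpleField η where
  card := 0
  left := Fin.elim0
  right := Fin.elim0
  region := Fin.elim0
  coeff := Fin.elim0
  left_nonneg i := i.elim0
  left_le_right i := i.elim0
  right_le i := i.elim0
  measurableSet_region i := i.elim0
  volume_region_lt_top i := i.elim0
  measurable_coeff i := i.elim0
  bounded_coeff i := i.elim0

/-- A scalar multiple of a simple field. -/
def smul (c : ℝ) (Φ : SimpleField η) : SimpleField η where
  __ := Φ
  coeff i ω := c * Φ.coeff i ω
  measurable_coeff i := (Φ.measurable_coeff i).const_mul c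
  bounded_coeff i := by
    obtain ⟨C, hC⟩ := Φ.bounded_coeff i
    refine ⟨|c| * C, fun ω => ?_⟩
    rw [abs_mul]
    exact mul_le_mul_of_nonneg_left (hC ω) (abs_nonneg c)

/-- The sum of two simple fields. -/
def add (Φ Ψ : SimpleField η) : SimpleField η where
  card := Φ.card + Ψ.card
  left := Fin.append Φ.left Ψ.left
  right := Fin.append Φ.right Ψ.right
  region := Fin.append Φ.region Ψ.region
  coeff := Fin.append Φ.coeff Ψ.coeff
  left_nonneg i := by
    refine Fin.addCases (fun j => ?_) (fun j => ?_) i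
    · rw [Fin.append_left]; exact Φ.left_nonneg j
    · rw [Fin.append_right]; exact Ψ.left_nonneg j
  left_le_right i := by
    refine Fin.addCases (fun j => ?_) (fun j => ?_) i
    · rw [Fin.append_left, Fin.append_left]; exact Φ.left_le_right j
    · rw [Fin.append_right, Fin.append_right]; exact Ψ.left_le_right j
  right_le i := by
    refine Fin.addCases (fun j => ?_) (fun j => ?_) i
    · rw [Fin.append_left]; exact Φ.right_le j
    · rw [Fin.append_right]; exact Ψ.right_le j
  measurableSet_region i := by
    refine Fin.addCases (fun j => ?_) (fun j => ?_) i
    · rw [Fin.append_left]; exact Φ.measurableSet_region j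
    · rw [Fin.append_right]; exact Ψ.measurableSet_region j
  volume_region_lt_top i := by
    refine Fin.addCases (fun j => ?_) (fun j => ?_) i
    · rw [Fin.append_left]; exact Φ.volume_region_lt_top j
    · rw [Fin.append_right]; exact Ψ.volume_region_lt_top j
  measurable_coeff i := by
    refine Fin.addCases (fun j => ?_) (fun j => ?_) i
    · rw [Fin.append_left, Fin.append_left]; exact Φ.measurable_coeff j
    · rw [Fin.append_right, Fin.append_right]; exact Ψ.measurable_coeff j
  bounded_coeff i := by
    refine Fin.addCases (fun j => ?_) (fun j => ?_) i
    · rw [Fin.append_left]; exact Φ.bounded_coeff j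
    · rw [Fin.append_right]; exact Ψ.bounded_coeff j

lemma val_zero (z : ℝ × ℝ) (ω : Ω) : (zero η).val z ω = 0 := Fin.sum_univ_zero _

lemma integral_zero (ω : Ω) : (zero η).integral ω = 0 := Fin.sum_univ_zero _

lemma val_smul (c : ℝ) (Φ : SimpleField η) (z : ℝ × ℝ) (ω : Ω) :
    (smul c Φ).val z ω = c * Φ.val z ω := by
  rw [val, val, Finset.mul_sum]
  refine Finset.sum_congr rfl fun i _ => ?_
  by_cases hz : z ∈ Φ.box i
  · rw [indicator_of_mem hz, indicator_of_mem (by exact hz)]; rfl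
  · rw [indicator_of_notMem hz, indicator_of_notMem (by exact hz), mul_zero]

lemma integral_smul (c : ℝ) (Φ : SimpleField η) (ω : Ω) :
    (smul c Φ).integral ω = c * Φ.integral ω := by
  rw [integral, integral, Finset.mul_sum]
  exact Finset.sum_congr rfl fun i _ => mul_assoc _ _ _

lemma box_add_castAdd (Φ Ψ : SimpleField η) (i : Fin Φ.card) :
    (Φ.add Ψ).box (Fin.castAdd Ψ.card i) = Φ.box i := by
  simp only [box, add, Fin.append_left]

lemma box_add_natAdd (Φ Ψ : SimpleField η) (i : Fin Ψ.card) :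
    (Φ.add Ψ).box (Fin.natAdd Φ.card i) = Ψ.box i := by
  simp only [box, add, Fin.append_right]

lemma coeff_add_castAdd (Φ Ψ : SimpleField η) (i : Fin Φ.card) :
    (Φ.add Ψ).coeff (Fin.castAdd Ψ.card i) = Φ.coeff i := Fin.append_left _ _ _

lemma coeff_add_natAdd (Φ Ψ : SimpleField η) (i : Fin Ψ.card) :
    (Φ.add Ψ).coeff (Fin.natAdd Φ.card i) = Ψ.coeff i := Fin.append_right _ _ _

lemma val_add (Φ Ψ : SimpleField η) (z : ℝ × ℝ) (ω : Ω) :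
    (Φ.add Ψ).val z ω = Φ.val z ω + Ψ.val z ω := by
  refine (Fin.sum_univ_add _).trans ?_
  simp only [box_add_castAdd, box_add_natAdd, coeff_add_castAdd, coeff_add_natAdd]
  rfl

lemma integral_add (Φ Ψ : SimpleField η) (ω : Ω) :
    (Φ.add Ψ).integral ω = Φ.integral ω + Ψ.integral ω := by
  refine (Fin.sum_univ_add _).trans ?_
  simp only [box_add_castAdd, box_add_natAdd, coeff_add_castAdd, coeff_add_natAdd]
  rfl

/-- The difference of two simple fields. -/
def sub (Φ Ψ : SimpleField η) : SimpleField η := Φ.add (smul (-1) Ψ)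

lemma val_sub (Φ Ψ : SimpleField η) (z : ℝ × ℝ) (ω : Ω) :
    (Φ.sub Ψ).val z ω = Φ.val z ω - Ψ.val z ω := by
  rw [sub, val_add, val_smul, neg_one_mul, sub_eq_add_neg]

lemma integral_sub (Φ Ψ : SimpleField η) (ω : Ω) :
    (Φ.sub Ψ).integral ω = Φ.integral ω - Ψ.integral ω := by
  rw [sub, integral_add, integral_smul, neg_one_mul, sub_eq_add_neg]

end SimpleField

/-! ### The predictable σ-algebra -/

/-- The σ-algebra on `(ℝ × ℝ) × Ω` generated by the sets `((a, b] × A) × F` with `a ≥ 0` and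
`F ∈ ℱ_a`. No upper bound is put on `b`: only its trace on `(0, T] × ℝ × Ω` matters. -/
@[reducible] def predictable (η : WhiteNoise T P) : MeasurableSpace ((ℝ × ℝ) × Ω) :=
  MeasurableSpace.generateFrom {S | ∃ (a b : ℝ) (A : Set ℝ) (F : Set Ω), 0 ≤ a ∧ MeasurableSet A ∧
    MeasurableSet[η.filtration a] F ∧ S = (Ioc a b ×ˢ A) ×ˢ F}

lemma measurableSet_predictable_box (η : WhiteNoise T P) {a b : ℝ} {A : Set ℝ} {F : Set Ω}
    (ha : 0 ≤ a) (hA : MeasurableSet A) (hF : MeasurableSet[η.filtration a] F) :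
    MeasurableSet[η.predictable] ((Ioc a b ×ˢ A) ×ˢ F) :=
  MeasurableSpace.measurableSet_generateFrom ⟨a, b, A, F, ha, hA, hF, rfl⟩

lemma predictable_le (η : WhiteNoise T P) :
    η.predictable ≤ (inferInstance : MeasurableSpace ((ℝ × ℝ) × Ω)) := by
  refine MeasurableSpace.generateFrom_le ?_
  rintro _ ⟨a, b, A, F, -, hA, hF, rfl⟩
  exact (measurableSet_Ioc.prod hA).prod (η.filtration.le a _ hF)

lemma isPiSystem_predictable (η : WhiteNoise T P) :
    IsPiSystem {S : Set ((ℝ × ℝ) × Ω) | ∃ (a b : ℝ) (A : Set ℝ) (F : Set Ω), 0 ≤ a ∧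
      MeasurableSet A ∧ MeasurableSet[η.filtration a] F ∧ S = (Ioc a b ×ˢ A) ×ˢ F} := by
  rintro _ ⟨a, b, A, F, ha, hA, hF, rfl⟩ _ ⟨a', b', A', F', ha', hA', hF', rfl⟩ -
  refine ⟨max a a', min b b', A ∩ A', F ∩ F', ha.trans (le_max_left _ _), hA.inter hA',
    (η.filtration.mono (le_max_left a a') _ hF).inter
      (η.filtration.mono (le_max_right a a') _ hF'), ?_⟩
  rw [prod_inter_prod, prod_inter_prod, Ioc_inter_Ioc]

lemma measurable_val_predictable {η : WhiteNoise T P} (Φ : SimpleField η) :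
    Measurable[η.predictable] fun z : (ℝ × ℝ) × Ω => Φ.val z.1 z.2 := by
  refine Finset.measurable_sum _ fun i _ => ?_
  have hbox : ∀ F, MeasurableSet[η.filtration (Φ.left i)] F →
      MeasurableSet[η.predictable] (Φ.box i ×ˢ F) := fun F hF =>
    η.measurableSet_predictable_box (Φ.left_nonneg i) (Φ.measurableSet_region i) hF
  intro U hU
  have e : (fun z : (ℝ × ℝ) × Ω => (Φ.box i).indicator (fun _ => Φ.coeff i z.2) z.1) ⁻¹' U
      = (Φ.box i ×ˢ (Φ.coeff i ⁻¹' U)) ∪ ((Φ.box i ×ˢ univ)ᶜ ∩ {_z | (0 : ℝ) ∈ U}) := by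
    ext ⟨z, ω⟩
    by_cases hz : z ∈ Φ.box i <;> simp [hz]
  rw [e]
  refine (hbox _ (Φ.measurable_coeff i hU)).union
    ((hbox _ MeasurableSet.univ).compl.inter ?_)
  by_cases h : (0 : ℝ) ∈ U <;> simp [h]

/-- Deterministic Borel functions are predictable on positive times. -/
lemma measurableSet_predictable_fst (η : WhiteNoise T P) {B : Set (ℝ × ℝ)} (hB : MeasurableSet B) :
    MeasurableSet[η.predictable] ((B ∩ Ioi 0 ×ˢ univ) ×ˢ (univ : Set Ω)) := by
  have hIoi : ∀ A : Set ℝ, MeasurableSet A →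
      MeasurableSet[η.predictable] ((Ioi 0 ×ˢ A) ×ˢ (univ : Set Ω)) := by
    intro A hA
    have : (Ioi (0 : ℝ) ×ˢ A) ×ˢ (univ : Set Ω) = ⋃ n : ℕ, (Ioc (0 : ℝ) n ×ˢ A) ×ˢ univ := by
      ext ⟨⟨s, y⟩, ω⟩
      simp only [mem_prod, mem_Ioi, mem_univ, and_true, mem_iUnion, mem_Ioc]
      exact ⟨fun h => (exists_nat_ge s).imp fun n hn => ⟨⟨h.1, hn⟩, h.2⟩,
        fun ⟨n, h⟩ => ⟨h.1.1, h.2⟩⟩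
    rw [this]
    exact MeasurableSet.iUnion fun n =>
      η.measurableSet_predictable_box le_rfl hA MeasurableSet.univ
  have hgen : (Prod.instMeasurableSpace : MeasurableSpace (ℝ × ℝ)) = MeasurableSpace.generateFrom
      (image2 (fun s t => s ×ˢ t) {S : Set ℝ | ∃ l u, l < u ∧ Ioc l u = S} {A | MeasurableSet A}) := by
    refine (generateFrom_eq_prod ?_ MeasurableSpace.generateFrom_measurableSet ?_ ?_).symm
    · rw [← borel_eq_generateFrom_Ioc ℝ]; exact (BorelSpace.measurable_eq).symm
    · refine ⟨fun n : ℕ => Ioc (-(n + 1) : ℝ) (n + 1), fun n =>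
        ⟨_, _, by linarith [n.cast_nonneg (α := ℝ)], rfl⟩, ?_⟩
      refine eq_univ_of_forall fun x => mem_iUnion.2 ?_
      obtain ⟨n, hn⟩ := exists_nat_ge |x|
      have := abs_le.1 hn
      exact ⟨n, by constructor <;> linarith⟩
    · exact isCountablySpanning_measurableSet
  have key : ∀ B : Set (ℝ × ℝ), MeasurableSet B →
      MeasurableSet[η.predictable] ((B ∩ Ioi 0 ×ˢ univ) ×ˢ (univ : Set Ω)) := by
    intro B hB
    rw [hgen] at hB
    induction B, hB using MeasurableSpace.generateFrom_induction with
    | hC S hS _ =>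
      obtain ⟨_, ⟨l, u, -, rfl⟩, A, hA, rfl⟩ := hS
      have : (Ioc l u ×ˢ A) ∩ Ioi (0 : ℝ) ×ˢ univ = Ioc (max l 0) u ×ˢ A := by
        rw [prod_inter_prod, inter_univ]
        congr 1
        ext s
        simp only [mem_inter_iff, mem_Ioc, mem_Ioi, max_lt_iff]
        tauto
      change MeasurableSet[η.predictable] (((Ioc l u ×ˢ A) ∩ Ioi (0 : ℝ) ×ˢ univ) ×ˢ (univ : Set Ω))
      rw [this]
      exact η.measurableSet_predictable_box (le_max_right _ _) hA MeasurableSet.univ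
    | empty => simp
    | compl S _ ih =>
      have : (Sᶜ ∩ Ioi (0 : ℝ) ×ˢ univ) ×ˢ (univ : Set Ω)
          = (Ioi (0 : ℝ) ×ˢ univ) ×ˢ (univ : Set Ω) \ (S ∩ Ioi 0 ×ˢ univ) ×ˢ univ := by
        ext ⟨z, ω⟩
        simp only [mem_prod, mem_inter_iff, mem_compl_iff, mem_univ, and_true, Set.mem_sdiff]
        tauto
      rw [this]
      exact (hIoi univ MeasurableSet.univ).diff ih
    | iUnion f _ ih =>
      rw [iUnion_inter, iUnion_prod_const]
      exact MeasurableSet.iUnion ih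
  exact key B hB

lemma measurable_predictable_of_fst (η : WhiteNoise T P) {g : ℝ × ℝ → ℝ} (hg : Measurable g)
    (L : ℝ) :
    Measurable[η.predictable] fun z : (ℝ × ℝ) × Ω => (cell T L).indicator g z.1 := by
  intro U hU
  have hc : cell T L ∩ Ioi 0 ×ˢ univ = cell T L :=
    inter_eq_left.2 (prod_mono (fun s hs => hs.1) (subset_univ _))
  have hcell : MeasurableSet[η.predictable] (cell T L ×ˢ (univ : Set Ω)) := by
    have := η.measurableSet_predictable_fst (measurableSet_cell T L)
    rwa [hc] at this
  have e : (fun z : (ℝ × ℝ) × Ω => (cell T L).indicator g z.1) ⁻¹' U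
      = (((cell T L ∩ g ⁻¹' U) ∩ Ioi 0 ×ˢ univ) ×ˢ (univ : Set Ω))
        ∪ ((cell T L ×ˢ univ)ᶜ ∩ {_z | (0 : ℝ) ∈ U}) := by
    rw [inter_right_comm, hc]
    ext ⟨z, ω⟩
    by_cases hz : z ∈ cell T L <;> simp [hz]
  rw [e]
  refine (η.measurableSet_predictable_fst ((measurableSet_cell T L).inter (hg hU))).union
    (hcell.compl.inter ?_)
  by_cases h : (0 : ℝ) ∈ U <;> simp [h]

end WhiteNoise

/-! ### Density of simple fields -/

namespace WhiteNoise

variable {Ω : Type*} [mΩ : MeasurableSpace Ω] {T : ℝ} {P : Measure Ω}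

/-- A simple field vanishing outside `D`. -/
def SimpleField.SupportedOn {η : WhiteNoise T P} (Φ : SimpleField η) (D : Set (ℝ × ℝ)) : Prop :=
  ∀ z ∉ D, ∀ ω, Φ.val z ω = 0

lemma SimpleField.SupportedOn.add {η : WhiteNoise T P} {Φ Ψ : SimpleField η} {D : Set (ℝ × ℝ)}
    (h1 : Φ.SupportedOn D) (h2 : Ψ.SupportedOn D) : (Φ.add Ψ).SupportedOn D := fun z hz ω => by
  rw [Φ.val_add, h1 z hz, h2 z hz, add_zero]

lemma SimpleField.SupportedOn.sub {η : WhiteNoise T P} {Φ Ψ : SimpleField η} {D : Set (ℝ × ℝ)}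
    (h1 : Φ.SupportedOn D) (h2 : Ψ.SupportedOn D) : (Φ.sub Ψ).SupportedOn D := fun z hz ω => by
  rw [Φ.val_sub, h1 z hz, h2 z hz, sub_zero]

/-- On the cell, the generators of the predictable σ-algebra are simple fields. -/
lemma exists_simpleField_box (η : WhiteNoise T P) (L c : ℝ) {a b : ℝ} {A : Set ℝ}
    {F : Set Ω} (ha : 0 ≤ a) (hA : MeasurableSet A) (hF : MeasurableSet[η.filtration a] F) :
    ∃ Ψ : SimpleField η, Ψ.SupportedOn (cell T L) ∧ ∀ z ∈ cell T L, ∀ ω,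
      Ψ.val z ω = ((Ioc a b ×ˢ A) ×ˢ F).indicator (fun _ => c) (z, ω) := by
  rcases le_or_gt a T with haT | haT
  · let Ψ : SimpleField η := SimpleField.single a (max a (min b T)) (A ∩ Icc 0 L)
      (F.indicator fun _ => c) ha (le_max_left _ _) (max_le haT (min_le_right _ _))
      (hA.inter measurableSet_Icc)
      ((measure_mono inter_subset_right).trans_lt (by simp [Real.volume_Icc]))
      (measurable_const.indicator hF)
      ⟨|c|, fun ω => by by_cases h : ω ∈ F <;> simp [h]⟩
    have hval : ∀ z ω, Ψ.val z ω = (Ioc a (max a (min b T)) ×ˢ (A ∩ Icc 0 L)).indicator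
        (fun _ => F.indicator (fun _ => c) ω) z := fun z ω => Fin.sum_univ_one _
    have hmem : ∀ s, s ∈ Ioc a (max a (min b T)) ↔ s ∈ Ioc a b ∧ s ≤ T := by
      intro s
      simp only [mem_Ioc, le_max_iff, le_min_iff]
      constructor
      · rintro ⟨h1, h2 | h2⟩
        · exact absurd h1 (not_lt.2 h2)
        · exact ⟨⟨h1, h2.1⟩, h2.2⟩
      · rintro ⟨⟨h1, h2⟩, h3⟩
        exact ⟨h1, Or.inr ⟨h2, h3⟩⟩
    refine ⟨Ψ, fun z hz ω => ?_, fun z hz ω => ?_⟩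
    · rw [hval]
      refine indicator_of_notMem (fun h => hz ?_) _
      exact ⟨⟨ha.trans_lt h.1.1, ((hmem _).1 h.1).2⟩, h.2.2⟩
    · rw [hval]
      have hiff : z ∈ Ioc a (max a (min b T)) ×ˢ (A ∩ Icc 0 L) ↔ z ∈ Ioc a b ×ˢ A := by
        rw [mem_prod, mem_prod, hmem]
        exact ⟨fun h => ⟨h.1.1, h.2.1⟩, fun h => ⟨⟨h.1, hz.1.2⟩, h.2, hz.2⟩⟩
      by_cases h1 : z ∈ Ioc a b ×ˢ A
      · rw [indicator_of_mem (hiff.2 h1)]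
        by_cases h2 : ω ∈ F
        · rw [indicator_of_mem h2, indicator_of_mem (mk_mem_prod h1 h2)]
        · rw [indicator_of_notMem h2, indicator_of_notMem fun h => h2 h.2]
      · rw [indicator_of_notMem fun h => h1 (hiff.1 h), indicator_of_notMem fun h => h1 h.1]
  · refine ⟨SimpleField.zero η, fun z _ ω => SimpleField.val_zero z ω, fun z hz ω => ?_⟩
    rw [SimpleField.val_zero, indicator_of_notMem]
    exact fun h => absurd (hz.1.2.trans_lt haT) (not_lt.2 h.1.1.1.le)

/-- Approximation of indicators, by induction over the predictable σ-algebra. -/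
lemma exists_simpleField_approx_indicator (η : WhiteNoise T P) (L c : ℝ)
    (κ : Measure ((ℝ × ℝ) × Ω)) [IsFiniteMeasure κ] (hκ : κ (cell T L ×ˢ univ)ᶜ = 0) {p : ℝ≥0∞}
    (hp1 : 1 ≤ p) (hp : p ≠ ∞) (S : Set ((ℝ × ℝ) × Ω)) (hS : MeasurableSet[η.predictable] S) :
    ∀ ε : ℝ≥0∞, ε ≠ 0 → ∃ Ψ : SimpleField η, Ψ.SupportedOn (cell T L) ∧
      eLpNorm ((fun z : (ℝ × ℝ) × Ω => Ψ.val z.1 z.2) - S.indicator fun _ => c) p κ ≤ ε := by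
  have hp0 : p ≠ 0 := (zero_lt_one.trans_le hp1).ne'
  have hcell : ∀ᵐ z ∂κ, z.1 ∈ cell T L := by
    rw [ae_iff]
    exact measure_mono_null (t := (cell T L ×ˢ univ)ᶜ) (fun z hz h => hz h.1) hκ
  have hbox : ∀ (a b : ℝ) (A : Set ℝ) (F : Set Ω), 0 ≤ a → MeasurableSet A →
      MeasurableSet[η.filtration a] F → ∃ Ψ : SimpleField η, Ψ.SupportedOn (cell T L) ∧
      (fun z : (ℝ × ℝ) × Ω => Ψ.val z.1 z.2) =ᵐ[κ] ((Ioc a b ×ˢ A) ×ˢ F).indicator fun _ => c := by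
    intro a b A F ha hA hF
    obtain ⟨Ψ, h1, h2⟩ := η.exists_simpleField_box L c (b := b) ha hA hF
    exact ⟨Ψ, h1, hcell.mono fun z hz => h2 z.1 hz z.2⟩
  have hmv : ∀ Ψ : SimpleField η,
      AEStronglyMeasurable (fun z : (ℝ × ℝ) × Ω => Ψ.val z.1 z.2) κ := fun Ψ =>
    Ψ.measurable_val.aestronglyMeasurable
  have hmi : ∀ S, MeasurableSet[η.predictable] S →
      AEStronglyMeasurable (S.indicator fun _ : (ℝ × ℝ) × Ω => c) κ := fun S hS =>
    (measurable_const.indicator (η.predictable_le _ hS)).aestronglyMeasurable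
  induction S, hS using MeasurableSpace.induction_on_inter (m := η.predictable) rfl
    η.isPiSystem_predictable with
  | empty =>
    intro ε _
    refine ⟨SimpleField.zero η, fun z _ ω => SimpleField.val_zero z ω, ?_⟩
    have : (fun z : (ℝ × ℝ) × Ω => (SimpleField.zero η).val z.1 z.2) - (∅ : Set _).indicator
        (fun _ => c) = 0 := by ext z; simp [SimpleField.val_zero]
    rw [this, eLpNorm_zero]
    exact zero_le
  | basic S hS =>
    intro ε _
    obtain ⟨a, b, A, F, ha, hA, hF, rfl⟩ := hS
    obtain ⟨Ψ, h1, h2⟩ := hbox a b A F ha hA hF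
    refine ⟨Ψ, h1, ?_⟩
    rw [eLpNorm_congr_ae (g := 0) (h2.mono fun z hz => by simp [hz]), eLpNorm_zero]
    exact zero_le
  | compl S hS ih =>
    intro ε hε
    obtain ⟨Ψ, h1, h2⟩ := ih ε hε
    obtain ⟨Ψ₀, h3, h4⟩ := hbox 0 T univ univ le_rfl MeasurableSet.univ MeasurableSet.univ
    refine ⟨Ψ₀.sub Ψ, h3.sub h1, ?_⟩
    rw [← eLpNorm_neg]
    refine le_trans (eLpNorm_congr_ae ?_).le h2
    filter_upwards [h4, hcell] with z hz hzc
    have hu : ((Ioc 0 T ×ˢ univ) ×ˢ (univ : Set Ω)).indicator (fun _ => c) z = c :=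
      indicator_of_mem (show z ∈ (Ioc 0 T ×ˢ univ) ×ˢ (univ : Set Ω) from
        ⟨⟨hzc.1, trivial⟩, trivial⟩) _
    rw [hu] at hz
    simp only [Pi.neg_apply, Pi.sub_apply, SimpleField.val_sub, hz]
    by_cases h : z ∈ S
    · rw [indicator_of_mem h, indicator_of_notMem (by simpa using h)]; ring
    · rw [indicator_of_notMem h, indicator_of_mem (by exact h)]; ring
  | iUnion f hd hf ih =>
    intro ε hε
    -- finite unions are handled by addition, the tail of the union has small measure
    have hfin : ∀ n : ℕ, ∀ ε : ℝ≥0∞, ε ≠ 0 → ∃ Ψ : SimpleField η, Ψ.SupportedOn (cell T L) ∧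
        eLpNorm ((fun z : (ℝ × ℝ) × Ω => Ψ.val z.1 z.2)
          - (⋃ i ∈ Finset.range n, f i).indicator fun _ => c) p κ ≤ ε := by
      intro n
      induction n with
      | zero =>
        intro ε _
        refine ⟨SimpleField.zero η, fun z _ ω => SimpleField.val_zero z ω, ?_⟩
        have : (fun z : (ℝ × ℝ) × Ω => (SimpleField.zero η).val z.1 z.2)
            - (⋃ i ∈ Finset.range 0, f i).indicator (fun _ => c) = 0 := by
          ext z; simp [SimpleField.val_zero]
        rw [this, eLpNorm_zero]
        exact zero_le
      | succ n ihn =>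
        intro ε hε
        have hε2 : ε / 2 ≠ 0 := (ENNReal.half_pos hε).ne'
        obtain ⟨Ψ₁, h1, h2⟩ := ihn (ε / 2) hε2
        obtain ⟨Ψ₂, h3, h4⟩ := ih n (ε / 2) hε2
        refine ⟨Ψ₁.add Ψ₂, h1.add h3, ?_⟩
        have hdis : Disjoint (⋃ i ∈ Finset.range n, f i) (f n) := by
          simp only [disjoint_iUnion_left]
          exact fun i hi => hd (Finset.mem_range.1 hi).ne
        have e : (fun z : (ℝ × ℝ) × Ω => (Ψ₁.add Ψ₂).val z.1 z.2)
            - (⋃ i ∈ Finset.range (n + 1), f i).indicator (fun _ => c)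
            = ((fun z : (ℝ × ℝ) × Ω => Ψ₁.val z.1 z.2)
              - (⋃ i ∈ Finset.range n, f i).indicator fun _ => c)
              + ((fun z : (ℝ × ℝ) × Ω => Ψ₂.val z.1 z.2) - (f n).indicator fun _ => c) := by
          have hu : ⋃ i ∈ Finset.range (n + 1), f i = (⋃ i ∈ Finset.range n, f i) ∪ f n := by
            rw [Finset.range_add_one, Finset.set_biUnion_insert, union_comm]
          rw [hu, indicator_union_of_disjoint hdis]
          ext z
          simp only [Pi.sub_apply, Pi.add_apply, SimpleField.val_add]
          ring
        rw [e]
        refine (eLpNorm_add_le ((hmv _).sub (hmi _ ?_)) ((hmv _).sub (hmi _ (hf n))) hp1).trans ?_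
        · exact MeasurableSet.biUnion (Finset.range n).countable_toSet fun i _ => hf i
        · exact (add_le_add h2 h4).trans (ENNReal.add_halves ε).le
    have hε2 : ε / 2 ≠ 0 := (ENNReal.half_pos hε).ne'
    let V : ℕ → Set ((ℝ × ℝ) × Ω) := fun n => ⋃ i ∈ Finset.range n, f i
    have hV : ∀ n, MeasurableSet[η.predictable] (V n) := fun n =>
      MeasurableSet.biUnion (Finset.range n).countable_toSet fun i _ => hf i
    have hU : MeasurableSet[η.predictable] (⋃ i, f i) := MeasurableSet.iUnion hf
    have htend : Tendsto (fun n => ‖c‖ₑ * κ ((⋃ i, f i) \ V n) ^ (1 / p.toReal)) atTop (𝓝 0) := by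
      have h1 : Tendsto (fun n => κ ((⋃ i, f i) \ V n)) atTop (𝓝 0) := by
        have := tendsto_measure_iInter_atTop (μ := κ) (s := fun n => (⋃ i, f i) \ V n)
          (fun n => (η.predictable_le _ (hU.diff (hV n))).nullMeasurableSet)
          (fun m n hmn => sdiff_subset_sdiff_right
            (biUnion_subset_biUnion_left fun i hi => Finset.range_mono hmn hi))
          ⟨0, measure_ne_top _ _⟩
        have h0 : ⋂ n, (⋃ i, f i) \ V n = ∅ := by
          refine eq_empty_of_forall_notMem fun z hz => ?_
          obtain ⟨i, hi⟩ := mem_iUnion.1 (mem_iInter.1 hz 0).1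
          exact (mem_iInter.1 hz (i + 1)).2
            (mem_biUnion (Finset.mem_coe.2 (Finset.self_mem_range_succ i)) hi)
        rw [h0, measure_empty] at this
        exact this
      have hpp : 0 < 1 / p.toReal := one_div_pos.2 (ENNReal.toReal_pos hp0 hp)
      have h2 := (ENNReal.continuous_rpow_const (y := 1 / p.toReal)).tendsto 0
      rw [ENNReal.zero_rpow_of_pos hpp] at h2
      have h3 := ENNReal.Tendsto.const_mul (a := ‖c‖ₑ) (h2.comp h1) (Or.inr enorm_ne_top)
      rwa [mul_zero] at h3
    obtain ⟨n, hn⟩ := (htend.eventually (eventually_le_nhds (pos_iff_ne_zero.2 hε2))).exists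
    obtain ⟨Ψ, h1, h2⟩ := hfin n (ε / 2) hε2
    refine ⟨Ψ, h1, ?_⟩
    have hsub : V n ⊆ ⋃ i, f i := iUnion₂_subset fun i _ => subset_iUnion f i
    have e : (fun z : (ℝ × ℝ) × Ω => Ψ.val z.1 z.2) - (⋃ i, f i).indicator (fun _ => c)
        = ((fun z : (ℝ × ℝ) × Ω => Ψ.val z.1 z.2) - (V n).indicator fun _ => c)
          - ((⋃ i, f i) \ V n).indicator fun _ => c := by
      have := indicator_union_of_disjoint (disjoint_sdiff_right : Disjoint (V n) ((⋃ i, f i) \ V n))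
        (fun _ => c)
      rw [union_sdiff_cancel hsub] at this
      rw [this]
      ext z
      simp only [Pi.sub_apply]
      ring
    rw [e]
    refine (eLpNorm_sub_le ((hmv _).sub (hmi _ (hV n))) (hmi _ (hU.diff (hV n))) hp1).trans ?_
    rw [eLpNorm_indicator_const (η.predictable_le _ (hU.diff (hV n))) hp0 hp]
    exact (add_le_add h2 hn).trans (ENNReal.add_halves ε).le

/-- Predictable `L^p` functions on `(0, T] × [0, L] × Ω` are `L^p` limits of simple fields. -/
lemma exists_simpleField_approx (η : WhiteNoise T P) (L : ℝ)
    (κ : Measure ((ℝ × ℝ) × Ω)) [IsFiniteMeasure κ] (hκ : κ (cell T L ×ˢ univ)ᶜ = 0) {p : ℝ≥0∞}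
    (hp1 : 1 ≤ p) (hp : p ≠ ∞) {v : (ℝ × ℝ) × Ω → ℝ} (hv : Measurable[η.predictable] v)
    (hvp : MemLp v p κ) {ε : ℝ≥0∞} (hε : ε ≠ 0) :
    ∃ Ψ : SimpleField η, Ψ.SupportedOn (cell T L) ∧
      eLpNorm (fun z : (ℝ × ℝ) × Ω => Ψ.val z.1 z.2 - v z) p κ ≤ ε := by
  have hle := η.predictable_le
  have hsm : ∀ f : (ℝ × ℝ) × Ω → ℝ, Measurable[η.predictable] f →
      StronglyMeasurable[η.predictable] f := fun f hf =>
    Measurable.stronglyMeasurable (mα := η.predictable) hf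
  have hvt : @MemLp _ _ η.predictable _ _ v p (κ.trim hle) := by
    refine ⟨(hsm v hv).aestronglyMeasurable, ?_⟩
    refine (eLpNorm_trim hle (hsm v hv)).trans_lt hvp.2
  obtain ⟨g, hg, Ψ, hΨ, rfl⟩ := @MemLp.induction_dense _ _ η.predictable _ p (κ.trim hle) hp
    (fun g => ∃ Ψ : SimpleField η, Ψ.SupportedOn (cell T L) ∧
      g = fun z : (ℝ × ℝ) × Ω => Ψ.val z.1 z.2)
    (fun c S hS _ ε hε => by
      obtain ⟨Ψ, h1, h2⟩ := η.exists_simpleField_approx_indicator L c κ hκ hp1 hp S hS ε hε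
      refine ⟨_, ?_, Ψ, h1, rfl⟩
      exact (eLpNorm_trim hle (hsm _ ((measurable_val_predictable Ψ).sub
        (measurable_const.indicator hS)))).trans_le h2)
    (fun f g hf hg => by
      obtain ⟨Ψ₁, h1, rfl⟩ := hf
      obtain ⟨Ψ₂, h2, rfl⟩ := hg
      exact ⟨Ψ₁.add Ψ₂, h1.add h2, funext fun z => (Ψ₁.val_add Ψ₂ z.1 z.2).symm⟩)
    (fun f hf => by
      obtain ⟨Ψ, -, rfl⟩ := hf
      exact (hsm _ (measurable_val_predictable Ψ)).aestronglyMeasurable)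
    v hvt ε hε
  refine ⟨Ψ, hΨ, ?_⟩
  replace hg := (eLpNorm_trim hle (hsm _ (hv.sub (measurable_val_predictable Ψ)))).symm.trans_le hg
  rw [← eLpNorm_neg]
  refine le_trans (le_of_eq ?_) hg
  congr 1
  ext z
  simp
end WhiteNoise

lemma eLpNorm_natCast_pow {α : Type*} [MeasurableSpace α] (f : α → ℝ) {n : ℕ} (hn : n ≠ 0)
    (μ : Measure α) : eLpNorm f n μ ^ n = ∫⁻ x, ‖f x‖ₑ ^ n ∂μ := by
  have h := eLpNorm_nnreal_pow_eq_lintegral (f := f) (μ := μ) (p := (n : ℝ≥0))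
    (by exact_mod_cast hn)
  have e : ((n : ℝ≥0) : ℝ) = ((n : ℕ) : ℝ) := by simp
  rw [e, ENNReal.rpow_natCast, ENNReal.coe_natCast] at h
  rw [h]
  simp only [ENNReal.rpow_natCast]

/-! ### The Itô–Walsh integral -/

namespace WhiteNoise

variable {Ω : Type*} [mΩ : MeasurableSpace Ω] {T : ℝ} {P : Measure Ω}

/-- The product of Lebesgue measure on `[0, T] × ℝ` and `P`. -/
noncomputable abbrev fieldMeasure (T : ℝ) (P : Measure Ω) : Measure ((ℝ × ℝ) × Ω) :=
  (volume.restrict (strip T)).prod P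

/-- The product of Lebesgue measure on `(0, T] × [0, L]` and `P`. -/
noncomputable abbrev cellMeasure (T L : ℝ) (P : Measure Ω) : Measure ((ℝ × ℝ) × Ω) :=
  (volume.restrict (cell T L)).prod P

lemma fieldMeasure_restrict [SFinite P] (T L : ℝ) :
    (fieldMeasure T P).restrict (cell T L ×ˢ univ) = cellMeasure T L P := by
  rw [cellMeasure, fieldMeasure, ← Measure.prod_restrict, Measure.restrict_univ,
    Measure.restrict_restrict (measurableSet_cell T L),
    inter_eq_left.2 (cell_subset_strip T L)]

instance isFiniteMeasure_cellMeasure [IsFiniteMeasure P] (T L : ℝ) :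
    IsFiniteMeasure (cellMeasure T L P) := by
  have : IsFiniteMeasure ((volume : Measure (ℝ × ℝ)).restrict (cell T L)) :=
    ⟨by rw [Measure.restrict_apply_univ, volume_cell]
        exact ENNReal.mul_lt_top ENNReal.ofReal_lt_top ENNReal.ofReal_lt_top⟩
  unfold cellMeasure
  infer_instance

lemma cellMeasure_compl [SFinite P] (T L : ℝ) :
    cellMeasure T L P (cell T L ×ˢ univ)ᶜ = 0 := by
  have hm : MeasurableSet (cell T L ×ˢ (univ : Set Ω)) := (measurableSet_cell T L).prod .univ
  rw [← fieldMeasure_restrict, Measure.restrict_apply hm.compl]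
  simp

lemma eLpNorm_fieldMeasure_eq [SFinite P] {f : (ℝ × ℝ) × Ω → ℝ} {L : ℝ}
    (hf : ∀ z, z.1 ∉ cell T L → f z = 0) (p : ℝ≥0∞) :
    eLpNorm f p (fieldMeasure T P) = eLpNorm f p (cellMeasure T L P) := by
  rw [← fieldMeasure_restrict, eLpNorm_restrict_eq_of_support_subset]
  exact fun z hz => ⟨by_contra fun h => hz (hf z h), trivial⟩

lemma lintegral_fieldMeasure_eq [SFinite P] {f : (ℝ × ℝ) × Ω → ℝ≥0∞} {L : ℝ}
    (hf : ∀ z, z.1 ∉ cell T L → f z = 0) :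
    ∫⁻ z, f z ∂(fieldMeasure T P) = ∫⁻ z, f z ∂(cellMeasure T L P) := by
  rw [← fieldMeasure_restrict, setLIntegral_eq_of_support_subset]
  exact fun z hz => ⟨by_contra fun h => hz (hf z h), trivial⟩

lemma cellMeasure_le [SFinite P] (T L : ℝ) : cellMeasure T L P ≤ fieldMeasure T P := by
  rw [← fieldMeasure_restrict]
  exact Measure.restrict_le_self

/-- The constant in the `L²` estimate for the stochastic integral. -/
noncomputable def isometryConst : ℝ≥0 := momentConst 1 + 1

variable {η : WhiteNoise T P}

lemma SimpleField.eLpNorm_integral_le (Φ : SimpleField η) (hT : 0 ≤ T) :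
    eLpNorm Φ.integral 2 P ≤
      isometryConst * eLpNorm (fun z : (ℝ × ℝ) × Ω => Φ.val z.1 z.2) 2 (fieldMeasure T P) := by
  have := η.isProbabilityMeasure
  let B : Set (ℝ × ℝ) := ⋃ i, Φ.box i
  have hB : MeasurableSet B := MeasurableSet.iUnion fun i => (Φ.isNoiseSet_box' i).1
  have hBv : volume B < ∞ := (measure_iUnion_fintype_le _ _).trans_lt
    (ENNReal.sum_lt_top.2 fun i _ => (Φ.isNoiseSet_box' i).2.2)
  have hne : volume B + 1 ≠ ∞ := ENNReal.add_ne_top.2 ⟨hBv.ne, ENNReal.one_ne_top⟩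
  have hne0 : volume B + 1 ≠ 0 := by simp
  have h := Φ.lintegral_integral_pow_le hT le_rfl
    (w := B.indicator fun _ => (volume B + 1)⁻¹) (measurable_const.indicator hB)
    (fun z => by
      by_cases hz : z ∈ B
      · rw [indicator_of_mem hz]; exact ENNReal.inv_ne_top.2 hne0
      · rw [indicator_of_notMem hz]; exact ENNReal.zero_ne_top)
    (fun z ω hw => by
      have hz : z ∉ B := fun hz => by
        rw [indicator_of_mem hz] at hw
        exact hne (ENNReal.inv_eq_zero.1 hw)
      exact Finset.sum_eq_zero fun i _ =>
        indicator_of_notMem (fun hi => hz (mem_iUnion.2 ⟨i, hi⟩)) _)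
    (by
      refine (setLIntegral_le_lintegral _ _).trans ?_
      rw [lintegral_indicator_const hB, ← ENNReal.div_eq_inv_mul]
      exact ENNReal.div_le_of_le_mul (by rw [one_mul]; exact le_self_add))
  simp only [mul_one, tsub_self, pow_zero, one_mul] at h
  have h2 : ∀ {α : Type _} [MeasurableSpace α] (f : α → ℝ) (μ : Measure α),
      ∫⁻ x, ‖f x‖ₑ ^ 2 ∂μ = eLpNorm f 2 μ ^ 2 := fun f μ =>
    (eLpNorm_natCast_pow f two_ne_zero μ).symm
  rw [h2, h2 fun z : (ℝ × ℝ) × Ω => Φ.val z.1 z.2] at h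
  rw [← ENNReal.pow_le_pow_left_iff two_ne_zero]
  refine h.trans ?_
  rw [mul_pow]
  refine mul_le_mul' ?_ le_rfl
  rw [isometryConst, ENNReal.coe_add, ENNReal.coe_one]
  calc (momentConst 1 : ℝ≥0∞) ≤ (momentConst 1 + 1) * 1 := by rw [mul_one]; exact le_self_add
    _ ≤ (momentConst 1 + 1) * (momentConst 1 + 1) := mul_le_mul' le_rfl le_add_self
    _ = _ := (sq _).symm

/-- Approximation to arbitrary accuracy, instead of along a sequence. -/
lemma isWalshIntegral_iff {Φ : ℝ × ℝ → Ω → ℝ} {Y : Ω → ℝ} :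
    η.IsWalshIntegral Φ Y ↔ ∀ ε : ℝ≥0∞, 0 < ε → ∃ Ψ : SimpleField η,
      eLpNorm (fun z : (ℝ × ℝ) × Ω => Ψ.val z.1 z.2 - Φ z.1 z.2) 2 (fieldMeasure T P) ≤ ε ∧
      eLpNorm (fun ω => Ψ.integral ω - Y ω) 2 P ≤ ε := by
  constructor
  · rintro ⟨Ψ, h1, h2⟩ ε hε
    obtain ⟨n, hn⟩ := ((h1.eventually (eventually_le_nhds hε)).and
      (h2.eventually (eventually_le_nhds hε))).exists
    exact ⟨Ψ n, hn⟩
  · intro h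
    have hpos : ∀ n : ℕ, 0 < (n : ℝ≥0∞)⁻¹ := fun n => by simp
    choose Ψ h1 h2 using fun n : ℕ => h _ (hpos n)
    exact ⟨Ψ, tendsto_of_tendsto_of_tendsto_of_le_of_le tendsto_const_nhds
      ENNReal.tendsto_inv_nat_nhds_zero (fun _ => zero_le) h1,
      tendsto_of_tendsto_of_tendsto_of_le_of_le tendsto_const_nhds
      ENNReal.tendsto_inv_nat_nhds_zero (fun _ => zero_le) h2⟩

lemma SimpleField.isWalshIntegral (Φ : SimpleField η) : η.IsWalshIntegral Φ.val Φ.integral :=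
  ⟨fun _ => Φ, by simp, by simp⟩

lemma IsWalshIntegral.congr {Φ Φ' : ℝ × ℝ → Ω → ℝ} {Y Y' : Ω → ℝ} (h : η.IsWalshIntegral Φ Y)
    (hΦ : (fun z : (ℝ × ℝ) × Ω => Φ z.1 z.2) =ᵐ[fieldMeasure T P] fun z => Φ' z.1 z.2)
    (hY : Y =ᵐ[P] Y') : η.IsWalshIntegral Φ' Y' := by
  obtain ⟨Ψ, h1, h2⟩ := h
  refine ⟨Ψ, h1.congr fun n => eLpNorm_congr_ae ?_, h2.congr fun n => eLpNorm_congr_ae ?_⟩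
  · filter_upwards [hΦ] with z hz
    rw [hz]
  · filter_upwards [hY] with ω hω
    rw [hω]

lemma IsWalshIntegral.sub {Φ Φ' : ℝ × ℝ → Ω → ℝ} {Y Y' : Ω → ℝ} (h : η.IsWalshIntegral Φ Y)
    (h' : η.IsWalshIntegral Φ' Y')
    (hΦ : AEStronglyMeasurable (fun z : (ℝ × ℝ) × Ω => Φ z.1 z.2) (fieldMeasure T P))
    (hΦ' : AEStronglyMeasurable (fun z : (ℝ × ℝ) × Ω => Φ' z.1 z.2) (fieldMeasure T P))
    (hY : AEStronglyMeasurable Y P) (hY' : AEStronglyMeasurable Y' P) :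
    η.IsWalshIntegral (fun z ω => Φ z ω - Φ' z ω) fun ω => Y ω - Y' ω := by
  rw [isWalshIntegral_iff] at *
  intro ε hε
  obtain ⟨Ψ, h1, h2⟩ := h (ε / 2) (ENNReal.half_pos hε.ne')
  obtain ⟨Ψ', h1', h2'⟩ := h' (ε / 2) (ENNReal.half_pos hε.ne')
  refine ⟨Ψ.sub Ψ', ?_, ?_⟩
  · rw [show (fun z : (ℝ × ℝ) × Ω => (Ψ.sub Ψ').val z.1 z.2 - (Φ z.1 z.2 - Φ' z.1 z.2))
      = (fun z => Ψ.val z.1 z.2 - Φ z.1 z.2) - fun z => Ψ'.val z.1 z.2 - Φ' z.1 z.2 by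
      ext z; simp only [SimpleField.val_sub, Pi.sub_apply]; ring]
    refine (eLpNorm_sub_le (Ψ.measurable_val.aestronglyMeasurable.sub hΦ)
      (Ψ'.measurable_val.aestronglyMeasurable.sub hΦ') one_le_two).trans ?_
    exact (add_le_add h1 h1').trans (ENNReal.add_halves ε).le
  · rw [show (fun ω => (Ψ.sub Ψ').integral ω - (Y ω - Y' ω))
      = (fun ω => Ψ.integral ω - Y ω) - fun ω => Ψ'.integral ω - Y' ω by
      ext ω; simp only [SimpleField.integral_sub, Pi.sub_apply]; ring]
    refine (eLpNorm_sub_le (Ψ.measurable_integral.aestronglyMeasurable.sub hY)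
      (Ψ'.measurable_integral.aestronglyMeasurable.sub hY') one_le_two).trans ?_
    exact (add_le_add h2 h2').trans (ENNReal.add_halves ε).le

/-- The stochastic integral is bounded on `L²`. -/
lemma IsWalshIntegral.eLpNorm_le {Φ : ℝ × ℝ → Ω → ℝ} {Y : Ω → ℝ} (h : η.IsWalshIntegral Φ Y)
    (hT : 0 ≤ T)
    (hΦ : AEStronglyMeasurable (fun z : (ℝ × ℝ) × Ω => Φ z.1 z.2) (fieldMeasure T P))
    (hY : AEStronglyMeasurable Y P) :
    eLpNorm Y 2 P ≤
      isometryConst * eLpNorm (fun z : (ℝ × ℝ) × Ω => Φ z.1 z.2) 2 (fieldMeasure T P) := by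
  obtain ⟨Ψ, h1, h2⟩ := h
  set N := eLpNorm (fun z : (ℝ × ℝ) × Ω => Φ z.1 z.2) 2 (fieldMeasure T P)
  have hle : ∀ n, eLpNorm Y 2 P ≤ eLpNorm (fun ω => (Ψ n).integral ω - Y ω) 2 P +
      isometryConst * (eLpNorm (fun z : (ℝ × ℝ) × Ω => (Ψ n).val z.1 z.2 - Φ z.1 z.2) 2
        (fieldMeasure T P) + N) := by
    intro n
    have e1 : Y = (Ψ n).integral - fun ω => (Ψ n).integral ω - Y ω := by ext ω; simp
    have e2 : (fun z : (ℝ × ℝ) × Ω => (Ψ n).val z.1 z.2)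
        = (fun z => (Ψ n).val z.1 z.2 - Φ z.1 z.2) + fun z => Φ z.1 z.2 := by ext z; simp
    have hm := (Ψ n).measurable_integral.aestronglyMeasurable (μ := P)
    calc eLpNorm Y 2 P ≤ eLpNorm (Ψ n).integral 2 P
          + eLpNorm (fun ω => (Ψ n).integral ω - Y ω) 2 P := by
          conv_lhs => rw [e1]
          exact eLpNorm_sub_le hm (hm.sub hY) one_le_two
      _ ≤ isometryConst * eLpNorm (fun z : (ℝ × ℝ) × Ω => (Ψ n).val z.1 z.2) 2 (fieldMeasure T P)
          + eLpNorm (fun ω => (Ψ n).integral ω - Y ω) 2 P :=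
        add_le_add ((Ψ n).eLpNorm_integral_le hT) le_rfl
      _ ≤ _ := by
        rw [add_comm]
        refine add_le_add le_rfl (mul_le_mul' le_rfl ?_)
        conv_lhs => rw [e2]
        exact eLpNorm_add_le ((Ψ n).measurable_val.aestronglyMeasurable.sub hΦ) hΦ one_le_two
  have hlim := h2.add (ENNReal.Tendsto.const_mul (a := (isometryConst : ℝ≥0∞))
    (h1.add (tendsto_const_nhds (x := N))) (Or.inr ENNReal.coe_ne_top))
  rw [zero_add, zero_add] at hlim
  exact ge_of_tendsto' hlim hle

/-- A Walsh integrable field agrees almost everywhere with a predictable one, an almost sure limit of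
simple fields. -/
lemma IsWalshIntegral.exists_predictable {Φ : ℝ × ℝ → Ω → ℝ} {Y : Ω → ℝ}
    (h : η.IsWalshIntegral Φ Y)
    (hΦ : AEStronglyMeasurable (fun z : (ℝ × ℝ) × Ω => Φ z.1 z.2) (fieldMeasure T P)) :
    ∃ v : (ℝ × ℝ) × Ω → ℝ, Measurable[η.predictable] v ∧
      (fun z : (ℝ × ℝ) × Ω => Φ z.1 z.2) =ᵐ[fieldMeasure T P] v := by
  obtain ⟨Ψ, h1, -⟩ := h
  obtain ⟨ns, -, hns⟩ := (tendstoInMeasure_of_tendsto_eLpNorm (f := fun n (z : (ℝ × ℝ) × Ω) =>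
    (Ψ n).val z.1 z.2) (g := fun z => Φ z.1 z.2) two_ne_zero
    (fun n => (Ψ n).measurable_val.aestronglyMeasurable) hΦ h1).exists_seq_tendsto_ae
  refine ⟨fun z => limsup (fun i => (Ψ (ns i)).val z.1 z.2) atTop, ?_, ?_⟩
  · exact Measurable.limsup (mδ := η.predictable) fun i => measurable_val_predictable (Ψ (ns i))
  · filter_upwards [hns] with z hz
    exact hz.limsup_eq.symm

/-- Predictable square integrable fields on a cell are Walsh integrable. -/
lemma exists_isWalshIntegral [IsProbabilityMeasure P] (η : WhiteNoise T P) (hT : 0 ≤ T) {L : ℝ}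
    {v : (ℝ × ℝ) × Ω → ℝ} (hv : Measurable[η.predictable] v)
    (hv0 : ∀ z, z.1 ∉ cell T L → v z = 0) (hv2 : MemLp v 2 (cellMeasure T L P)) :
    ∃ Y : Ω → ℝ, AEStronglyMeasurable Y P ∧ η.IsWalshIntegral (fun q ω => v (q, ω)) Y := by
  have hvm : Measurable v := hv.mono η.predictable_le le_rfl
  obtain ⟨e, he0, heS⟩ : ∃ e : ℕ → ℝ≥0∞, (∀ n, e n ≠ 0) ∧ (Antitone e ∧ ∑' n, e n ≠ ∞) := by
    refine ⟨fun n => 2⁻¹ ^ n, fun n => by simp, fun m n hmn => ?_, ?_⟩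
    · exact pow_le_pow_right_of_le_one' (by simp) hmn
    · rw [ENNReal.tsum_geometric, ENNReal.one_sub_inv_two, inv_inv]
      simp
  choose Ψ hs hΨ using fun n => η.exists_simpleField_approx L (cellMeasure T L P)
    (cellMeasure_compl T L) one_le_two (by simp) hv hv2 (he0 n)
  have hdiff : ∀ n, eLpNorm (fun z : (ℝ × ℝ) × Ω => (Ψ n).val z.1 z.2 - v z) 2
      (fieldMeasure T P) ≤ e n := fun n => by
    rw [eLpNorm_fieldMeasure_eq (L := L) fun z hz => by rw [hs n z.1 hz, hv0 z hz, sub_zero]]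
    exact hΨ n
  have hm2 : ∀ n, AEStronglyMeasurable (fun z : (ℝ × ℝ) × Ω => (Ψ n).val z.1 z.2 - v z)
      (fieldMeasure T P) := fun n =>
    ((Ψ n).measurable_val.sub hvm).aestronglyMeasurable
  have heN : ∀ n, e n ≠ ∞ := fun n => ne_top_of_le_ne_top heS.2 (ENNReal.le_tsum n)
  have hmem : ∀ n, MemLp (Ψ n).integral 2 P := fun n => by
    refine ⟨(Ψ n).measurable_integral.aestronglyMeasurable,
      ((Ψ n).eLpNorm_integral_le hT).trans_lt (ENNReal.mul_lt_top ENNReal.coe_lt_top ?_)⟩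
    rw [show (fun z : (ℝ × ℝ) × Ω => (Ψ n).val z.1 z.2)
      = (fun z => (Ψ n).val z.1 z.2 - v z) + v by ext z; simp]
    refine (eLpNorm_add_le (hm2 n) hvm.aestronglyMeasurable one_le_two).trans_lt ?_
    rw [eLpNorm_fieldMeasure_eq hv0]
    exact ENNReal.add_lt_top.2 ⟨(hdiff n).trans_lt (heN n).lt_top, hv2.2⟩
  have hcau : ∀ n m, eLpNorm ((Ψ n).integral - (Ψ m).integral) 2 P
      ≤ isometryConst * (e n + e m) := fun n m => by
    rw [show (Ψ n).integral - (Ψ m).integral = ((Ψ n).sub (Ψ m)).integral by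
      ext ω; rw [SimpleField.integral_sub, Pi.sub_apply]]
    refine (SimpleField.eLpNorm_integral_le _ hT).trans (mul_le_mul' le_rfl ?_)
    rw [show (fun z : (ℝ × ℝ) × Ω => ((Ψ n).sub (Ψ m)).val z.1 z.2)
      = (fun z => (Ψ n).val z.1 z.2 - v z) - fun z => (Ψ m).val z.1 z.2 - v z by
      ext z; simp only [SimpleField.val_sub, Pi.sub_apply]; ring]
    exact (eLpNorm_sub_le (hm2 n) (hm2 m) one_le_two).trans (add_le_add (hdiff n) (hdiff m))
  obtain ⟨Y, hY, hlim⟩ := Lp.cauchy_complete_eLpNorm one_le_two hmem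
    (B := fun n => (isometryConst * 2 + 1) * e n)
    (by
      rw [ENNReal.tsum_mul_left]
      exact ENNReal.mul_ne_top (by simp [ENNReal.mul_eq_top]) heS.2)
    (fun N n m hn hm => by
      refine (hcau n m).trans_lt ?_
      calc isometryConst * (e n + e m) ≤ isometryConst * (e N + e N) :=
            mul_le_mul' le_rfl (add_le_add (heS.1 hn) (heS.1 hm))
        _ = isometryConst * 2 * e N := by ring
        _ < isometryConst * 2 * e N + e N :=
          ENNReal.lt_add_right (ENNReal.mul_ne_top (by simp [ENNReal.mul_eq_top]) (heN N)) (he0 N)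
        _ = _ := by ring)
  refine ⟨Y, hY.1, Ψ, ?_, hlim⟩
  exact tendsto_of_tendsto_of_tendsto_of_le_of_le tendsto_const_nhds
    (ENNReal.tendsto_atTop_zero_of_tsum_ne_top heS.2) (fun _ => zero_le) hdiff

lemma SimpleField.integral_integral_eq_zero (Φ : SimpleField η) :
    Integrable Φ.integral P ∧ ∫ ω, Φ.integral ω ∂P = 0 := by
  have := η.isProbabilityMeasure
  have hint : ∀ i, Integrable (fun ω => Φ.coeff i ω * η.eval (Φ.box i) ω) P := fun i => by
    obtain ⟨C, hC⟩ := Φ.bounded_coeff i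
    exact ((η.memLp_eval ⟨_, Φ.isNoiseSet_box' i⟩).integrable one_le_two).bdd_mul
      (Φ.measurable_coeff' i).aestronglyMeasurable (ae_of_all _ fun ω => hC ω)
  refine ⟨integrable_finsetSum _ fun i _ => hint i, ?_⟩
  unfold SimpleField.integral
  rw [integral_finsetSum _ fun i _ => hint i]
  refine Finset.sum_eq_zero fun i _ => ?_
  have hind : IndepFun (Φ.coeff i) (η.eval (Φ.box i)) P := by
    have h := η.indep_filtration (fun _ : Unit => ⟨Φ.box i, Φ.isNoiseSet_box' i⟩) (Φ.left i)
      (fun _ => by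
        rw [Set.disjoint_left]
        exact fun z hz hz' => absurd hz'.1.2 (not_le.2 hz.1.1))
    rw [IndepFun_iff_Indep]
    refine indep_of_indep_of_le_right (indep_of_indep_of_le_left h
      (Φ.measurable_coeff i).comap_le) ?_
    rw [← measurable_iff_comap_le]
    exact (measurable_pi_apply (X := fun _ : Unit => ℝ) ()).comp (comap_measurable _)
  rw [hind.integral_fun_mul_eq_mul_integral (Φ.measurable_coeff' i).aestronglyMeasurable
    (η.memLp_eval ⟨_, Φ.isNoiseSet_box' i⟩).1]
  rw [show ∫ ω, η.eval (Φ.box i) ω ∂P = 0 from η.mean_eq_zero ⟨_, Φ.isNoiseSet_box' i⟩, mul_zero]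

/-- Stochastic integrals have mean zero. -/
lemma IsWalshIntegral.integral_eq_zero {Φ : ℝ × ℝ → Ω → ℝ} {Y : Ω → ℝ}
    (h : η.IsWalshIntegral Φ Y) (hY : AEStronglyMeasurable Y P) : ∫ ω, Y ω ∂P = 0 := by
  have := η.isProbabilityMeasure
  obtain ⟨Ψ, -, h2⟩ := h
  refine tendsto_nhds_unique (tendsto_integral_of_L1' Y hY (F := fun n => (Ψ n).integral)
    (Eventually.of_forall fun n => (Ψ n).integral_integral_eq_zero.1)
    (tendsto_of_tendsto_of_tendsto_of_le_of_le tendsto_const_nhds h2 (fun _ => zero_le)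
      fun n => ?_)) ?_
  · exact eLpNorm_le_eLpNorm_of_exponent_le one_le_two
      ((Ψ n).measurable_integral.aestronglyMeasurable.sub hY)
  · simp only [(Ψ _).integral_integral_eq_zero.2]
    exact tendsto_const_nhds

end WhiteNoise

/-! ### Moments of Itô–Walsh integrals -/

namespace WhiteNoise

variable {Ω : Type*} [mΩ : MeasurableSpace Ω] {T : ℝ} {P : Measure Ω}

variable {η : WhiteNoise T P}

/-- The weighted Burkholder-type inequality for simple fields, with respect to the measure of
density `w⁻¹ ^ (m - 1)`. -/
lemma SimpleField.lintegral_integral_pow_le_of_supportedOn [IsProbabilityMeasure P]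
    (Ψ : SimpleField η) (hT : 0 ≤ T) {L : ℝ} (hΨ : Ψ.SupportedOn (cell T L)) {m : ℕ} (hm : 1 ≤ m)
    {w : ℝ × ℝ → ℝ≥0∞} (hw : Measurable w) (hwt : ∀ z, w z ≠ ∞)
    (hwc : ∀ z ∈ cell T L, w z ≠ 0) (hwo : ∀ z ∉ cell T L, w z = 0)
    (hw1 : ∫⁻ z in cell T L, w z ≤ 1) :
    ∫⁻ ω, ‖Ψ.integral ω‖ₑ ^ (2 * m) ∂P ≤ momentConst m *
      ∫⁻ z, (w z.1)⁻¹ ^ (m - 1) * ‖Ψ.val z.1 z.2‖ₑ ^ (2 * m) ∂(cellMeasure T L P) := by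
  refine (Ψ.lintegral_integral_pow_le hT hm hw hwt
    (fun z ω hz => hΨ z (fun hc => hwc z hc hz) ω) ?_).trans ?_
  · refine le_trans (le_of_eq ?_) hw1
    have : ∫⁻ z in cell T L, w z ∂(volume.restrict (strip T)) = ∫⁻ z in strip T, w z :=
      setLIntegral_eq_of_support_subset fun z hz => by_contra fun h => hz (hwo z h)
    rw [← this, Measure.restrict_restrict (measurableSet_cell T L),
      inter_eq_left.2 (cell_subset_strip T L)]
  · refine mul_le_mul' le_rfl (le_of_eq ?_)
    exact lintegral_fieldMeasure_eq (f := fun z : (ℝ × ℝ) × Ω =>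
      (w z.1)⁻¹ ^ (m - 1) * ‖Ψ.val z.1 z.2‖ₑ ^ (2 * m)) fun z hz => by
      rw [hΨ z.1 hz, enorm_zero, zero_pow (by omega), mul_zero]

/-- A weighted Burkholder-type inequality for Itô–Walsh integrals. It follows from the one for
simple fields, since these are dense in the weighted `L^{2m}` space and, by Hölder's inequality,
convergence there implies convergence in `L²`. -/
theorem IsWalshIntegral.lintegral_pow_le [IsProbabilityMeasure P] {Φ : ℝ × ℝ → Ω → ℝ} {Y : Ω → ℝ}
    (h : η.IsWalshIntegral Φ Y) (hT : 0 ≤ T)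
    (hΦ : AEStronglyMeasurable (fun z : (ℝ × ℝ) × Ω => Φ z.1 z.2) (fieldMeasure T P))
    (hY : Measurable Y) {L : ℝ} (hΦ0 : ∀ z ∉ cell T L, ∀ ω, Φ z ω = 0) {m : ℕ} (hm : 1 ≤ m)
    {w : ℝ × ℝ → ℝ≥0∞} (hw : Measurable w) (hwt : ∀ z, w z ≠ ∞) {δ : ℝ≥0∞} (hδ : δ ≠ 0)
    (hwc : ∀ z ∈ cell T L, δ ≤ w z) (hwo : ∀ z ∉ cell T L, w z = 0)
    (hw1 : ∫⁻ z in cell T L, w z ≤ 1) :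
    ∫⁻ ω, ‖Y ω‖ₑ ^ (2 * m) ∂P ≤ momentConst m *
      ∫⁻ z, (w z.1)⁻¹ ^ (m - 1) * ‖Φ z.1 z.2‖ₑ ^ (2 * m) ∂(cellMeasure T L P) := by
  have hwc' : ∀ z ∈ cell T L, w z ≠ 0 := fun z hz h0 => hδ (le_zero_iff.1 (h0 ▸ hwc z hz))
  by_cases hfin : ∫⁻ z, (w z.1)⁻¹ ^ (m - 1) * ‖Φ z.1 z.2‖ₑ ^ (2 * m) ∂(cellMeasure T L P) = ∞
  · rw [hfin, ENNReal.mul_top]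
    · exact le_top
    · exact_mod_cast momentConst_ne_zero m
  obtain ⟨v, hv, hΦv⟩ := h.exists_predictable hΦ
  have hvm : Measurable v := hv.mono η.predictable_le le_rfl
  have hac := Measure.absolutelyContinuous_of_le (cellMeasure_le (P := P) T L)
  have hD : Measurable fun z : (ℝ × ℝ) × Ω => (w z.1)⁻¹ ^ (m - 1) :=
    (hw.comp measurable_fst).inv.pow_const _
  -- the weighted measure and its norm
  let κ := (cellMeasure T L P).withDensity fun z : (ℝ × ℝ) × Ω => (w z.1)⁻¹ ^ (m - 1)
  have hκac : κ ≪ cellMeasure T L P := withDensity_absolutelyContinuous _ _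
  have hcell : ∀ᵐ z ∂(cellMeasure T L P), z.1 ∈ cell T L := by
    rw [ae_iff]
    exact measure_mono_null (t := (cell T L ×ˢ univ)ᶜ) (fun z hz h => hz h.1)
      (cellMeasure_compl T L)
  have hκfin : IsFiniteMeasure κ := by
    refine isFiniteMeasure_withDensity ?_
    refine ne_top_of_le_ne_top (b := ∫⁻ _, δ⁻¹ ^ (m - 1) ∂(cellMeasure T L P)) ?_
      (lintegral_mono_ae ?_)
    · rw [lintegral_const]
      exact ENNReal.mul_ne_top (ENNReal.pow_ne_top (ENNReal.inv_ne_top.2 hδ)) (measure_ne_top _ _)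
    · filter_upwards [hcell] with z hz
      gcongr
      exact hwc z.1 hz
  have hκnorm : ∀ f : (ℝ × ℝ) × Ω → ℝ, Measurable f → eLpNorm f ((2 * m : ℕ) : ℝ≥0∞) κ ^ (2 * m) =
      ∫⁻ z, (w z.1)⁻¹ ^ (m - 1) * ‖f z‖ₑ ^ (2 * m) ∂(cellMeasure T L P) := fun f hf => by
    rw [eLpNorm_natCast_pow f (by omega),
      lintegral_withDensity_eq_lintegral_mul _ hD (hf.enorm.pow_const _)]
    rfl
  have hvκ : eLpNorm v ((2 * m : ℕ) : ℝ≥0∞) κ ^ (2 * m)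
      = ∫⁻ z, (w z.1)⁻¹ ^ (m - 1) * ‖Φ z.1 z.2‖ₑ ^ (2 * m) ∂(cellMeasure T L P) := by
    rw [hκnorm v hvm]
    refine lintegral_congr_ae ?_
    filter_upwards [hac.ae_le hΦv] with z hz
    rw [hz]
  have hp1 : (1 : ℝ≥0∞) ≤ ((2 * m : ℕ) : ℝ≥0∞) := by exact_mod_cast (by omega : 1 ≤ 2 * m)
  have hvp : MemLp v ((2 * m : ℕ) : ℝ≥0∞) κ := by
    refine ⟨hvm.aestronglyMeasurable, ?_⟩
    rw [lt_top_iff_ne_top]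
    intro htop
    rw [htop, ENNReal.top_pow (by omega)] at hvκ
    exact hfin hvκ.symm
  have hpos : ∀ n : ℕ, (n : ℝ≥0∞)⁻¹ ≠ 0 := fun n => by simp
  choose Ψ hs hΨ using fun n : ℕ => η.exists_simpleField_approx L κ
    (hκac (cellMeasure_compl T L)) hp1 (ENNReal.natCast_ne_top _) hv hvp (hpos n)
  -- Hölder's inequality: the weighted norm dominates the `L²` norm
  have hhold : ∀ n, eLpNorm (fun z : (ℝ × ℝ) × Ω => (Ψ n).val z.1 z.2 - Φ z.1 z.2) 2
      (fieldMeasure T P) ≤ (n : ℝ≥0∞)⁻¹ := fun n => by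
    refine le_trans ?_ (hΨ n)
    rw [eLpNorm_fieldMeasure_eq (L := L) fun z hz => by rw [hs n z.1 hz, hΦ0 z.1 hz, sub_zero]]
    let f : (ℝ × ℝ) × Ω → ℝ := fun z => (cell T L ×ˢ univ).indicator
      (fun z => (Ψ n).val z.1 z.2 - v z) z
    have hfm : Measurable f :=
      ((Ψ n).measurable_val.sub hvm).indicator ((measurableSet_cell T L).prod .univ)
    have hfae : ∀ᵐ z ∂(cellMeasure T L P), f z = (Ψ n).val z.1 z.2 - v z := by
      filter_upwards [hcell] with z hz
      exact indicator_of_mem (show z ∈ cell T L ×ˢ univ from ⟨hz, trivial⟩) _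
    rw [← eLpNorm_congr_ae (f := f) (μ := κ) (hκac.ae_le hfae),
      eLpNorm_congr_ae (g := f) (μ := cellMeasure T L P) (by
        filter_upwards [hfae, hac.ae_le hΦv] with z h1 h2
        rw [h1, h2]), ← ENNReal.pow_le_pow_left_iff (n := 2 * m) (by omega), hκnorm f hfm, pow_mul]
    have h2 := eLpNorm_natCast_pow f two_ne_zero (cellMeasure T L P)
    rw [Nat.cast_two] at h2
    rw [h2]
    have hl := lintegral_pow_le_weight (μ := cellMeasure T L P) hm (w := fun z => w z.1)
      (Q := fun z => ‖f z‖ₑ ^ 2) (hw.comp measurable_fst) (hfm.enorm.pow_const 2)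
      (fun z => hwt z.1) (fun z hz => by
        have : f z = 0 := indicator_of_notMem
          (show z ∉ cell T L ×ˢ univ from fun hc => hwc' z.1 hc.1 hz) _
        simp [this])
    refine hl.trans ?_
    have h1 : ∫⁻ z, w z.1 ∂(cellMeasure T L P) ≤ 1 := by
      rw [cellMeasure, lintegral_prod (fun z : (ℝ × ℝ) × Ω => w z.1)
        (hw.comp measurable_fst).aemeasurable]
      simpa using hw1
    calc _ ≤ 1 ^ (m - 1) * ∫⁻ z, (w z.1)⁻¹ ^ (m - 1) * (‖f z‖ₑ ^ 2) ^ m ∂(cellMeasure T L P) := by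
          gcongr
      _ = _ := by simp only [one_pow, one_mul, pow_mul]
  have hconv : Tendsto (fun n => eLpNorm ((Ψ n).integral - Y) 2 P) atTop (𝓝 0) := by
    have hb : ∀ n, eLpNorm ((Ψ n).integral - Y) 2 P ≤ isometryConst * (n : ℝ≥0∞)⁻¹ := fun n =>
      (((Ψ n).isWalshIntegral.sub h (Ψ n).measurable_val.aestronglyMeasurable hΦ
        (Ψ n).measurable_integral.aestronglyMeasurable hY.aestronglyMeasurable).eLpNorm_le hT
        ((Ψ n).measurable_val.aestronglyMeasurable.sub hΦ)
        ((Ψ n).measurable_integral.aestronglyMeasurable.sub hY.aestronglyMeasurable)).trans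
        (mul_le_mul' le_rfl (hhold n))
    refine tendsto_of_tendsto_of_tendsto_of_le_of_le tendsto_const_nhds ?_ (fun _ => zero_le) hb
    have := ENNReal.Tendsto.const_mul (a := (isometryConst : ℝ≥0∞))
      ENNReal.tendsto_inv_nat_nhds_zero (Or.inr ENNReal.coe_ne_top)
    rwa [mul_zero] at this
  obtain ⟨ns, hmono, hns⟩ := (tendstoInMeasure_of_tendsto_eLpNorm two_ne_zero
    (fun n => (Ψ n).measurable_integral.aestronglyMeasurable) hY.aestronglyMeasurable
    hconv).exists_seq_tendsto_ae
  have hlim : ∫⁻ ω, ‖Y ω‖ₑ ^ (2 * m) ∂P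
      = ∫⁻ ω, liminf (fun i => ‖(Ψ (ns i)).integral ω‖ₑ ^ (2 * m)) atTop ∂P := by
    refine lintegral_congr_ae ?_
    filter_upwards [hns] with ω hω
    exact (((ENNReal.continuous_pow (2 * m)).tendsto _).comp
      ((continuous_enorm.tendsto _).comp hω)).liminf_eq.symm
  rw [hlim]
  refine (lintegral_liminf_le fun i => (Ψ (ns i)).measurable_integral.enorm.pow_const _).trans ?_
  have hup : ∀ i, ∫⁻ ω, ‖(Ψ (ns i)).integral ω‖ₑ ^ (2 * m) ∂P ≤ momentConst m *
      (((ns i : ℕ) : ℝ≥0∞)⁻¹ + eLpNorm v ((2 * m : ℕ) : ℝ≥0∞) κ) ^ (2 * m) := fun i => by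
    refine ((Ψ (ns i)).lintegral_integral_pow_le_of_supportedOn hT (hs _) hm hw hwt hwc' hwo
      hw1).trans (mul_le_mul' le_rfl ?_)
    rw [← hκnorm _ (Ψ (ns i)).measurable_val]
    gcongr
    rw [show (fun z : (ℝ × ℝ) × Ω => (Ψ (ns i)).val z.1 z.2)
      = (fun z => (Ψ (ns i)).val z.1 z.2 - v z) + v by ext z; simp]
    exact (eLpNorm_add_le ((Ψ (ns i)).measurable_val.sub hvm).aestronglyMeasurable
      hvm.aestronglyMeasurable hp1).trans (add_le_add (hΨ _) le_rfl)
  have hlim2 : Tendsto (fun i => (momentConst m : ℝ≥0∞) *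
      (((ns i : ℕ) : ℝ≥0∞)⁻¹ + eLpNorm v ((2 * m : ℕ) : ℝ≥0∞) κ) ^ (2 * m)) atTop
      (𝓝 (momentConst m * (0 + eLpNorm v ((2 * m : ℕ) : ℝ≥0∞) κ) ^ (2 * m))) :=
    ENNReal.Tendsto.const_mul (((ENNReal.continuous_pow (2 * m)).tendsto _).comp
      ((ENNReal.tendsto_inv_nat_nhds_zero.comp hmono.tendsto_atTop).add tendsto_const_nhds))
      (Or.inr ENNReal.coe_ne_top)
  rw [zero_add, hvκ] at hlim2
  rw [← hlim2.liminf_eq]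
  exact liminf_le_liminf (Eventually.of_forall hup)

/-- Moments of the stochastic integral of `g(s, y) v(s, y)` with deterministic `g`. -/
theorem IsWalshIntegral.lintegral_pow_le_of_mul [IsProbabilityMeasure P] {g : ℝ × ℝ → ℝ}
    {v : ℝ × ℝ → Ω → ℝ} {Y : Ω → ℝ} (h : η.IsWalshIntegral (fun z ω => g z * v z ω) Y)
    (hT : 0 < T) (hg : Measurable g) (hv : Measurable fun z : (ℝ × ℝ) × Ω => v z.1 z.2)
    (hY : Measurable Y) {L : ℝ} (hL : 0 < L) (hg0 : ∀ z ∉ cell T L, g z = 0) {m : ℕ} (hm : 1 ≤ m)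
    {W : ℝ≥0∞} (hW0 : W ≠ 0) (hWt : W ≠ ∞) (hgW : ∫⁻ z in cell T L, ‖g z‖ₑ ^ 2 ≤ W) :
    ∫⁻ ω, ‖Y ω‖ₑ ^ (2 * m) ∂P ≤ momentConst m * (2 * W) ^ (m - 1) *
      ∫⁻ z in cell T L, ‖g z‖ₑ ^ 2 * ∫⁻ ω, ‖v z ω‖ₑ ^ (2 * m) ∂P := by
  have hvol0 : volume (cell T L) ≠ 0 := by
    rw [volume_cell]
    simp [hT, hL]
  have hvolt : volume (cell T L) ≠ ∞ := by
    rw [volume_cell]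
    exact ENNReal.mul_ne_top ENNReal.ofReal_ne_top ENNReal.ofReal_ne_top
  have h2W0 : 2 * W ≠ 0 := mul_ne_zero two_ne_zero hW0
  have h2Wt : 2 * W ≠ ∞ := ENNReal.mul_ne_top ENNReal.ofNat_ne_top hWt
  have h2V0 : 2 * volume (cell T L) ≠ 0 := mul_ne_zero two_ne_zero hvol0
  have h2Vt : 2 * volume (cell T L) ≠ ∞ := ENNReal.mul_ne_top ENNReal.ofNat_ne_top hvolt
  let w : ℝ × ℝ → ℝ≥0∞ := (cell T L).indicator fun z =>
    (2 * W)⁻¹ * ‖g z‖ₑ ^ 2 + (2 * volume (cell T L))⁻¹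
  have hwm : Measurable w :=
    (((hg.enorm.pow_const 2).const_mul _).add_const _).indicator (measurableSet_cell T L)
  have hwc : ∀ z ∈ cell T L, w z = (2 * W)⁻¹ * ‖g z‖ₑ ^ 2 + (2 * volume (cell T L))⁻¹ :=
    fun z hz => indicator_of_mem hz _
  have hwo : ∀ z ∉ cell T L, w z = 0 := fun z hz => indicator_of_notMem hz _
  have hmeas : Measurable fun z : (ℝ × ℝ) × Ω => g z.1 * v z.1 z.2 :=
    (hg.comp measurable_fst).mul hv
  refine (h.lintegral_pow_le hT.le hmeas.aestronglyMeasurable hY (L := L)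
    (fun z hz ω => by rw [hg0 z hz, zero_mul]) hm hwm (δ := (2 * volume (cell T L))⁻¹)
    (fun z => ?_) (ENNReal.inv_ne_zero.2 h2Vt) (fun z hz => ?_) hwo ?_).trans ?_
  · by_cases hz : z ∈ cell T L
    · rw [hwc z hz]
      exact ENNReal.add_ne_top.2 ⟨ENNReal.mul_ne_top (ENNReal.inv_ne_top.2 h2W0)
        (ENNReal.pow_ne_top enorm_ne_top), ENNReal.inv_ne_top.2 h2V0⟩
    · rw [hwo z hz]; exact ENNReal.zero_ne_top
  · rw [hwc z hz]; exact le_add_self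
  · rw [setLIntegral_congr_fun (measurableSet_cell T L) hwc, lintegral_add_right _ measurable_const,
      lintegral_const_mul _ (hg.enorm.pow_const 2), setLIntegral_const]
    have e : ∀ a : ℝ≥0∞, a ≠ 0 → a ≠ ∞ → (2 * a)⁻¹ * a = 2⁻¹ := fun a h0 ht => by
      rw [ENNReal.mul_inv (Or.inl two_ne_zero) (Or.inl ENNReal.ofNat_ne_top), mul_assoc,
        ENNReal.inv_mul_cancel h0 ht, mul_one]
    rw [e _ hvol0 hvolt]
    refine (add_le_add (mul_le_mul' le_rfl hgW) le_rfl).trans ?_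
    rw [e _ hW0 hWt, ENNReal.inv_two_add_inv_two]
  · rw [mul_assoc]
    refine mul_le_mul' le_rfl ?_
    have hR : Measurable fun z : (ℝ × ℝ) × Ω => ‖g z.1‖ₑ ^ 2 * ‖v z.1 z.2‖ₑ ^ (2 * m) :=
      ((hg.comp measurable_fst).enorm.pow_const 2).mul (hv.enorm.pow_const _)
    have hfub : ∫⁻ z in cell T L, ‖g z‖ₑ ^ 2 * ∫⁻ ω, ‖v z ω‖ₑ ^ (2 * m) ∂P
        = ∫⁻ z, ‖g z.1‖ₑ ^ 2 * ‖v z.1 z.2‖ₑ ^ (2 * m) ∂(cellMeasure T L P) := by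
      rw [cellMeasure, lintegral_prod _ hR.aemeasurable]
      refine lintegral_congr fun z => ?_
      simp only
      rw [lintegral_const_mul]
      exact (hv.comp measurable_prodMk_left).enorm.pow_const _
    rw [hfub, ← lintegral_const_mul _ hR]
    have hcell : ∀ᵐ z ∂(cellMeasure T L P), z.1 ∈ cell T L := by
      rw [ae_iff]
      exact measure_mono_null (t := (cell T L ×ˢ univ)ᶜ) (fun z hz h => hz h.1)
        (cellMeasure_compl T L)
    refine lintegral_mono_ae ?_
    filter_upwards [hcell] with z hz
    rw [enorm_mul, mul_pow, ← mul_assoc, ← mul_assoc]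
    refine mul_le_mul' ?_ le_rfl
    by_cases hgz : ‖g z.1‖ₑ = 0
    · rw [hgz, zero_pow (by omega), mul_zero]; exact zero_le
    -- on the cell, `w⁻¹ ≤ 2 W / |g|²`
    have hinv : (w z.1)⁻¹ * ‖g z.1‖ₑ ^ 2 ≤ 2 * W := by
      rw [← ENNReal.div_eq_inv_mul]
      refine ENNReal.div_le_of_le_mul ?_
      rw [hwc _ hz, mul_add, ← mul_assoc, ENNReal.mul_inv_cancel h2W0 h2Wt, one_mul]
      exact le_self_add
    obtain ⟨k, rfl⟩ : ∃ k, m = k + 1 := ⟨m - 1, by omega⟩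
    rw [Nat.add_sub_cancel, mul_add, mul_one, pow_add, pow_mul, ← mul_assoc, ← mul_pow]
    gcongr

end WhiteNoise

/-! ### Truncated powers -/

/-- The truncation `a ↦ (a ∧ N) ∨ (-N)`. -/
def truncate (N : ℕ) (a : ℝ) : ℝ := max (-N) (min a N)

/-- The function `|a|² (|a| ∧ N)^{2m - 2}`, which grows quadratically and increases to `|a|^{2m}` as
`N → ∞`. -/
noncomputable def truncPow (m N : ℕ) (a : ℝ) : ℝ≥0∞ := ‖a‖ₑ ^ 2 * min ‖a‖ₑ N ^ (2 * (m - 1))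

lemma measurable_truncate (N : ℕ) : Measurable (truncate N) :=
  measurable_const.max (measurable_id.min measurable_const)

lemma measurable_truncPow (m N : ℕ) : Measurable (truncPow m N) :=
  (measurable_enorm.pow_const _).mul ((measurable_enorm.min measurable_const).pow_const _)

lemma abs_truncate (N : ℕ) (a : ℝ) : |truncate N a| = min |a| N := by
  have hN : (0 : ℝ) ≤ N := N.cast_nonneg
  unfold truncate
  rcases le_total a N with h1 | h1
  · rcases le_total (-(N : ℝ)) a with h2 | h2
    · rw [min_eq_left h1, max_eq_right h2, min_eq_left (abs_le.2 ⟨h2, h1⟩)]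
    · rw [min_eq_left h1, max_eq_left h2, abs_neg, abs_of_nonneg hN, min_eq_right]
      exact (by linarith : (N : ℝ) ≤ -a).trans (neg_le_abs a)
  · rw [min_eq_right h1, max_eq_right (by linarith), abs_of_nonneg hN,
      min_eq_right (h1.trans (le_abs_self a))]

lemma abs_sub_truncate_le (N : ℕ) (a : ℝ) : |a - truncate N a| ≤ |a| := by
  have hN : (0 : ℝ) ≤ N := N.cast_nonneg
  unfold truncate
  rcases le_total a N with h1 | h1
  · rcases le_total (-(N : ℝ)) a with h2 | h2
    · rw [min_eq_left h1, max_eq_right h2, sub_self, abs_zero]; exact abs_nonneg a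
    · rw [min_eq_left h1, max_eq_left h2, abs_of_nonpos (by linarith), abs_of_nonpos (by linarith)]
      linarith
  · rw [min_eq_right h1, max_eq_right (by linarith), abs_of_nonneg (by linarith),
      abs_of_nonneg (by linarith)]
    linarith

lemma truncate_eq_self {N : ℕ} {a : ℝ} (h : |a| ≤ N) : truncate N a = a := by
  unfold truncate
  rw [min_eq_left (abs_le.1 h).2, max_eq_right (abs_le.1 h).1]

lemma enorm_le_natCast {a : ℝ} {N : ℕ} : ‖a‖ₑ ≤ N ↔ |a| ≤ N := by
  rw [Real.enorm_eq_ofReal_abs, ← ENNReal.ofReal_natCast,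
    ENNReal.ofReal_le_ofReal_iff N.cast_nonneg]

lemma enorm_truncate (N : ℕ) (a : ℝ) : ‖truncate N a‖ₑ = min ‖a‖ₑ N := by
  rw [Real.enorm_eq_ofReal_abs, abs_truncate, Real.enorm_eq_ofReal_abs, ENNReal.ofReal_min,
    ENNReal.ofReal_natCast]

lemma enorm_truncate_pow_le {m : ℕ} (hm : 1 ≤ m) (N : ℕ) (a : ℝ) :
    ‖truncate N a‖ₑ ^ (2 * m) ≤ truncPow m N a := by
  rw [enorm_truncate, truncPow, show 2 * m = 2 + 2 * (m - 1) by omega, pow_add]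
  gcongr
  exact min_le_left _ _

lemma enorm_sub_truncate_sq_le (m N : ℕ) (a : ℝ) :
    (N : ℝ≥0∞) ^ (2 * (m - 1)) * ‖a - truncate N a‖ₑ ^ 2 ≤ truncPow m N a := by
  rw [truncPow, mul_comm]
  rcases le_total ‖a‖ₑ N with h | h
  · rw [truncate_eq_self (enorm_le_natCast.1 h)]
    simp
  · rw [min_eq_right h]
    gcongr
    rw [enorm_le_iff_norm_le]
    exact abs_sub_truncate_le N a

lemma truncPow_le_pow {m : ℕ} (hm : 1 ≤ m) (N : ℕ) (a : ℝ) : truncPow m N a ≤ ‖a‖ₑ ^ (2 * m) := by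
  rw [truncPow, show 2 * m = 2 + 2 * (m - 1) by omega, pow_add]
  gcongr
  exact min_le_left _ _

lemma truncPow_le_sq (m N : ℕ) (a : ℝ) :
    truncPow m N a ≤ (N : ℝ≥0∞) ^ (2 * (m - 1)) * ‖a‖ₑ ^ 2 := by
  rw [truncPow, mul_comm]
  gcongr
  exact min_le_right _ _

lemma truncPow_le_of_enorm_le {m N : ℕ} (hm : 1 ≤ m) {a b : ℝ} (h : ‖a‖ₑ ≤ 3 * ‖b‖ₑ) :
    truncPow m N a ≤ 3 ^ (2 * m) * truncPow m N b := by
  have h1 : min ‖a‖ₑ N ≤ 3 * min ‖b‖ₑ N := by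
    rcases le_total ‖b‖ₑ N with hb | hb
    · rw [min_eq_left hb]; exact (min_le_left _ _).trans h
    · rw [min_eq_right hb]
      exact (min_le_right _ _).trans (le_mul_of_one_le_left zero_le (by norm_num))
  rw [truncPow, truncPow]
  calc _ ≤ (3 * ‖b‖ₑ) ^ 2 * (3 * min ‖b‖ₑ N) ^ (2 * (m - 1)) := by gcongr
    _ = 3 ^ (2 + 2 * (m - 1)) * (‖b‖ₑ ^ 2 * min ‖b‖ₑ N ^ (2 * (m - 1))) := by
      rw [mul_pow, mul_pow, pow_add]; ring
    _ = _ := by rw [show 2 + 2 * (m - 1) = 2 * m by omega]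

lemma truncPow_add_add_le {m : ℕ} (hm : 1 ≤ m) (N : ℕ) (a b c : ℝ) :
    truncPow m N (a + b + c) ≤ 3 ^ (2 * m) *
      (‖a‖ₑ ^ (2 * m) + ‖b‖ₑ ^ (2 * m) + (N : ℝ≥0∞) ^ (2 * (m - 1)) * ‖c‖ₑ ^ 2) := by
  have key : ∀ d : ℝ, |a| ≤ |d| → |b| ≤ |d| → |c| ≤ |d| →
      truncPow m N (a + b + c) ≤ 3 ^ (2 * m) * truncPow m N d := fun d ha hb hc => by
    refine truncPow_le_of_enorm_le hm ?_
    rw [Real.enorm_eq_ofReal_abs, Real.enorm_eq_ofReal_abs,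
      show (3 : ℝ≥0∞) = ENNReal.ofReal 3 by simp, ← ENNReal.ofReal_mul (by norm_num)]
    refine ENNReal.ofReal_le_ofReal ?_
    have := abs_add_three a b c
    linarith
  have hcase : (|a| ≤ |a| ∧ |b| ≤ |a| ∧ |c| ≤ |a|) ∨ (|a| ≤ |b| ∧ |b| ≤ |b| ∧ |c| ≤ |b|) ∨
      (|a| ≤ |c| ∧ |b| ≤ |c| ∧ |c| ≤ |c|) := by
    rcases le_total |a| |b| with h1 | h1 <;> rcases le_total |b| |c| with h2 | h2 <;>
      rcases le_total |a| |c| with h3 | h3 <;>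
      first
      | exact Or.inl ⟨le_rfl, by linarith, by linarith⟩
      | exact Or.inr (Or.inl ⟨by linarith, le_rfl, by linarith⟩)
      | exact Or.inr (Or.inr ⟨by linarith, by linarith, le_rfl⟩)
  rcases hcase with ⟨h1, h2, h3⟩ | ⟨h1, h2, h3⟩ | ⟨h1, h2, h3⟩
  · refine (key a h1 h2 h3).trans (mul_le_mul' le_rfl ((truncPow_le_pow hm N a).trans ?_))
    rw [add_assoc]; exact le_self_add
  · refine (key b h1 h2 h3).trans (mul_le_mul' le_rfl ((truncPow_le_pow hm N b).trans ?_))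
    exact le_add_self.trans le_self_add
  · exact (key c h1 h2 h3).trans (mul_le_mul' le_rfl ((truncPow_le_sq m N c).trans le_add_self))

lemma tendsto_truncPow {m : ℕ} (hm : 1 ≤ m) (a : ℝ) :
    Tendsto (fun N : ℕ => truncPow m N a) atTop (𝓝 (‖a‖ₑ ^ (2 * m))) := by
  obtain ⟨n, hn⟩ := exists_nat_ge |a|
  refine tendsto_const_nhds.congr' ?_
  filter_upwards [eventually_ge_atTop n] with N hN
  rw [truncPow, min_eq_left (enorm_le_natCast.2 (hn.trans (by exact_mod_cast hN))), ← pow_add]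
  congr 1
  omega

/-! ### Truncation of the integrand -/

namespace WhiteNoise

variable {Ω : Type*} [mΩ : MeasurableSpace Ω] {T : ℝ} {P : Measure Ω} {η : WhiteNoise T P}

/-- The integral of a product `g v`, `g` deterministic, splits into the integrals of `g` times the
truncation of `v` and of `g` times the remainder. -/
lemma IsWalshIntegral.exists_truncate [IsProbabilityMeasure P] {g : ℝ × ℝ → ℝ}
    {v : ℝ × ℝ → Ω → ℝ} {Y : Ω → ℝ} (h : η.IsWalshIntegral (fun z ω => g z * v z ω) Y)
    (hT : 0 ≤ T) (hg : Measurable g) (hv : Measurable fun z : (ℝ × ℝ) × Ω => v z.1 z.2)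
    (hY : Measurable Y) {L : ℝ} (hg0 : ∀ z ∉ cell T L, g z = 0)
    (hg2 : ∫⁻ z in cell T L, ‖g z‖ₑ ^ 2 ≠ ∞) (N : ℕ) :
    ∃ Y₁ : Ω → ℝ, Measurable Y₁ ∧
      η.IsWalshIntegral (fun z ω => g z * truncate N (v z ω)) Y₁ ∧
      η.IsWalshIntegral (fun z ω => g z * (v z ω - truncate N (v z ω))) fun ω => Y ω - Y₁ ω := by
  have hgv : Measurable fun z : (ℝ × ℝ) × Ω => g z.1 * v z.1 z.2 :=
    (hg.comp measurable_fst).mul hv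
  have hgt : Measurable fun z : (ℝ × ℝ) × Ω => g z.1 * truncate N (v z.1 z.2) :=
    (hg.comp measurable_fst).mul ((measurable_truncate N).comp hv)
  obtain ⟨q, hq, hqae⟩ := h.exists_predictable hgv.aestronglyMeasurable
  have hgp : Measurable[η.predictable] fun z : (ℝ × ℝ) × Ω => g z.1 := by
    have := η.measurable_predictable_of_fst hg L
    refine (congrArg (@Measurable _ _ η.predictable _) (funext fun z => ?_)).mp this
    by_cases hz : z.1 ∈ cell T L
    · rw [indicator_of_mem hz]
    · rw [indicator_of_notMem hz, hg0 _ hz]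
  -- where `g ≠ 0`, the field `v` is the quotient of a predictable field by `g`
  let q' : (ℝ × ℝ) × Ω → ℝ := fun z => g z.1 * truncate N (q z / g z.1)
  have hq' : Measurable[η.predictable] q' := hgp.mul ((measurable_truncate N).comp (hq.div hgp))
  have hae : (fun z : (ℝ × ℝ) × Ω => q' z) =ᵐ[fieldMeasure T P]
      fun z => g z.1 * truncate N (v z.1 z.2) := by
    filter_upwards [hqae] with z hz
    by_cases h0 : g z.1 = 0
    · simp only [q', h0, zero_mul]
    · simp only [q', ← hz, mul_div_cancel_left₀ _ h0]
  have hmem : MemLp q' 2 (cellMeasure T L P) := by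
    have hgm : MemLp (fun z : (ℝ × ℝ) × Ω => (N : ℝ) * g z.1) 2 (cellMeasure T L P) := by
      refine MemLp.const_mul ⟨(hg.comp measurable_fst).aestronglyMeasurable, ?_⟩ _
      have h2 := eLpNorm_natCast_pow (fun z : (ℝ × ℝ) × Ω => g z.1) two_ne_zero (cellMeasure T L P)
      rw [Nat.cast_two] at h2
      have h3 : eLpNorm (fun z : (ℝ × ℝ) × Ω => g z.1) 2 (cellMeasure T L P) ^ 2 < ∞ := ?_
      · exact (ENNReal.pow_lt_top_iff.1 h3).resolve_right two_ne_zero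
      rw [h2]
      rw [cellMeasure, lintegral_prod (fun z : (ℝ × ℝ) × Ω => ‖g z.1‖ₑ ^ 2)
        ((hg.comp measurable_fst).enorm.pow_const 2).aemeasurable]
      simpa [lt_top_iff_ne_top] using hg2
    refine hgm.mono (hq'.mono η.predictable_le le_rfl).aestronglyMeasurable (ae_of_all _ fun z => ?_)
    simp only [q', norm_mul, Real.norm_eq_abs, abs_truncate, Nat.abs_cast]
    rw [mul_comm]
    gcongr
    exact min_le_right _ _
  obtain ⟨Y₀, hY₀, hW⟩ := η.exists_isWalshIntegral hT hq'
    (fun z hz => by simp only [q', hg0 _ hz, zero_mul]) hmem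
  have h1 : η.IsWalshIntegral (fun z ω => g z * truncate N (v z ω)) (hY₀.mk Y₀) :=
    hW.congr hae hY₀.ae_eq_mk
  refine ⟨hY₀.mk Y₀, hY₀.stronglyMeasurable_mk.measurable, h1, ?_⟩
  have h2 := h.sub h1 hgv.aestronglyMeasurable hgt.aestronglyMeasurable hY.aestronglyMeasurable
    hY₀.stronglyMeasurable_mk.aestronglyMeasurable
  simpa only [mul_sub] using h2

/-- Truncated moments of `c + ∫ g v dη`, in terms of those of `v`. -/
lemma IsWalshIntegral.lintegral_truncPow_le [IsProbabilityMeasure P] {g : ℝ × ℝ → ℝ}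
    {v : ℝ × ℝ → Ω → ℝ} {Y : Ω → ℝ} (h : η.IsWalshIntegral (fun z ω => g z * v z ω) Y)
    (hT : 0 < T) (hg : Measurable g) (hv : Measurable fun z : (ℝ × ℝ) × Ω => v z.1 z.2)
    (hY : Measurable Y) {L : ℝ} (hL : 0 < L) (hg0 : ∀ z ∉ cell T L, g z = 0) {m : ℕ} (hm : 1 ≤ m)
    {W : ℝ≥0∞} (hW0 : W ≠ 0) (hWt : W ≠ ∞) (hgW : ∫⁻ z in cell T L, ‖g z‖ₑ ^ 2 ≤ W) (c : ℝ)
    (N : ℕ) :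
    ∫⁻ ω, truncPow m N (c + Y ω) ∂P ≤ 3 ^ (2 * m) * (‖c‖ₑ ^ (2 * m) +
      (momentConst m * (2 * W) ^ (m - 1) + momentConst 1) *
        ∫⁻ z in cell T L, ‖g z‖ₑ ^ 2 * ∫⁻ ω, truncPow m N (v z ω) ∂P) := by
  obtain ⟨Y₁, hY₁, h1, h2⟩ := h.exists_truncate hT.le hg hv hY hg0
    (ne_top_of_le_ne_top hWt hgW) N
  have hvt : Measurable fun z : (ℝ × ℝ) × Ω => truncate N (v z.1 z.2) :=
    (measurable_truncate N).comp hv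
  have b1 := h1.lintegral_pow_le_of_mul hT hg hvt hY₁ hL hg0 hm hW0 hWt hgW
  have b2 := h2.lintegral_pow_le_of_mul hT hg (hv.sub hvt) (hY.sub hY₁) hL hg0 le_rfl hW0 hWt hgW
  simp only [mul_one, tsub_self, pow_zero] at b2
  set J := ∫⁻ z in cell T L, ‖g z‖ₑ ^ 2 * ∫⁻ ω, truncPow m N (v z ω) ∂P
  have c1 : ∫⁻ ω, ‖Y₁ ω‖ₑ ^ (2 * m) ∂P ≤ momentConst m * (2 * W) ^ (m - 1) * J := by
    refine b1.trans (mul_le_mul' le_rfl (lintegral_mono fun z => mul_le_mul' le_rfl ?_))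
    exact lintegral_mono fun ω => enorm_truncate_pow_le hm N _
  have c2 : (N : ℝ≥0∞) ^ (2 * (m - 1)) * ∫⁻ ω, ‖Y ω - Y₁ ω‖ₑ ^ 2 ∂P ≤ momentConst 1 * J := by
    refine (mul_le_mul' le_rfl b2).trans ?_
    rw [mul_left_comm]
    refine mul_le_mul' le_rfl ?_
    rw [← lintegral_const_mul' _ _ (ENNReal.pow_ne_top (ENNReal.natCast_ne_top N))]
    refine lintegral_mono fun z => ?_
    simp only
    rw [mul_left_comm]
    refine mul_le_mul' le_rfl ?_
    rw [← lintegral_const_mul' _ _ (ENNReal.pow_ne_top (ENNReal.natCast_ne_top N))]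
    exact lintegral_mono fun ω => enorm_sub_truncate_sq_le m N _
  calc ∫⁻ ω, truncPow m N (c + Y ω) ∂P
      ≤ ∫⁻ ω, 3 ^ (2 * m) * (‖c‖ₑ ^ (2 * m) + ‖Y₁ ω‖ₑ ^ (2 * m)
          + (N : ℝ≥0∞) ^ (2 * (m - 1)) * ‖Y ω - Y₁ ω‖ₑ ^ 2) ∂P :=
        lintegral_mono fun ω => by
          have := truncPow_add_add_le hm N c (Y₁ ω) (Y ω - Y₁ ω)
          rwa [add_assoc c, add_sub_cancel] at this
    _ = 3 ^ (2 * m) * (‖c‖ₑ ^ (2 * m) + ∫⁻ ω, ‖Y₁ ω‖ₑ ^ (2 * m) ∂P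
          + (N : ℝ≥0∞) ^ (2 * (m - 1)) * ∫⁻ ω, ‖Y ω - Y₁ ω‖ₑ ^ 2 ∂P) := by
      have m1 : Measurable fun ω => ‖Y₁ ω‖ₑ ^ (2 * m) := hY₁.enorm.pow_const _
      have m2 : Measurable fun ω => ‖Y ω - Y₁ ω‖ₑ ^ 2 := (hY.sub hY₁).enorm.pow_const _
      have m3 : Measurable fun ω => ‖c‖ₑ ^ (2 * m) + ‖Y₁ ω‖ₑ ^ (2 * m)
          + (N : ℝ≥0∞) ^ (2 * (m - 1)) * ‖Y ω - Y₁ ω‖ₑ ^ 2 :=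
        (measurable_const.add m1).add (m2.const_mul _)
      rw [lintegral_const_mul _ m3, lintegral_add_right _ (m2.const_mul _), lintegral_add_right _ m1,
        lintegral_const_mul _ m2, lintegral_const, measure_univ, mul_one]
    _ ≤ _ := by
      rw [add_mul, add_assoc]
      gcongr

end WhiteNoise

/-! ### Moments of the mild solution -/

/-- The integrand `(s, y) ↦ G_{t-s}(x, y)` of the mild formulation. -/
noncomputable def mildKernel (bc : BoundaryCondition) (L t x : ℝ) : ℝ × ℝ → ℝ :=
  (Ioo 0 t ×ˢ Icc 0 L).indicator fun q => heatKernel bc L (t - q.1) x q.2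

lemma measurable_mildKernel (bc : BoundaryCondition) {L : ℝ} (hL : 1 ≤ L) (t x : ℝ) :
    Measurable (mildKernel bc L t x) :=
  (measurable_heatKernel_comp bc hL (measurable_const.sub measurable_fst) measurable_const
    measurable_snd).indicator (measurableSet_Ioo.prod measurableSet_Icc)

lemma mildKernel_of_notMem_cell (bc : BoundaryCondition) {T L t : ℝ} (htT : t ≤ T) (x : ℝ)
    {z : ℝ × ℝ} (hz : z ∉ cell T L) : mildKernel bc L t x z = 0 :=
  indicator_of_notMem (fun h => hz ⟨⟨h.1.1, h.1.2.le.trans htT⟩, h.2⟩) _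

/-- The squared kernel, integrated over space, is at most `4 κ / √(t - s)`. -/
lemma lintegral_mildKernel_sq_mul_le (bc : BoundaryCondition) {T L t : ℝ} (hL : 1 ≤ L)
    (htT : t ≤ T) {x : ℝ} (hx : x ∈ Icc 0 L) {F : ℝ → ℝ≥0∞} (hF : Measurable F) :
    ∫⁻ z in cell T L, ‖mildKernel bc L t x z‖ₑ ^ 2 * F (t - z.1) ≤
      ∫⁻ r in Ioc 0 T, ENNReal.ofReal (4 * kernelConst T / √r) * F r := by
  have hm := measurable_mildKernel bc hL t x
  have hm2 : Measurable fun z : ℝ × ℝ => ‖mildKernel bc L t x z‖ₑ ^ 2 * F (t - z.1) :=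
    (hm.enorm.pow_const 2).mul (hF.comp (measurable_const.sub measurable_fst))
  let K : ℝ → ℝ≥0∞ := (Ioc 0 T).indicator fun r => ENNReal.ofReal (4 * kernelConst T / √r) * F r
  rw [cell, Measure.volume_eq_prod, ← Measure.prod_restrict,
    lintegral_prod _ hm2.aemeasurable]
  calc ∫⁻ s in Ioc 0 T, ∫⁻ y in Icc 0 L, ‖mildKernel bc L t x (s, y)‖ₑ ^ 2 * F (t - s)
      ≤ ∫⁻ s in Ioc 0 T, K (t - s) := by
        refine setLIntegral_mono' measurableSet_Ioc fun s hs => ?_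
        have hms : Measurable fun y => ‖mildKernel bc L t x (s, y)‖ₑ ^ 2 :=
          (hm.comp measurable_prodMk_left).enorm.pow_const 2
        rw [lintegral_mul_const _ hms]
        rcases lt_or_ge s t with hst | hst
        · simp only [K]
          rw [indicator_of_mem (show t - s ∈ Ioc 0 T from ⟨by linarith, by linarith [hs.1]⟩)]
          refine mul_le_mul' (le_trans (le_of_eq ?_) (lintegral_heatKernel_sq_le bc hL
            (sub_pos.2 hst) (by linarith [hs.1]) hx)) le_rfl
          refine setLIntegral_congr_fun measurableSet_Icc fun y hy => ?_
          simp only [mildKernel]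
          rw [indicator_of_mem (show (s, y) ∈ Ioo 0 t ×ˢ Icc 0 L from ⟨⟨hs.1, hst⟩, hy⟩),
            Real.enorm_eq_ofReal_abs, ← ENNReal.ofReal_pow (abs_nonneg _), sq_abs]
        · have h0 : ∀ y, mildKernel bc L t x (s, y) = 0 := fun y =>
            indicator_of_notMem (fun h => absurd h.1.2 (not_lt.2 hst)) _
          simp [h0]
    _ ≤ ∫⁻ s, K (t - s) := setLIntegral_le_lintegral _ _
    _ = ∫⁻ r, K r := lintegral_sub_left_eq_self K t
    _ = _ := lintegral_indicator measurableSet_Ioc _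

/-- The mass of `4 κ / √r` on `(0, T]`, increased by one to be positive. -/
noncomputable def kernelMass (T : ℝ) : ℝ≥0∞ :=
  (∫⁻ r in Ioc 0 T, ENNReal.ofReal (4 * kernelConst T / √r)) + 1

lemma lintegral_kernelConst_ne_top (T : ℝ) :
    ∫⁻ r in Ioc 0 T, ENNReal.ofReal (4 * kernelConst T / √r) ≠ ∞ := by
  rcases le_or_gt T 0 with hT | hT
  · simp [Ioc_eq_empty (not_lt.2 hT)]
  have h : IntegrableOn (fun r : ℝ => r ^ (-(1 / 2) : ℝ)) (Ioc 0 T) :=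
    (intervalIntegrable_iff_integrableOn_Ioc_of_le hT.le).1
      (intervalIntegral.intervalIntegrable_rpow' (by norm_num))
  have h2 : IntegrableOn (fun r : ℝ => 4 * kernelConst T / √r) (Ioc 0 T) := by
    have h1 : IntegrableOn (fun r : ℝ => 4 * kernelConst T * r ^ (-(1 / 2) : ℝ)) (Ioc 0 T) :=
      h.const_mul _
    refine h1.congr_fun (fun r hr => ?_) measurableSet_Ioc
    simp only
    rw [Real.rpow_neg hr.1.le, ← Real.sqrt_eq_rpow, div_eq_mul_inv]
  exact (h2.lintegral_lt_top).ne

lemma kernelMass_ne_top (T : ℝ) : kernelMass T ≠ ∞ :=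
  ENNReal.add_ne_top.2 ⟨lintegral_kernelConst_ne_top T, ENNReal.one_ne_top⟩

lemma kernelMass_ne_zero (T : ℝ) : kernelMass T ≠ 0 := by simp [kernelMass]

lemma lintegral_mildKernel_sq_le (bc : BoundaryCondition) {T L t : ℝ} (hL : 1 ≤ L)
    (htT : t ≤ T) {x : ℝ} (hx : x ∈ Icc 0 L) :
    ∫⁻ z in cell T L, ‖mildKernel bc L t x z‖ₑ ^ 2 ≤ kernelMass T := by
  have h := lintegral_mildKernel_sq_mul_le bc hL htT hx (F := fun _ => 1) measurable_const
  simp only [mul_one] at h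
  exact h.trans le_self_add

/-- A sufficiently strong exponential weight makes the kernel `4 κ / √r` arbitrarily small. -/
lemma exists_lintegral_exp_le (T : ℝ) {ε : ℝ≥0∞} (hε : 0 < ε) :
    ∃ β : ℝ, 0 ≤ β ∧ ∫⁻ r in Ioc 0 T, ENNReal.ofReal (4 * kernelConst T / √r)
      * ENNReal.ofReal (Real.exp (-(β * r))) ≤ ε := by
  have hmk : Measurable fun r : ℝ => ENNReal.ofReal (4 * kernelConst T / √r) :=
    (measurable_const.div Real.continuous_sqrt.measurable).ennreal_ofReal
  have h : Tendsto (fun n : ℕ => ∫⁻ r in Ioc 0 T, ENNReal.ofReal (4 * kernelConst T / √r)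
      * ENNReal.ofReal (Real.exp (-((n : ℝ) * r)))) atTop (𝓝 (∫⁻ r in Ioc 0 T, 0)) := by
    refine tendsto_lintegral_of_dominated_convergence
      (fun r => ENNReal.ofReal (4 * kernelConst T / √r)) (fun n => ?_) (fun n => ?_)
      (lintegral_kernelConst_ne_top T) ?_
    · exact hmk.mul (by fun_prop)
    · filter_upwards [ae_restrict_mem measurableSet_Ioc] with r hr
      refine mul_le_of_le_one_right zero_le ?_
      rw [← ENNReal.ofReal_one]
      refine ENNReal.ofReal_le_ofReal (Real.exp_le_one_iff.2 ?_)
      have := mul_nonneg (Nat.cast_nonneg (α := ℝ) n) hr.1.le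
      linarith
    · filter_upwards [ae_restrict_mem measurableSet_Ioc] with r hr
      have h1 : Tendsto (fun n : ℕ => Real.exp (-((n : ℝ) * r))) atTop (𝓝 0) :=
        Real.tendsto_exp_neg_atTop_nhds_zero.comp
          (tendsto_natCast_atTop_atTop.atTop_mul_const hr.1)
      have h2 := ENNReal.tendsto_ofReal h1
      rw [ENNReal.ofReal_zero] at h2
      have h3 := ENNReal.Tendsto.const_mul (a := ENNReal.ofReal (4 * kernelConst T / √r)) h2
        (Or.inr ENNReal.ofReal_ne_top)
      rwa [mul_zero] at h3
  rw [lintegral_zero] at h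
  obtain ⟨n, hn⟩ := (h.eventually (eventually_le_nhds hε)).exists
  exact ⟨n, n.cast_nonneg, hn⟩

namespace IsMildSolution

/-- The solution, extended by zero to all space-time points. -/
noncomputable def extension {Ω : Type*} (T L : ℝ) (u : ℝ → ℝ → Ω → ℝ) (q : ℝ × ℝ) (ω : Ω) : ℝ :=
  (Icc 0 T ×ˢ Icc 0 L).indicator (fun q => u q.1 q.2 ω) q

lemma extension_of_mem {Ω : Type*} {T L : ℝ} (u : ℝ → ℝ → Ω → ℝ) {q : ℝ × ℝ} (hq : q ∈ Icc 0 T ×ˢ Icc 0 L)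
    (ω : Ω) : extension T L u q ω = u q.1 q.2 ω := indicator_of_mem hq _

variable {Ω : Type*} [mΩ : MeasurableSpace Ω] {T : ℝ} {P : Measure Ω} {η : WhiteNoise T P}
  {bc : BoundaryCondition} {L : ℝ} {u : ℝ → ℝ → Ω → ℝ}

lemma measurable_extension (hu : IsMildSolution bc η L u) :
    Measurable fun z : (ℝ × ℝ) × Ω => extension T L u z.1 z.2 := by
  refine (congrArg Measurable (funext fun z => ?_)).mp hu.measurable
  by_cases hz : z.1 ∈ Icc 0 T ×ˢ Icc 0 L
  · rw [extension_of_mem u hz, indicator_of_mem (show z ∈ (Icc 0 T ×ˢ Icc 0 L) ×ˢ univ from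
      ⟨hz, trivial⟩)]
  · rw [extension, indicator_of_notMem hz, indicator_of_notMem fun h => hz h.1]

lemma measurable_apply (hu : IsMildSolution bc η L u) {t x : ℝ} (ht : t ∈ Icc 0 T)
    (hx : x ∈ Icc 0 L) : Measurable (u t x) :=
  (hu.adapted t ht x hx).mono (η.filtration.le t) le_rfl

/-- The mild formulation, with the integrand written as `mildKernel` times `u`. -/
lemma isWalshIntegral (hu : IsMildSolution bc η L u) {t x : ℝ} (ht : t ∈ Ioc 0 T)
    (hx : x ∈ Icc 0 L) :
    η.IsWalshIntegral (fun q ω => mildKernel bc L t x q * extension T L u q ω)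
      fun ω => u t x ω - ∫ y in (0 : ℝ)..L, heatKernel bc L t x y := by
  refine (hu.mild t ht x hx).congr (ae_of_all _ fun z => ?_) (ae_of_all _ fun _ => rfl)
  simp only [mildKernel]
  by_cases hz : z.1 ∈ Ioo 0 t ×ˢ Icc 0 L
  · rw [indicator_of_mem hz, indicator_of_mem hz, extension_of_mem u]
    exact ⟨⟨hz.1.1.le, hz.1.2.le.trans ht.2⟩, hz.2⟩
  · rw [indicator_of_notMem hz, indicator_of_notMem hz, zero_mul]

/-- The moments of the solution are bounded, by constants depending on `T` and the order only. The
truncated moments satisfy a linear Volterra inequality with the kernel `4 κ / √r`, which is closed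
by an exponential weight in time since they are finite; the truncation is then removed by
Fatou's lemma. -/
theorem exists_lintegral_pow_le (T : ℝ) (hT : 0 < T) {m : ℕ} (hm : 1 ≤ m) :
    ∃ C : ℝ≥0, ∀ {Ω : Type*} [MeasurableSpace Ω] {P : Measure Ω} [IsProbabilityMeasure P]
      {η : WhiteNoise T P} {bc : BoundaryCondition} {L : ℝ} {u : ℝ → ℝ → Ω → ℝ}, 1 ≤ L →
      IsMildSolution bc η L u → ∀ t ∈ Icc 0 T, ∀ x ∈ Icc 0 L,
        ∫⁻ ω, ‖u t x ω‖ₑ ^ (2 * m) ∂P ≤ C := by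
  let A₁ : ℝ≥0∞ := momentConst m * (2 * kernelMass T) ^ (m - 1) + momentConst 1
  have hA₁t : A₁ ≠ ∞ := ENNReal.add_ne_top.2 ⟨ENNReal.mul_ne_top ENNReal.coe_ne_top
    (ENNReal.pow_ne_top (ENNReal.mul_ne_top ENNReal.ofNat_ne_top (kernelMass_ne_top T))),
    ENNReal.coe_ne_top⟩
  let D : ℝ≥0∞ := 3 ^ (2 * m) * A₁
  have hDt : D ≠ ∞ := ENNReal.mul_ne_top (ENNReal.pow_ne_top ENNReal.ofNat_ne_top) hA₁t
  obtain ⟨β, hβ0, hβ⟩ := exists_lintegral_exp_le T (ε := (2 * D)⁻¹)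
    (ENNReal.inv_pos.2 (ENNReal.mul_ne_top ENNReal.ofNat_ne_top hDt))
  let A : ℝ≥0∞ := 3 ^ (2 * m) * 2 ^ (2 * m)
  have hAt : A ≠ ∞ := ENNReal.mul_ne_top (ENNReal.pow_ne_top ENNReal.ofNat_ne_top)
    (ENNReal.pow_ne_top ENNReal.ofNat_ne_top)
  have hA1 : 1 ≤ A := one_le_mul (one_le_pow₀ (by norm_num)) (one_le_pow₀ (by norm_num))
  have hCt : ENNReal.ofReal (Real.exp (β * T)) * (2 * A) ≠ ∞ :=
    ENNReal.mul_ne_top ENNReal.ofReal_ne_top (ENNReal.mul_ne_top ENNReal.ofNat_ne_top hAt)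
  refine ⟨(ENNReal.ofReal (Real.exp (β * T)) * (2 * A)).toNNReal, ?_⟩
  intro Ω _ P _ η bc L u hL hu t ht x hx
  rw [ENNReal.coe_toNNReal hCt]
  have hL0 : 0 < L := zero_lt_one.trans_le hL
  -- the weights `e^{-βt}`
  let E : ℝ → ℝ≥0∞ := fun s => ENNReal.ofReal (Real.exp (-(β * s)))
  let E' : ℝ → ℝ≥0∞ := fun s => ENNReal.ofReal (Real.exp (β * s))
  have hEE' : ∀ s, E' s * E s = 1 := fun s => by
    simp only [E, E']
    rw [← ENNReal.ofReal_mul (Real.exp_pos _).le, ← Real.exp_add, add_neg_cancel, Real.exp_zero,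
      ENNReal.ofReal_one]
  have hEadd : ∀ s r, E s * E' r = E (s - r) := fun s r => by
    simp only [E, E']
    rw [← ENNReal.ofReal_mul (Real.exp_pos _).le, ← Real.exp_add]
    ring_nf
  have hE1 : ∀ s, 0 ≤ s → E s ≤ 1 := fun s hs => by
    simp only [E]
    rw [← ENNReal.ofReal_one]
    refine ENNReal.ofReal_le_ofReal (Real.exp_le_one_iff.2 ?_)
    have := mul_nonneg hβ0 hs
    linarith
  have hEm : Measurable E := by simp only [E]; fun_prop
  have htrunc : ∀ N : ℕ, ∀ t ∈ Icc 0 T, ∀ x ∈ Icc 0 L,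
      ∫⁻ ω, truncPow m N (u t x ω) ∂P ≤ ENNReal.ofReal (Real.exp (β * T)) * (2 * A) := by
    intro N
    let f : ℝ × ℝ → ℝ≥0∞ := fun q => ∫⁻ ω, truncPow m N (u q.1 q.2 ω) ∂P
    let B : ℝ≥0∞ := ⨆ q ∈ Icc 0 T ×ˢ Icc 0 L, E q.1 * f q
    have hfB : ∀ q ∈ Icc 0 T ×ˢ Icc 0 L, E q.1 * f q ≤ B := fun q hq =>
      le_iSup₂ (f := fun q (_ : q ∈ Icc 0 T ×ˢ Icc 0 L) => E q.1 * f q) q hq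
    have hBt : B ≠ ∞ := by
      obtain ⟨C, hC⟩ := hu.bounded
      refine ne_top_of_le_ne_top (b := (N : ℝ≥0∞) ^ (2 * (m - 1)) * (C : ℝ≥0∞) ^ 2)
        (ENNReal.mul_ne_top (ENNReal.pow_ne_top (ENNReal.natCast_ne_top N))
          (ENNReal.pow_ne_top ENNReal.coe_ne_top)) (iSup₂_le fun q hq => ?_)
      refine (mul_le_of_le_one_left zero_le (hE1 _ hq.1.1)).trans ?_
      refine (lintegral_mono fun ω => truncPow_le_sq m N _).trans ?_
      rw [lintegral_const_mul' _ _ (ENNReal.pow_ne_top (ENNReal.natCast_ne_top N))]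
      refine mul_le_mul' le_rfl ?_
      have h2 := eLpNorm_natCast_pow (u q.1 q.2) two_ne_zero P
      rw [Nat.cast_two] at h2
      rw [← h2]
      exact pow_le_pow_left' (hC _ hq.1 _ hq.2) 2
    have hrec : ∀ q ∈ Icc 0 T ×ˢ Icc 0 L, E q.1 * f q ≤ A + B / 2 := by
      rintro ⟨t, x⟩ ⟨ht, hx⟩
      simp only at ht hx ⊢
      rcases ht.1.eq_or_lt with h0 | h0
      · subst h0
        have : f (0, x) ≤ 1 := by
          simp only [f]
          calc ∫⁻ ω, truncPow m N (u 0 x ω) ∂P ≤ ∫⁻ _, 1 ∂P := by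
                refine lintegral_mono_ae ?_
                filter_upwards [hu.initial x hx] with ω hω
                rw [hω]
                refine (truncPow_le_pow hm N 1).trans ?_
                simp
            _ = 1 := by simp
        calc E 0 * f (0, x) ≤ 1 * 1 := mul_le_mul' (hE1 0 le_rfl) this
          _ ≤ A := by rw [one_mul]; exact hA1
          _ ≤ _ := le_self_add
      · have hb := (hu.isWalshIntegral ⟨h0, ht.2⟩ hx).lintegral_truncPow_le hT
          (measurable_mildKernel bc hL t x) hu.measurable_extension
          ((hu.measurable_apply ht hx).sub_const _) hL0
          (fun z hz => mildKernel_of_notMem_cell bc ht.2 x hz) hm (kernelMass_ne_zero T)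
          (kernelMass_ne_top T) (lintegral_mildKernel_sq_le bc hL ht.2 hx)
          (∫ y in (0 : ℝ)..L, heatKernel bc L t x y) N
        simp only [add_sub_cancel] at hb
        have hc : ‖∫ y in (0 : ℝ)..L, heatKernel bc L t x y‖ₑ ≤ 2 := by
          rw [Real.enorm_eq_ofReal_abs, show (2 : ℝ≥0∞) = ENNReal.ofReal 2 by simp]
          exact ENNReal.ofReal_le_ofReal (abs_integral_heatKernel_right_le bc hL h0 x)
        have hJ : E t * ∫⁻ z in cell T L, ‖mildKernel bc L t x z‖ₑ ^ 2 *
            ∫⁻ ω, truncPow m N (extension T L u z ω) ∂P ≤ (2 * D)⁻¹ * B := by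
          rw [← lintegral_const_mul' _ _ ENNReal.ofReal_ne_top]
          calc _ ≤ ∫⁻ z in cell T L,
                (‖mildKernel bc L t x z‖ₑ ^ 2 * E (t - z.1)) * B := by
                refine setLIntegral_mono' (measurableSet_cell T L) fun z hz => ?_
                have hz' : z ∈ Icc 0 T ×ˢ Icc 0 L := ⟨Ioc_subset_Icc_self hz.1, hz.2⟩
                simp only [extension_of_mem u hz']
                calc E t * (‖mildKernel bc L t x z‖ₑ ^ 2 * f z)
                    = ‖mildKernel bc L t x z‖ₑ ^ 2 * (E t * ((E' z.1 * E z.1) * f z)) := by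
                      rw [hEE', one_mul]; ring
                  _ = ‖mildKernel bc L t x z‖ₑ ^ 2 * ((E t * E' z.1) * (E z.1 * f z)) := by ring
                  _ ≤ ‖mildKernel bc L t x z‖ₑ ^ 2 * (E (t - z.1) * B) := by
                      rw [hEadd]
                      gcongr
                      exact hfB z hz'
                  _ = _ := by ring
            _ = (∫⁻ z in cell T L, ‖mildKernel bc L t x z‖ₑ ^ 2 * E (t - z.1)) * B :=
                lintegral_mul_const' _ _ hBt
            _ ≤ _ := mul_le_mul'
                ((lintegral_mildKernel_sq_mul_le bc hL ht.2 hx hEm).trans hβ) le_rfl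
        have hD2 : D * (2 * D)⁻¹ ≤ 2⁻¹ := by
          rw [ENNReal.mul_inv (Or.inl two_ne_zero) (Or.inl ENNReal.ofNat_ne_top), mul_left_comm]
          exact mul_le_of_le_one_right zero_le (ENNReal.mul_inv_le_one D)
        calc E t * f (t, x) ≤ E t * (3 ^ (2 * m) * (2 ^ (2 * m) + A₁ *
              ∫⁻ z in cell T L, ‖mildKernel bc L t x z‖ₑ ^ 2 *
                ∫⁻ ω, truncPow m N (extension T L u z ω) ∂P)) := by
              refine mul_le_mul' le_rfl (hb.trans ?_)
              gcongr
          _ = E t * A + D * (E t * ∫⁻ z in cell T L, ‖mildKernel bc L t x z‖ₑ ^ 2 *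
                ∫⁻ ω, truncPow m N (extension T L u z ω) ∂P) := by
              simp only [A, D]; ring
          _ ≤ 1 * A + D * ((2 * D)⁻¹ * B) := by
              gcongr
              exact hE1 t ht.1
          _ ≤ A + B / 2 := by
              rw [one_mul, ← mul_assoc, ENNReal.div_eq_inv_mul]
              gcongr
    have hB2 : B ≤ 2 * A := by
      have h1 : B ≤ A + B / 2 := iSup₂_le hrec
      have h2 : B / 2 + B / 2 ≤ A + B / 2 := by rwa [ENNReal.add_halves]
      have h3 : B / 2 ≤ A := (ENNReal.add_le_add_iff_right
        (ENNReal.div_ne_top hBt two_ne_zero)).1 h2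
      rw [← ENNReal.add_halves B, two_mul]
      exact add_le_add h3 h3
    intro t ht x hx
    calc f (t, x) = E' t * (E t * f (t, x)) := by rw [← mul_assoc, hEE', one_mul]
      _ ≤ _ := by
        refine mul_le_mul' (ENNReal.ofReal_le_ofReal (Real.exp_le_exp.2 ?_))
          ((hfB (t, x) ⟨ht, hx⟩).trans hB2)
        exact mul_le_mul_of_nonneg_left ht.2 hβ0
  have hlim : ∫⁻ ω, ‖u t x ω‖ₑ ^ (2 * m) ∂P
      = ∫⁻ ω, liminf (fun N : ℕ => truncPow m N (u t x ω)) atTop ∂P :=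
    lintegral_congr fun ω => (tendsto_truncPow hm (u t x ω)).liminf_eq.symm
  rw [hlim]
  refine (lintegral_liminf_le fun N =>
    (measurable_truncPow m N).comp (hu.measurable_apply ht hx)).trans ?_
  refine (liminf_le_liminf (Eventually.of_forall fun N => htrunc N t ht x hx)).trans ?_
  simp

end IsMildSolution

/-! ### Fubini's theorem for the stochastic integral -/

namespace WhiteNoise

variable {Ω : Type*} [mΩ : MeasurableSpace Ω] {T : ℝ} {P : Measure Ω} {η : WhiteNoise T P}

lemma SimpleField.memLp_val [IsProbabilityMeasure P] (Φ : SimpleField η) :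
    MemLp (fun z : (ℝ × ℝ) × Ω => Φ.val z.1 z.2) 2 (fieldMeasure T P) := by
  refine memLp_finsetSum _ fun i _ => ?_
  obtain ⟨C, hC⟩ := Φ.bounded_coeff i
  have hbox := Φ.isNoiseSet_box' i
  have hm : MeasurableSet (Φ.box i ×ˢ (univ : Set Ω)) := hbox.1.prod .univ
  have hfin : fieldMeasure T P (Φ.box i ×ˢ univ) ≠ ∞ := by
    rw [fieldMeasure, Measure.prod_prod, measure_univ, mul_one]
    exact ((Measure.restrict_apply_le _ _).trans_lt hbox.2.2).ne
  have he : (fun z : (ℝ × ℝ) × Ω => (Φ.box i).indicator (fun _ => Φ.coeff i z.2) z.1)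
      = (Φ.box i ×ˢ univ).indicator fun z => Φ.coeff i z.2 := by
    ext z
    by_cases hz : z.1 ∈ Φ.box i
    · rw [indicator_of_mem hz, indicator_of_mem (show z ∈ Φ.box i ×ˢ univ from ⟨hz, trivial⟩)]
    · rw [indicator_of_notMem hz, indicator_of_notMem fun h => hz h.1]
  rw [he]
  refine (memLp_indicator_const 2 hm C (Or.inr hfin)).mono
    (((Φ.measurable_coeff' i).comp measurable_snd).indicator hm).aestronglyMeasurable
    (ae_of_all _ fun z => ?_)
  by_cases hz : z ∈ Φ.box i ×ˢ (univ : Set Ω)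
  · rw [indicator_of_mem hz, indicator_of_mem hz]
    exact (hC z.2).trans (le_abs_self C)
  · rw [indicator_of_notMem hz, indicator_of_notMem hz]

lemma SimpleField.memLp_integral [IsProbabilityMeasure P] (Φ : SimpleField η) (hT : 0 ≤ T) :
    MemLp Φ.integral 2 P :=
  ⟨Φ.measurable_integral.aestronglyMeasurable, (Φ.eLpNorm_integral_le hT).trans_lt
    (ENNReal.mul_lt_top ENNReal.coe_lt_top Φ.memLp_val.2)⟩

/-- The graph of the stochastic integral on simple fields, as a subspace of the Hilbert sum of
`L²([0, T] × ℝ × Ω)` and `L²(Ω)`. -/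
def simpleGraph (η : WhiteNoise T P) :
    Submodule ℝ (WithLp 2 (Lp ℝ 2 (fieldMeasure T P) × Lp ℝ 2 P)) where
  carrier := {p | ∃ Ψ : SimpleField η,
    p.fst =ᵐ[fieldMeasure T P] (fun z => Ψ.val z.1 z.2) ∧ p.snd =ᵐ[P] Ψ.integral}
  add_mem' := by
    rintro p q ⟨Ψ, h1, h2⟩ ⟨Ψ', h1', h2'⟩
    refine ⟨Ψ.add Ψ', ?_, ?_⟩
    · filter_upwards [Lp.coeFn_add p.fst q.fst, h1, h1'] with z hz h h'
      rw [WithLp.add_fst, hz, Pi.add_apply, h, h', SimpleField.val_add]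
    · filter_upwards [Lp.coeFn_add p.snd q.snd, h2, h2'] with ω hω h h'
      rw [WithLp.add_snd, hω, Pi.add_apply, h, h', SimpleField.integral_add]
  zero_mem' := by
    refine ⟨SimpleField.zero η, ?_, ?_⟩
    · filter_upwards [Lp.coeFn_zero ℝ 2 (fieldMeasure T P)] with z hz
      rw [WithLp.zero_fst, hz, SimpleField.val_zero, Pi.zero_apply]
    · filter_upwards [Lp.coeFn_zero ℝ 2 P] with ω hω
      rw [WithLp.zero_snd, hω, SimpleField.integral_zero, Pi.zero_apply]
  smul_mem' := by
    rintro c p ⟨Ψ, h1, h2⟩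
    refine ⟨SimpleField.smul c Ψ, ?_, ?_⟩
    · filter_upwards [Lp.coeFn_smul c p.fst, h1] with z hz h
      rw [WithLp.smul_fst, hz, Pi.smul_apply, h, SimpleField.val_smul, smul_eq_mul]
    · filter_upwards [Lp.coeFn_smul c p.snd, h2] with ω hω h
      rw [WithLp.smul_snd, hω, Pi.smul_apply, h, SimpleField.integral_smul, smul_eq_mul]

lemma isWalshIntegral_iff_mem_closure [IsProbabilityMeasure P] (hT : 0 ≤ T)
    {Φ : ℝ × ℝ → Ω → ℝ} {Y : Ω → ℝ}
    (hΦ : MemLp (fun z : (ℝ × ℝ) × Ω => Φ z.1 z.2) 2 (fieldMeasure T P)) (hY : MemLp Y 2 P) :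
    η.IsWalshIntegral Φ Y ↔
      WithLp.toLp 2 (hΦ.toLp _, hY.toLp _) ∈ η.simpleGraph.topologicalClosure := by
  have e1 : ∀ (q : Lp ℝ 2 (fieldMeasure T P)) (Ψ : SimpleField η),
      q =ᵐ[fieldMeasure T P] (fun z => Ψ.val z.1 z.2) → edist (hΦ.toLp _) q =
        eLpNorm (fun z : (ℝ × ℝ) × Ω => Ψ.val z.1 z.2 - Φ z.1 z.2) 2 (fieldMeasure T P) := by
    intro q Ψ hq
    rw [edist_comm, Lp.edist_def]
    refine eLpNorm_congr_ae ?_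
    filter_upwards [hq, hΦ.coeFn_toLp] with z h1 h2
    rw [Pi.sub_apply, h1, h2]
  have e2 : ∀ (q : Lp ℝ 2 P) (Ψ : SimpleField η), q =ᵐ[P] Ψ.integral → edist (hY.toLp _) q =
        eLpNorm (fun ω => Ψ.integral ω - Y ω) 2 P := by
    intro q Ψ hq
    rw [edist_comm, Lp.edist_def]
    refine eLpNorm_congr_ae ?_
    filter_upwards [hq, hY.coeFn_toLp] with z h1 h2
    rw [Pi.sub_apply, h1, h2]
  rw [isWalshIntegral_iff, ← SetLike.mem_coe, Submodule.topologicalClosure_coe,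
    EMetric.mem_closure_iff]
  constructor
  · intro h ε hε
    obtain ⟨δ, hδ0, hδ⟩ : ∃ δ : ℝ≥0∞, 0 < δ ∧ δ + δ < ε := by
      obtain ⟨δ, hδ0, hδ⟩ := exists_between (ENNReal.half_pos hε.ne')
      exact ⟨δ, hδ0, (ENNReal.add_lt_add hδ hδ).trans_le (ENNReal.add_halves ε).le⟩
    obtain ⟨Ψ, h1, h2⟩ := h δ hδ0
    refine ⟨WithLp.toLp 2 (Ψ.memLp_val.toLp _, (Ψ.memLp_integral hT).toLp _),
      ⟨Ψ, Ψ.memLp_val.coeFn_toLp, (Ψ.memLp_integral hT).coeFn_toLp⟩, lt_of_le_of_lt ?_ hδ⟩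
    rw [← e1 _ Ψ Ψ.memLp_val.coeFn_toLp] at h1
    rw [← e2 _ Ψ (Ψ.memLp_integral hT).coeFn_toLp] at h2
    rw [WithLp.prod_edist_eq_of_L2]
    refine le_trans ?_ (add_le_add h1 h2)
    rw [one_div, ENNReal.rpow_inv_le_iff two_pos, ENNReal.rpow_two]
    rw [add_sq]
    exact add_le_add le_self_add le_rfl
  · intro h ε hε
    obtain ⟨q, ⟨Ψ, h1, h2⟩, hq⟩ := h ε hε
    have f1 := WithLp.edist_fst_le (p := 2) (WithLp.toLp 2 (hΦ.toLp _, hY.toLp _)) q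
    have f2 := WithLp.edist_snd_le (p := 2) (WithLp.toLp 2 (hΦ.toLp _, hY.toLp _)) q
    exact ⟨Ψ, (e1 q.fst Ψ h1).symm.trans_le (f1.trans hq.le),
      (e2 q.snd Ψ h2).symm.trans_le (f2.trans hq.le)⟩

/-- A pair `(Φ, Y)` of square integrable functions satisfies `Y = ∫ Φ dη` if and only if it is
orthogonal to every pair that is orthogonal to the graph of the integral. Unlike the definition, this
condition is visibly stable under averaging over a parameter. -/
lemma isWalshIntegral_iff_orthogonal [IsProbabilityMeasure P] (hT : 0 ≤ T)
    {Φ : ℝ × ℝ → Ω → ℝ} {Y : Ω → ℝ}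
    (hΦ : MemLp (fun z : (ℝ × ℝ) × Ω => Φ z.1 z.2) 2 (fieldMeasure T P)) (hY : MemLp Y 2 P) :
    η.IsWalshIntegral Φ Y ↔ ∀ p ∈ η.simpleGraphᗮ,
      ∫ z, Φ z.1 z.2 * p.fst z ∂(fieldMeasure T P) + ∫ ω, Y ω * p.snd ω ∂P = 0 := by
  rw [isWalshIntegral_iff_mem_closure hT hΦ hY, ← Submodule.orthogonal_orthogonal_eq_closure,
    Submodule.mem_orthogonal]
  refine forall₂_congr fun p _ => ?_
  rw [WithLp.prod_inner_apply, L2.inner_def, L2.inner_def]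
  have i1 : ∫ z, inner ℝ (p.fst z) (hΦ.toLp _ z) ∂(fieldMeasure T P)
      = ∫ z, Φ z.1 z.2 * p.fst z ∂(fieldMeasure T P) := by
    refine integral_congr_ae ?_
    filter_upwards [hΦ.coeFn_toLp] with z hz
    rw [hz]; rfl
  have i2 : ∫ ω, inner ℝ (p.snd ω) (hY.toLp _ ω) ∂P = ∫ ω, Y ω * p.snd ω ∂P := by
    refine integral_congr_ae ?_
    filter_upwards [hY.coeFn_toLp] with z hz
    rw [hz]; rfl
  rw [← i1, ← i2]
  rfl

lemma memLp_two_iff {α : Type*} [MeasurableSpace α] {μ : Measure α} {f : α → ℝ} :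
    MemLp f 2 μ ↔ AEStronglyMeasurable f μ ∧ ∫⁻ x, ‖f x‖ₑ ^ 2 ∂μ < ∞ := by
  have h := eLpNorm_natCast_pow f two_ne_zero μ
  rw [Nat.cast_two] at h
  rw [MemLp, ← h]
  simp [ENNReal.pow_lt_top_iff]

lemma memLp_integral_left {α β : Type*} [MeasurableSpace α] [MeasurableSpace β] {ν : Measure α}
    [IsFiniteMeasure ν] {μ : Measure β} [SFinite μ] {f : α × β → ℝ} (hf : Measurable f)
    (hf2 : MemLp f 2 (ν.prod μ)) : MemLp (fun y => ∫ x, f (x, y) ∂ν) 2 μ := by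
  rw [memLp_two_iff] at hf2 ⊢
  refine ⟨hf.stronglyMeasurable.integral_prod_left'.aestronglyMeasurable, ?_⟩
  have hle : ∀ y, ‖∫ x, f (x, y) ∂ν‖ₑ ^ 2 ≤ ν univ * ∫⁻ x, ‖f (x, y)‖ₑ ^ 2 ∂ν := fun y => by
    have h := lintegral_pow_le_weight (μ := ν) (m := 2) one_le_two (w := fun _ => 1)
      (Q := fun x => ‖f (x, y)‖ₑ) measurable_const
      (hf.comp (measurable_id.prodMk measurable_const)).enorm (by simp) (by simp)
    refine (pow_le_pow_left' (enorm_integral_le_lintegral_enorm _) 2).trans (h.trans ?_)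
    simp
  calc ∫⁻ y, ‖∫ x, f (x, y) ∂ν‖ₑ ^ 2 ∂μ ≤ ∫⁻ y, ν univ * ∫⁻ x, ‖f (x, y)‖ₑ ^ 2 ∂ν ∂μ :=
        lintegral_mono hle
    _ = ν univ * ∫⁻ z, ‖f z‖ₑ ^ 2 ∂(ν.prod μ) := by
      rw [lintegral_const_mul' _ _ (measure_ne_top _ _),
        lintegral_prod_symm _ (hf.enorm.pow_const 2).aemeasurable]
    _ < ∞ := ENNReal.mul_lt_top (measure_lt_top _ _) hf2.2

lemma ae_memLp_prodMk {α β : Type*} [MeasurableSpace α] [MeasurableSpace β] {ν : Measure α}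
    {μ : Measure β} [SFinite μ] {f : α × β → ℝ} (hf : Measurable f)
    (hf2 : MemLp f 2 (ν.prod μ)) : ∀ᵐ x ∂ν, MemLp (fun y => f (x, y)) 2 μ := by
  have h := (memLp_two_iff.1 hf2).2
  rw [lintegral_prod _ (hf.enorm.pow_const 2).aemeasurable] at h
  filter_upwards [ae_lt_top (hf.enorm.pow_const 2).lintegral_prod_right' h.ne] with x hx
  exact memLp_two_iff.2 ⟨(hf.comp measurable_prodMk_left).aestronglyMeasurable, hx⟩

/-- Fubini's theorem: stochastic integration commutes with averaging over a parameter. -/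
theorem IsWalshIntegral.integral_param [IsProbabilityMeasure P] (hT : 0 ≤ T) {α : Type*}
    [MeasurableSpace α] {ν : Measure α} [IsFiniteMeasure ν] {Φ : α → ℝ × ℝ → Ω → ℝ}
    {Y : α → Ω → ℝ} (h : ∀ᵐ x ∂ν, η.IsWalshIntegral (Φ x) (Y x))
    (hΦm : Measurable fun p : α × ((ℝ × ℝ) × Ω) => Φ p.1 p.2.1 p.2.2)
    (hΦ2 : MemLp (fun p : α × ((ℝ × ℝ) × Ω) => Φ p.1 p.2.1 p.2.2) 2 (ν.prod (fieldMeasure T P)))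
    (hYm : Measurable fun p : α × Ω => Y p.1 p.2)
    (hY2 : MemLp (fun p : α × Ω => Y p.1 p.2) 2 (ν.prod P)) :
    η.IsWalshIntegral (fun z ω => ∫ x, Φ x z ω ∂ν) fun ω => ∫ x, Y x ω ∂ν := by
  refine (isWalshIntegral_iff_orthogonal hT (memLp_integral_left hΦm hΦ2)
    (memLp_integral_left hYm hY2)).2 fun p hp => ?_
  have i1 : Integrable (fun q : α × ((ℝ × ℝ) × Ω) => Φ q.1 q.2.1 q.2.2 * p.fst q.2)
      (ν.prod (fieldMeasure T P)) := hΦ2.integrable_mul ((Lp.memLp p.fst).comp_snd ν)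
  have i2 : Integrable (fun q : α × Ω => Y q.1 q.2 * p.snd q.2) (ν.prod P) :=
    hY2.integrable_mul ((Lp.memLp p.snd).comp_snd ν)
  have s1 : ∫ z, (∫ x, Φ x z.1 z.2 ∂ν) * p.fst z ∂(fieldMeasure T P)
      = ∫ x, ∫ z, Φ x z.1 z.2 * p.fst z ∂(fieldMeasure T P) ∂ν := by
    rw [integral_integral_swap (f := fun x (z : (ℝ × ℝ) × Ω) => Φ x z.1 z.2 * p.fst z) i1]
    simp only [integral_mul_const]
  have s2 : ∫ ω, (∫ x, Y x ω ∂ν) * p.snd ω ∂P = ∫ x, ∫ ω, Y x ω * p.snd ω ∂P ∂ν := by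
    rw [integral_integral_swap (f := fun x ω => Y x ω * p.snd ω) i2]
    simp only [integral_mul_const]
  rw [s1, s2, ← integral_add i1.integral_prod_left i2.integral_prod_left]
  refine integral_eq_zero_of_ae ?_
  filter_upwards [h, ae_memLp_prodMk hΦm hΦ2, ae_memLp_prodMk hYm hY2] with x hx h1 h2
  exact (isWalshIntegral_iff_orthogonal hT h1 h2).1 hx p hp

end WhiteNoise

/-! ### The averaged kernel -/

/-- The kernel `(s, y) ↦ ∫_0^L G_{t-s}(x, y) dx` appearing in the spatial average of the mild
formulation. -/
noncomputable def massKernel (bc : BoundaryCondition) (L t : ℝ) : ℝ × ℝ → ℝ :=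
  (Ioo 0 t ×ˢ Icc 0 L).indicator fun q => heatMass bc L (t - q.1) q.2

lemma measurable_massKernel (bc : BoundaryCondition) {L : ℝ} (hL : 1 ≤ L) (t : ℝ) :
    Measurable (massKernel bc L t) :=
  ((measurable_heatMass bc hL).comp
    ((measurable_const.sub measurable_fst).prodMk measurable_snd)).indicator
    (measurableSet_Ioo.prod measurableSet_Icc)

lemma massKernel_of_notMem_cell (bc : BoundaryCondition) {T L t : ℝ} (htT : t ≤ T)
    {z : ℝ × ℝ} (hz : z ∉ cell T L) : massKernel bc L t z = 0 :=
  indicator_of_notMem (fun h => hz ⟨⟨h.1.1, h.1.2.le.trans htT⟩, h.2⟩) _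

lemma setIntegral_mildKernel (bc : BoundaryCondition) {L : ℝ} (hL : 0 ≤ L) (t : ℝ) (z : ℝ × ℝ) :
    ∫ x in Icc 0 L, mildKernel bc L t x z = massKernel bc L t z := by
  simp only [mildKernel, massKernel]
  by_cases hz : z ∈ Ioo 0 t ×ˢ Icc 0 L
  · simp only [indicator_of_mem hz]
    rw [heatMass, intervalIntegral.integral_of_le hL, integral_Icc_eq_integral_Ioc]
  · simp only [indicator_of_notMem hz, integral_zero]

lemma lintegral_Ioi_inv_sq {δ : ℝ} (hδ : 0 < δ) :
    ∫⁻ r in Ioi δ, ENNReal.ofReal (4 * (δ / r) ^ 2) = ENNReal.ofReal (4 * δ) := by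
  have hint := integrableOn_Ioi_rpow_of_lt (a := -2) (by norm_num) hδ
  have hval := integral_Ioi_rpow_of_lt (a := -2) (by norm_num) hδ
  have e : ∀ r ∈ Ioi δ, 4 * (δ / r) ^ 2 = 4 * δ ^ 2 * r ^ (-2 : ℝ) := fun r hr => by
    have hr0 : 0 < r := hδ.trans hr
    rw [Real.rpow_neg hr0.le, Real.rpow_two]
    field_simp
  rw [setLIntegral_congr_fun measurableSet_Ioi fun r hr => by rw [e r hr],
    ← ofReal_integral_eq_lintegral_ofReal, integral_const_mul, hval]
  · congr 1
    norm_num [Real.rpow_neg hδ.le]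
    field_simp
  · exact Integrable.const_mul hint _
  · filter_upwards [ae_restrict_mem measurableSet_Ioi] with r hr
    have hr0 : 0 < r := hδ.trans hr
    simp only [Pi.zero_apply]
    positivity

/-- The squared `L²` distance of the averaged kernels at two times is of the order of the time
difference times the length of the interval. At distance `r` from the earlier time, the integrand is
at most `16 ∧ 4 (δ / r)²`, where `δ` is the time difference. -/
lemma lintegral_massKernel_sub_sq_le (bc : BoundaryCondition) {T L t₁ t₂ : ℝ} (hL : 1 ≤ L)
    (h12 : t₁ < t₂) :
    ∫⁻ z in cell T L, ‖massKernel bc L t₂ z - massKernel bc L t₁ z‖ₑ ^ 2 ≤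
      ENNReal.ofReal (24 * (t₂ - t₁) * L) := by
  set δ := t₂ - t₁ with hδdef
  have hδ : 0 < δ := sub_pos.2 h12
  let b : ℝ → ℝ≥0∞ := fun r => (Ioc 0 δ).indicator (fun _ => ENNReal.ofReal 16) r
    + (Ioi δ).indicator (fun r => ENNReal.ofReal (4 * (δ / r) ^ 2)) r
  let F : ℝ → ℝ≥0∞ := fun s => (Ico t₁ t₂).indicator (fun _ => ENNReal.ofReal 4) s + b (t₁ - s)
  have hq : Measurable fun r : ℝ => ENNReal.ofReal (4 * (δ / r) ^ 2) := by fun_prop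
  have hb : Measurable b :=
    (measurable_const.indicator measurableSet_Ioc).add (hq.indicator measurableSet_Ioi)
  have hF : Measurable F := (measurable_const.indicator measurableSet_Ico).add
    (hb.comp (measurable_const.sub measurable_id))
  have hsq : ∀ a c : ℝ, 0 ≤ c → |a| ≤ c → ‖a‖ₑ ^ 2 ≤ ENNReal.ofReal (c ^ 2) := fun a c hc h => by
    rw [Real.enorm_eq_ofReal_abs, ENNReal.ofReal_pow hc]
    exact pow_le_pow_left' (ENNReal.ofReal_le_ofReal h) 2
  have hpt : ∀ z ∈ cell T L, ‖massKernel bc L t₂ z - massKernel bc L t₁ z‖ₑ ^ 2 ≤ F z.1 := by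
    rintro ⟨s, y⟩ ⟨hs, hy⟩
    simp only at hs hy ⊢
    have hmem : ∀ t, s < t → massKernel bc L t (s, y) = heatMass bc L (t - s) y := fun t ht =>
      indicator_of_mem (show (s, y) ∈ Ioo 0 t ×ˢ Icc 0 L from ⟨⟨hs.1, ht⟩, hy⟩) _
    have hnot : ∀ t, t ≤ s → massKernel bc L t (s, y) = 0 := fun t ht =>
      indicator_of_notMem (fun h => absurd h.1.2 (not_lt.2 ht)) _
    rcases lt_or_ge s t₁ with h1 | h1
    · rw [hmem _ (h1.trans h12), hmem _ h1]
      have hr : 0 < t₁ - s := sub_pos.2 h1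
      refine le_trans ?_ (le_add_self : b (t₁ - s) ≤ F s)
      rcases le_or_gt (t₁ - s) δ with h2 | h2
      · refine le_trans ?_ (le_self_add (a := (Ioc 0 δ).indicator _ (t₁ - s)))
        rw [indicator_of_mem (show t₁ - s ∈ Ioc 0 δ from ⟨hr, h2⟩)]
        refine (hsq _ 4 (by norm_num) ?_).trans (by norm_num)
        have a1 := abs_heatMass_le bc hL (t₂ - s) y
        have a2 := abs_heatMass_le bc hL (t₁ - s) y
        have a3 := abs_sub (heatMass bc L (t₂ - s) y) (heatMass bc L (t₁ - s) y)
        linarith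
      · refine le_trans ?_ (le_add_self (a := (Ioi δ).indicator _ (t₁ - s)))
        rw [indicator_of_mem (show t₁ - s ∈ Ioi δ from h2)]
        have a1 := abs_heatMass_add_sub_le bc hL hr hδ.le y
        rw [show t₁ - s + δ = t₂ - s by rw [hδdef]; ring] at a1
        refine (hsq _ _ (by positivity) a1).trans (le_of_eq ?_)
        rw [mul_pow]
        norm_num
    · rw [hnot _ h1, sub_zero]
      rcases lt_or_ge s t₂ with h2 | h2
      · rw [hmem _ h2]
        refine le_trans ?_ (le_self_add (a := (Ico t₁ t₂).indicator _ s))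
        rw [indicator_of_mem (show s ∈ Ico t₁ t₂ from ⟨h1, h2⟩)]
        exact (hsq _ 2 (by norm_num) (abs_heatMass_le bc hL _ y)).trans (by norm_num)
      · rw [hnot _ h2]
        simp
  calc _ ≤ ∫⁻ z in cell T L, F z.1 := setLIntegral_mono' (measurableSet_cell T L) hpt
    _ = (∫⁻ s in Ioc 0 T, F s) * ENNReal.ofReal L := by
      rw [cell, Measure.volume_eq_prod, ← Measure.prod_restrict,
        lintegral_prod (fun z : ℝ × ℝ => F z.1) (hF.comp measurable_fst).aemeasurable]
      simp only [lintegral_const, Measure.restrict_apply_univ, Real.volume_Icc, sub_zero]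
      exact lintegral_mul_const _ hF
    _ ≤ (∫⁻ s, F s) * ENNReal.ofReal L := mul_le_mul' (setLIntegral_le_lintegral _ _) le_rfl
    _ = (ENNReal.ofReal (4 * δ) + (ENNReal.ofReal (16 * δ) + ENNReal.ofReal (4 * δ)))
          * ENNReal.ofReal L := by
      congr 1
      simp only [F]
      rw [lintegral_add_left (measurable_const.indicator measurableSet_Ico),
        lintegral_sub_left_eq_self b t₁,
        lintegral_add_left (measurable_const.indicator measurableSet_Ioc),
        lintegral_indicator_const measurableSet_Ico, lintegral_indicator_const measurableSet_Ioc,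
        lintegral_indicator measurableSet_Ioi, lintegral_Ioi_inv_sq hδ, Real.volume_Ico,
        Real.volume_Ioc, sub_zero, ← ENNReal.ofReal_mul (by norm_num),
        ← ENNReal.ofReal_mul (by norm_num)]
    _ = _ := by
      rw [← ENNReal.ofReal_add (by positivity) (by positivity),
        ← ENNReal.ofReal_add (by positivity) (by positivity), ← ENNReal.ofReal_mul (by positivity)]
      congr 1
      ring

/-! ### Spatial averages -/

lemma memLp_two_prod_of_le {α β : Type*} [MeasurableSpace α] [MeasurableSpace β] {ν : Measure α}
    {μ : Measure β} [SFinite μ] {f : α × β → ℝ} (hf : Measurable f) {s : Set α}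
    (hs : MeasurableSet s) (hν : ν s ≠ ∞) {B : ℝ≥0∞} (hB : B ≠ ∞)
    (h : ∀ x ∈ s, ∫⁻ y, ‖f (x, y)‖ₑ ^ 2 ∂μ ≤ B) : MemLp f 2 ((ν.restrict s).prod μ) := by
  refine WhiteNoise.memLp_two_iff.2 ⟨hf.aestronglyMeasurable, ?_⟩
  rw [lintegral_prod _ (hf.enorm.pow_const 2).aemeasurable]
  refine (setLIntegral_mono' hs h).trans_lt ?_
  rw [setLIntegral_const]
  exact ENNReal.mul_lt_top hB.lt_top hν.lt_top

namespace IsMildSolution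

variable {Ω : Type*} [mΩ : MeasurableSpace Ω] {T : ℝ} {P : Measure Ω} {η : WhiteNoise T P}
  {bc : BoundaryCondition} {L : ℝ} {u : ℝ → ℝ → Ω → ℝ}

/-- The mild formulation for the centred solution, including the initial time. -/
lemma isWalshIntegral_sub_integral [IsProbabilityMeasure P] (hu : IsMildSolution bc η L u)
    {t x : ℝ} (ht : t ∈ Icc 0 T) (hx : x ∈ Icc 0 L) :
    η.IsWalshIntegral (fun q ω => mildKernel bc L t x q * extension T L u q ω)
      fun ω => u t x ω - ∫ ω', u t x ω' ∂P := by
  rcases ht.1.eq_or_lt with h0 | h0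
  · subst h0
    refine (WhiteNoise.SimpleField.zero η).isWalshIntegral.congr (ae_of_all _ fun z => ?_) ?_
    · simp only [WhiteNoise.SimpleField.val_zero, mildKernel, Ioo_self, empty_prod,
        indicator_empty, zero_mul]
    · have hE : ∫ ω', u 0 x ω' ∂P = 1 := by
        rw [integral_congr_ae (hu.initial x hx)]
        simp
      filter_upwards [hu.initial x hx] with ω hω
      rw [hω, hE, sub_self, WhiteNoise.SimpleField.integral_zero]
  · have h := hu.isWalshIntegral ⟨h0, ht.2⟩ hx
    have hm := hu.measurable_apply ht hx
    have hE := h.integral_eq_zero (hm.sub_const _).aestronglyMeasurable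
    obtain ⟨C, hC⟩ := hu.bounded
    have hint : Integrable (u t x) P :=
      MemLp.integrable one_le_two ⟨hm.aestronglyMeasurable, (hC t ht x hx).trans_lt
        ENNReal.coe_lt_top⟩
    rw [integral_sub hint (integrable_const _)] at hE
    simp only [integral_const, probReal_univ, one_smul] at hE
    rwa [← sub_eq_zero.1 hE] at h

lemma lintegral_mildKernel_mul_sq_le [IsProbabilityMeasure P] (hL : 1 ≤ L)
    (hu : IsMildSolution bc η L u) {C : ℝ≥0}
    (hC : ∀ t ∈ Icc 0 T, ∀ x ∈ Icc 0 L, eLpNorm (u t x) 2 P ≤ C) {t : ℝ} (ht : t ∈ Icc 0 T)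
    {x : ℝ} (hx : x ∈ Icc 0 L) :
    ∫⁻ z : (ℝ × ℝ) × Ω, ‖mildKernel bc L t x z.1 * extension T L u z.1 z.2‖ₑ ^ 2
      ∂(WhiteNoise.fieldMeasure T P) ≤ kernelMass T * C ^ 2 := by
  let f : (ℝ × ℝ) × Ω → ℝ≥0∞ := fun z =>
    ‖mildKernel bc L t x z.1 * extension T L u z.1 z.2‖ₑ ^ 2
  have hf : Measurable f := ((((measurable_mildKernel bc hL t x).comp measurable_fst).mul
    hu.measurable_extension).enorm).pow_const 2
  have hf0 : ∀ z : (ℝ × ℝ) × Ω, z.1 ∉ cell T L → f z = 0 := fun z hz => by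
    simp only [f, mildKernel_of_notMem_cell bc ht.2 x hz, zero_mul, enorm_zero]
    exact zero_pow two_ne_zero
  calc ∫⁻ z, f z ∂(WhiteNoise.fieldMeasure T P)
      = ∫⁻ z in cell T L, ∫⁻ ω, f (z, ω) ∂P := by
        rw [WhiteNoise.lintegral_fieldMeasure_eq hf0, WhiteNoise.cellMeasure,
          lintegral_prod _ hf.aemeasurable]
    _ ≤ ∫⁻ z in cell T L, ‖mildKernel bc L t x z‖ₑ ^ 2 * (C : ℝ≥0∞) ^ 2 := by
        refine setLIntegral_mono' (measurableSet_cell T L) fun z hz => ?_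
        have hz' : z ∈ Icc 0 T ×ˢ Icc 0 L := ⟨Ioc_subset_Icc_self hz.1, hz.2⟩
        simp only [f, extension_of_mem u hz', enorm_mul, mul_pow]
        rw [lintegral_const_mul' _ _ (ENNReal.pow_ne_top enorm_ne_top)]
        refine mul_le_mul' le_rfl ?_
        have h2 := eLpNorm_natCast_pow (u z.1 z.2) two_ne_zero P
        rw [Nat.cast_two] at h2
        rw [← h2]
        exact pow_le_pow_left' (hC _ hz'.1 _ hz'.2) 2
    _ = (∫⁻ z in cell T L, ‖mildKernel bc L t x z‖ₑ ^ 2) * (C : ℝ≥0∞) ^ 2 :=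
        lintegral_mul_const' _ _ (ENNReal.pow_ne_top ENNReal.coe_ne_top)
    _ ≤ _ := mul_le_mul' (lintegral_mildKernel_sq_le bc hL ht.2 hx) le_rfl

/-- Stochastic Fubini for the mild formulation. -/
lemma isWalshIntegral_spatial [IsProbabilityMeasure P] (hT : 0 ≤ T) (hL : 1 ≤ L)
    (hu : IsMildSolution bc η L u) {t : ℝ} (ht : t ∈ Icc 0 T) :
    Measurable (fun ω => ∫ x in (0 : ℝ)..L, (u t x ω - ∫ ω', u t x ω' ∂P)) ∧
    η.IsWalshIntegral (fun q ω => massKernel bc L t q * extension T L u q ω)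
      fun ω => ∫ x in (0 : ℝ)..L, (u t x ω - ∫ ω', u t x ω' ∂P) := by
  have hL0 : 0 ≤ L := zero_le_one.trans hL
  let Y : ℝ → Ω → ℝ := fun x ω => extension T L u (t, x) ω - ∫ ω', extension T L u (t, x) ω' ∂P
  have hYu : ∀ x ∈ Icc 0 L, Y x = fun ω => u t x ω - ∫ ω', u t x ω' ∂P := fun x hx => by
    ext ω
    simp only [Y, extension_of_mem u (show (t, x) ∈ Icc 0 T ×ˢ Icc 0 L from ⟨ht, hx⟩)]
  have hint : (fun ω => ∫ x in (0 : ℝ)..L, (u t x ω - ∫ ω', u t x ω' ∂P))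
      = fun ω => ∫ x in Icc 0 L, Y x ω := by
    ext ω
    rw [intervalIntegral.integral_of_le hL0, ← integral_Icc_eq_integral_Ioc]
    exact setIntegral_congr_fun measurableSet_Icc fun x hx => (congrFun (hYu x hx) ω).symm
  have hext : Measurable fun p : ℝ × Ω => extension T L u (t, p.1) p.2 :=
    hu.measurable_extension.comp (f := fun p : ℝ × Ω => ((t, p.1), p.2))
      ((measurable_const.prodMk measurable_fst).prodMk measurable_snd)
  have hYm : Measurable fun p : ℝ × Ω => Y p.1 p.2 :=
    hext.sub (hext.stronglyMeasurable.integral_prod_right'.measurable.comp measurable_fst)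
  have hΦm : Measurable fun p : ℝ × ((ℝ × ℝ) × Ω) =>
      mildKernel bc L t p.1 p.2.1 * extension T L u p.2.1 p.2.2 := by
    have hk : Measurable fun p : ℝ × (ℝ × ℝ) => mildKernel bc L t p.1 p.2 := by
      have h1 : Measurable fun p : ℝ × (ℝ × ℝ) => heatKernel bc L (t - p.2.1) p.1 p.2.2 :=
        measurable_heatKernel_comp bc hL (measurable_const.sub measurable_snd.fst) measurable_fst
          measurable_snd.snd
      exact h1.indicator (measurable_snd (measurableSet_Ioo.prod measurableSet_Icc))
    exact (hk.comp (f := fun p : ℝ × ((ℝ × ℝ) × Ω) => (p.1, p.2.1))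
      (measurable_fst.prodMk measurable_snd.fst)).mul (hu.measurable_extension.comp measurable_snd)
  have hwalsh : ∀ x ∈ Icc 0 L,
      η.IsWalshIntegral (fun q ω => mildKernel bc L t x q * extension T L u q ω) (Y x) :=
    fun x hx => by
      rw [hYu x hx]
      exact hu.isWalshIntegral_sub_integral ht hx
  obtain ⟨C, hC⟩ := hu.bounded
  have hΦx := fun x hx => hu.lintegral_mildKernel_mul_sq_le hL hC ht (x := x) hx
  have hKC : kernelMass T * (C : ℝ≥0∞) ^ 2 ≠ ∞ :=
    ENNReal.mul_ne_top (kernelMass_ne_top T) (ENNReal.pow_ne_top ENNReal.coe_ne_top)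
  have hvol : volume (Icc 0 L) ≠ ∞ := by simp [Real.volume_Icc]
  have hfin : IsFiniteMeasure ((volume : Measure ℝ).restrict (Icc 0 L)) :=
    ⟨by rw [Measure.restrict_apply_univ]; exact hvol.lt_top⟩
  have hYx : ∀ x ∈ Icc 0 L, ∫⁻ ω, ‖Y x ω‖ₑ ^ 2 ∂P ≤
      (WhiteNoise.isometryConst : ℝ≥0∞) ^ 2 * (kernelMass T * C ^ 2) := fun x hx => by
    have hmx : Measurable fun z : (ℝ × ℝ) × Ω =>
        mildKernel bc L t x z.1 * extension T L u z.1 z.2 :=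
      ((measurable_mildKernel bc hL t x).comp measurable_fst).mul hu.measurable_extension
    have hb := pow_le_pow_left' ((hwalsh x hx).eLpNorm_le hT hmx.aestronglyMeasurable
      (hYm.comp measurable_prodMk_left).aestronglyMeasurable) 2
    have h1 := eLpNorm_natCast_pow (Y x) two_ne_zero P
    have h2 := eLpNorm_natCast_pow (fun z : (ℝ × ℝ) × Ω =>
        mildKernel bc L t x z.1 * extension T L u z.1 z.2) two_ne_zero (WhiteNoise.fieldMeasure T P)
    rw [Nat.cast_two] at h1 h2
    rw [mul_pow, h1, h2] at hb
    exact hb.trans (mul_le_mul' le_rfl (hΦx x hx))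
  have hmain := WhiteNoise.IsWalshIntegral.integral_param (η := η) hT
    (ν := volume.restrict (Icc 0 L))
    (Φ := fun x q ω => mildKernel bc L t x q * extension T L u q ω) (Y := Y)
    ((ae_restrict_mem measurableSet_Icc).mono hwalsh) hΦm
    (memLp_two_prod_of_le hΦm measurableSet_Icc hvol hKC hΦx) hYm
    (memLp_two_prod_of_le hYm measurableSet_Icc hvol
      (ENNReal.mul_ne_top (ENNReal.pow_ne_top ENNReal.coe_ne_top) hKC) hYx)
  rw [hint]
  refine ⟨hYm.stronglyMeasurable.integral_prod_left'.measurable, ?_⟩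
  simpa only [integral_mul_const, setIntegral_mildKernel bc hL0] using hmain

/-- The moment estimate for even integer exponents and ordered times. -/
lemma eLpNorm_spatialAverage_sub_le [IsProbabilityMeasure P] (hT : 0 < T) (hL : 1 ≤ L)
    (hu : IsMildSolution bc η L u) {m : ℕ} (hm : 1 ≤ m) {C : ℝ≥0}
    (hC : ∀ t ∈ Icc 0 T, ∀ x ∈ Icc 0 L, ∫⁻ ω, ‖u t x ω‖ₑ ^ (2 * m) ∂P ≤ C) {t₁ t₂ : ℝ}
    (ht₁ : t₁ ∈ Icc 0 T) (ht₂ : t₂ ∈ Icc 0 T) (h12 : t₁ < t₂) :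
    AEStronglyMeasurable (fun ω => spatialAverage P L u t₂ ω - spatialAverage P L u t₁ ω) P ∧
    eLpNorm (fun ω => spatialAverage P L u t₂ ω - spatialAverage P L u t₁ ω) (2 * m : ℕ) P ≤
      ENNReal.ofReal ((momentConst m * 2 ^ (m - 1) * C + 1 : ℝ≥0) * √24 *
        |t₂ - t₁| ^ (1 / 2 : ℝ) * L ^ (-(1 / 2) : ℝ)) := by
  have hL0 : 0 < L := zero_lt_one.trans_le hL
  have hδ : 0 < t₂ - t₁ := sub_pos.2 h12
  obtain ⟨m₁, w₁⟩ := hu.isWalshIntegral_spatial hT.le hL ht₁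
  obtain ⟨m₂, w₂⟩ := hu.isWalshIntegral_spatial hT.le hL ht₂
  let D : Ω → ℝ := fun ω => (∫ x in (0 : ℝ)..L, (u t₂ x ω - ∫ ω', u t₂ x ω' ∂P))
    - ∫ x in (0 : ℝ)..L, (u t₁ x ω - ∫ ω', u t₁ x ω' ∂P)
  have hD : Measurable D := m₂.sub m₁
  have hk : ∀ t, Measurable fun z : (ℝ × ℝ) × Ω => massKernel bc L t z.1 * extension T L u z.1 z.2 :=
    fun t => ((measurable_massKernel bc hL t).comp measurable_fst).mul hu.measurable_extension
  have hw : η.IsWalshIntegral (fun q ω => (massKernel bc L t₂ q - massKernel bc L t₁ q) *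
      extension T L u q ω) D := by
    have := w₂.sub w₁ (hk t₂).aestronglyMeasurable (hk t₁).aestronglyMeasurable
      m₂.aestronglyMeasurable m₁.aestronglyMeasurable
    simpa only [← sub_mul] using this
  set W : ℝ := 24 * (t₂ - t₁) * L with hWdef
  have hW : 0 < W := by positivity
  have hgW := lintegral_massKernel_sub_sq_le (T := T) bc hL h12
  have hmom := hw.lintegral_pow_le_of_mul hT
    ((measurable_massKernel bc hL t₂).sub (measurable_massKernel bc hL t₁)) hu.measurable_extension
    hD hL0 (fun z hz => by
      rw [massKernel_of_notMem_cell bc ht₂.2 hz, massKernel_of_notMem_cell bc ht₁.2 hz, sub_zero])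
    hm (W := ENNReal.ofReal W) (ENNReal.ofReal_pos.2 hW).ne' ENNReal.ofReal_ne_top hgW
  set M : ℝ≥0 := momentConst m * 2 ^ (m - 1) * C + 1 with hM
  have hfinal : eLpNorm D (2 * m : ℕ) P ≤ M * ENNReal.ofReal √W := by
    rw [← ENNReal.pow_le_pow_left_iff (n := 2 * m) (by omega), eLpNorm_natCast_pow D (by omega)]
    calc ∫⁻ ω, ‖D ω‖ₑ ^ (2 * m) ∂P
        ≤ momentConst m * (2 * ENNReal.ofReal W) ^ (m - 1) * (ENNReal.ofReal W * C) := by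
          refine hmom.trans (mul_le_mul' le_rfl ?_)
          calc _ ≤ ∫⁻ z in cell T L,
                ‖massKernel bc L t₂ z - massKernel bc L t₁ z‖ₑ ^ 2 * (C : ℝ≥0∞) := by
                refine setLIntegral_mono' (measurableSet_cell T L) fun z hz => ?_
                have hz' : z ∈ Icc 0 T ×ˢ Icc 0 L := ⟨Ioc_subset_Icc_self hz.1, hz.2⟩
                simp only [extension_of_mem u hz']
                exact mul_le_mul' le_rfl (hC _ hz'.1 _ hz'.2)
            _ ≤ _ := by
                rw [lintegral_mul_const' _ _ ENNReal.coe_ne_top]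
                exact mul_le_mul' hgW le_rfl
      _ = (momentConst m * 2 ^ (m - 1) * C : ℝ≥0) * ENNReal.ofReal W ^ m := by
          obtain ⟨n, rfl⟩ : ∃ n, m = n + 1 := ⟨m - 1, by omega⟩
          push_cast [Nat.add_sub_cancel]
          rw [mul_pow, pow_succ (ENNReal.ofReal W)]
          ring
      _ ≤ (M : ℝ≥0∞) ^ (2 * m) * ENNReal.ofReal W ^ m := by
          refine mul_le_mul' ?_ le_rfl
          rw [← ENNReal.coe_pow]
          refine ENNReal.coe_le_coe.2 (le_trans (le_self_add : _ ≤ M) ?_)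
          exact le_self_pow₀ le_add_self (by omega)
      _ = _ := by
          rw [mul_pow, pow_mul (ENNReal.ofReal √W), ← ENNReal.ofReal_pow (Real.sqrt_nonneg W),
            Real.sq_sqrt hW.le]
  have hS : (fun ω => spatialAverage P L u t₂ ω - spatialAverage P L u t₁ ω)
      = fun ω => L⁻¹ * D ω := by
    ext ω
    simp only [spatialAverage, D, mul_sub]
  rw [hS]
  refine ⟨(hD.const_mul _).aestronglyMeasurable, ?_⟩
  have hsm : eLpNorm (fun ω => L⁻¹ * D ω) (2 * m : ℕ) P
      = ENNReal.ofReal L⁻¹ * eLpNorm D (2 * m : ℕ) P := by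
    have := eLpNorm_const_smul L⁻¹ D (2 * m : ℕ) P
    rwa [Real.enorm_eq_ofReal (inv_nonneg.2 hL0.le)] at this
  rw [hsm]
  refine (mul_le_mul' le_rfl hfinal).trans (le_of_eq ?_)
  rw [← ENNReal.ofReal_coe_nnreal, ← ENNReal.ofReal_mul M.coe_nonneg,
    ← ENNReal.ofReal_mul (inv_nonneg.2 hL0.le), abs_of_pos hδ, ← Real.sqrt_eq_rpow,
    Real.rpow_neg hL0.le, ← Real.sqrt_eq_rpow, hWdef, Real.sqrt_mul (by positivity),
    Real.sqrt_mul (by norm_num)]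
  congr 1
  have hsL : √L ≠ 0 := (Real.sqrt_pos.2 hL0).ne'
  have hLL : L⁻¹ * √L = (√L)⁻¹ := by
    rw [inv_mul_eq_iff_eq_mul₀ hL0.ne', eq_mul_inv_iff_mul_eq₀ hsL, Real.mul_self_sqrt hL0.le]
  rw [← hLL]
  ring

end IsMildSolution

end PAM

theorem proposition4p2 (T : ℝ) (hT : 0 < T) (k : ℝ) (hk : 2 ≤ k) :
    ∃ α : ℝ, 0 < α ∧
      ∀ (Ω : Type*) [MeasurableSpace Ω] (P : Measure Ω) [IsProbabilityMeasure P]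
        (η : PAM.WhiteNoise T P) (bc : PAM.BoundaryCondition) (L : ℝ), 1 ≤ L →
        ∀ u : ℝ → ℝ → Ω → ℝ, PAM.IsMildSolution bc η L u →
          ∀ t₁ ∈ Icc 0 T, ∀ t₂ ∈ Icc 0 T,
            MemLp (fun ω => PAM.spatialAverage P L u t₂ ω - PAM.spatialAverage P L u t₁ ω)
              (ENNReal.ofReal k) P ∧
            eLpNorm (fun ω => PAM.spatialAverage P L u t₂ ω - PAM.spatialAverage P L u t₁ ω)
              (ENNReal.ofReal k) P ≤
              ENNReal.ofReal (α * |t₂ - t₁| ^ (1 / 2 : ℝ) * L ^ (-(1 / 2) : ℝ)) := by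
  obtain ⟨m, hmk⟩ := exists_nat_ge k
  have hm : 1 ≤ m := by
    have : (1 : ℝ) ≤ m := by linarith
    exact_mod_cast this
  have hkm : ENNReal.ofReal k ≤ ((2 * m : ℕ) : ℝ≥0∞) := by
    rw [← ENNReal.ofReal_natCast]
    refine ENNReal.ofReal_le_ofReal ?_
    push_cast
    linarith
  obtain ⟨C, hC⟩ := PAM.IsMildSolution.exists_lintegral_pow_le T hT hm
  refine ⟨(PAM.momentConst m * 2 ^ (m - 1) * C + 1 : ℝ≥0) * √24, by positivity, ?_⟩
  intro Ω _ P _ η bc L hL u hu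
  have key : ∀ t₁ ∈ Icc 0 T, ∀ t₂ ∈ Icc 0 T, t₁ < t₂ →
      AEStronglyMeasurable
        (fun ω => PAM.spatialAverage P L u t₂ ω - PAM.spatialAverage P L u t₁ ω) P ∧
      eLpNorm (fun ω => PAM.spatialAverage P L u t₂ ω - PAM.spatialAverage P L u t₁ ω)
        (ENNReal.ofReal k) P ≤ ENNReal.ofReal ((PAM.momentConst m * 2 ^ (m - 1) * C + 1 : ℝ≥0) * √24
          * |t₂ - t₁| ^ (1 / 2 : ℝ) * L ^ (-(1 / 2) : ℝ)) := fun t₁ ht₁ t₂ ht₂ h12 => by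
    obtain ⟨h1, h2⟩ := hu.eLpNorm_spatialAverage_sub_le hT hL hm (hC hL hu) ht₁ ht₂ h12
    exact ⟨h1, (eLpNorm_le_eLpNorm_of_exponent_le hkm h1).trans h2⟩
  intro t₁ ht₁ t₂ ht₂
  rcases lt_trichotomy t₁ t₂ with h | h | h
  · obtain ⟨h1, h2⟩ := key t₁ ht₁ t₂ ht₂ h
    exact ⟨⟨h1, h2.trans_lt ENNReal.ofReal_lt_top⟩, h2⟩
  · subst h
    simp
  · obtain ⟨h1, h2⟩ := key t₂ ht₂ t₁ ht₁ h
    have e : (fun ω => PAM.spatialAverage P L u t₂ ω - PAM.spatialAverage P L u t₁ ω)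
        = -fun ω => PAM.spatialAverage P L u t₁ ω - PAM.spatialAverage P L u t₂ ω := by
      ext ω
      simp
    rw [e, eLpNorm_neg, abs_sub_comm]
    exact ⟨MemLp.neg ⟨h1, h2.trans_lt ENNReal.ofReal_lt_top⟩, h2⟩
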